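/- Let $I$ be a finite set and let $S\subset\mathbb R^I$ be a Clemens polytope, i.e. a finite simplicial complex whose faces are simplices $\Delta^F=\{x\in\mathbb R_{\ge 0}^I : \sum_i x_i=c,\ x_i=0 \text{ for } i\notin F\}$, where $c>0$ is fixed and $F$ runs over a family of non-empty subsets of $I$ that contains all singletons and is closed under passing to non-empty subsets. For a face $\Delta^F$ put $J_F=\{j\in I : \Delta^{F\cup\{j\}} \text{ is a face of } S\}$. A simple density $\omega$ on $S$ consists of $\omega_{F,j}\in(0,+\infty]$ for every face $\Delta^F$ and $j\in J_F$, such that $\omega_{F,j}\ge\omega_{F',j}$ whenever $F\supset F'$ and $j\in J_F$. An $n$-pointed parametrized tropical curve in $S$ consists of a connected finite graph $\Gamma$ without self-loops (multiple edges allowed), a continuous map $h:\Gamma\to S$ embedding every edge as an affine segment in a face of $S$, a weight vector $w_{(v,e)}\in\mathbb Z^I\setminus 0$ for every flag, parallel to $h(e)$ and pointing away from $h(v)$, with $w_{(u,e)}+w_{(v,e)}=0$ if $u,v$ are the endpoints of $e$, a genus $g(v)\in\mathbb Z_{\ge0}$ for every vertex, and marked vertices $\gamma_1,\dots,\gamma_n$.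 An $n$-pointed combinatorial type consists of the same data except that $h$ is replaced by a non-empty subset $I_v\subset I$ for every vertex $v$ (and there is no parallelism condition); a curve has the combinatorial type in which $h(v)$ lies in the relative interior of $\Delta^{I_v}$. A type is good if it is, up to isomorphism, the type of some curve. The genus is $b_1(\Gamma)+\sum_v g(v)$. With $\sigma_v=\sum_{e\ni v}w_{(v,e)}$, the tropical degree is $\sum_v\max_{j\in J_{I_v}}\omega_{I_v,j}|\sigma_v^j|$ (where $\infty\cdot 0=0$). A curve or type is simple if $\sigma_v\neq0$ for every vertex $v$ of degree $2$ with $g(v)=0$ that carries no marked point. Curves and types are considered up to isomorphism, and segments up to reparametrization. For a good type $\alpha$ with graph $\Gamma$ let $P_\alpha\subset(\mathbb R^I)^{V(\Gamma)}$ be the set of vertex positions $(h(v))_v$ of the curves with underlying data exactly $\alpha$, and let $\overline P_\alpha$ be its closure. Theorem. Fix integers $g,n\ge0$ and a real number $A>0$. Let $M=M_{g,n}(S,A)$ be the set of isomorphism classes of simple $n$-pointed genus $g$ parametrized tropical curves in $S$ of tropical degree $\le A$. (1) For every good simple $n$-pointed genus $g$ type $\alpha$ of degree $\le A$ and every $p\in\overline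 P_\alpha$, contracting all edges of length zero (a vertex arising from a connected subgraph $\Gamma'$ gets genus $b_1(\Gamma')+\sum_{v\in\Gamma'}g(v)$), and then simplifying (removing all vertices $v$ of degree $2$ with $\sigma_v=0$, $g(v)=0$ and no marked point, and joining the adjacent edges) gives a well-defined point $\iota_\alpha(p)\in M$. Equip $M$ with the finest topology for which all the maps $\iota_\alpha:\overline P_\alpha\to M$ are continuous. Then $M$ is a compact Hausdorff space. (2) Sending a type to the set $M_\alpha\subset M$ of curves of that type is a bijection from the set of isomorphism classes of good simple $n$-pointed genus $g$ combinatorial types of tropical degree $\le A$ onto a finite stratification of $M$: a finite partition into non-empty locally closed subsets such that the closure of each of them is a union of members of the partition. (3) For each such $\alpha$, the set $P_\alpha$ is a non-empty open convex polyhedron, i.e. it is defined in a real affine space (an affine subspace of $(\mathbb R^I)^{V(\Gamma)}$) by finitely many strict affine inequalities, and the natural map $P_\alpha\to M_\alpha$ is an open quotient map for the subspace topology of $M_\alpha\subset M$, whose fibres are the orbits of the finite automorphism group of $\alpha$. So $M_\alpha$ is the quotient of an open convex polyhedron by this finite group; in particular, if every automorphism of $\alpha$ fixes all vertices, then $P_\alpha\to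 M_\alpha$ is a homeomorphism. -/

import Mathlib

open Set Topology
open scoped ENNReal

namespace TropicalModuli

universe u

/-! ### Clemens polytopes and simple densities -/

/-- The combinatorial data of a Clemens polytope: the dual intersection complex on the set `I` of
irreducible components of the special fibre (`F` is a face iff `D_F` is non-empty), and the
positive number `scale` (the valuation of a uniformizer) such that the polytope lies in the
hyperplane `∑ x i = scale` of `ℝ^I`. -/
structure ClemensPolytope (I : Type u) where
  complex : AbstractSimplicialComplex I
  scale : ℝ
  scale_pos : 0 < scale

namespace ClemensPolytope

variable {I : Type u} (S : ClemensPolytope I)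

/-- The (non-empty) index sets of the faces. -/
def faces : Set (Finset I) := S.complex.faces

/-- The closed simplex `Δ^F` in `ℝ^I`. -/
def closedFace [Fintype I] (F : Finset I) : Set (I → ℝ) :=
  {x | (∀ i, 0 ≤ x i) ∧ ∑ i, x i = S.scale ∧ ∀ i, i ∉ F → x i = 0}

/-- The relative interior of the simplex `Δ^F`. -/
def openFace [Fintype I] (F : Finset I) : Set (I → ℝ) :=
  {x | x ∈ S.closedFace F ∧ ∀ i ∈ F, 0 < x i}

/-- The Clemens polytope as a subset of `ℝ^I`. -/
def carrier [Fintype I] : Set (I → ℝ) := ⋃ F ∈ S.faces, S.closedFace F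

/-- `J_F`, the set of `j` such that `D_{F ∪ {j}}` is non-empty. -/
def link [DecidableEq I] (F : Finset I) : Set I := {j | insert j F ∈ S.faces}

end ClemensPolytope

/-- A simple density on a Clemens polytope, with values in `(0, +∞]`.  (The values `ω F j` for
which `F` is not a face or `j ∉ J_F` play no role.) -/
structure SimpleDensity {I : Type u} [DecidableEq I] (S : ClemensPolytope I) where
  ω : Finset I → I → ℝ≥0∞
  pos : ∀ F ∈ S.faces, ∀ j ∈ S.link F, 0 < ω F j
  mono : ∀ F ∈ S.faces, ∀ F' ∈ S.faces, F' ⊆ F → ∀ j ∈ S.link F, ω F' j ≤ ω F j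

/-! ### Decorated graphs -/

/-- A connected finite graph without self-loops (multiple edges are allowed), with tropical weight
vectors on its flags, genera of vertices and `n` marked points.

An edge is a pair `{d, rev d}` of opposite darts.  As there are no self-loops, a dart `d` is the
same thing as a flag, namely the vertex `src d` together with an edge connected to it; the other
endpoint of that edge is `src (rev d)`.  Since curves and types are considered up to isomorphism,
vertices and darts are taken to be numbered. -/
structure DecoratedGraph (I : Type u) (n : ℕ) where
  numV : ℕ
  numD : ℕ
  src : Fin numD → Fin numV
  rev : Fin numD → Fin numD
  rev_rev : ∀ d, rev (rev d) = d
  no_loop : ∀ d, src (rev d) ≠ src d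
  numV_pos : 0 < numV
  connected : ∀ u v : Fin numV,
    Relation.ReflTransGen (fun a b => ∃ d, src d = a ∧ src (rev d) = b) u v
  weight : Fin numD → I → ℤ
  weight_ne_zero : ∀ d, weight d ≠ 0
  weight_rev : ∀ d, weight (rev d) = -weight d
  genus : Fin numV → ℕ
  mark : Fin n → Fin numV

namespace DecoratedGraph

variable {I : Type u} {n : ℕ} (G : DecoratedGraph I n)

/-- The endpoint of a dart. -/
def tgt (d : Fin G.numD) : Fin G.numV := G.src (G.rev d)

/-- The number of edges connected to `v`. -/
def degree (v : Fin G.numV) : ℕ := (Finset.univ.filter fun d => G.src d = v).card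

/-- `n(v)`, the number of marked points at `v`. -/
def numMarks (v : Fin G.numV) : ℕ := (Finset.univ.filter fun i => G.mark i = v).card

/-- `σ_v`, the sum of the weight vectors around `v`. -/
def weightSum (v : Fin G.numV) : I → ℤ :=
  ∑ d ∈ Finset.univ.filter (fun d => G.src d = v), G.weight d

/-- A vertex is of type A if the sum of weight vectors around it is nonzero, otherwise of type B. -/
def IsTypeA (v : Fin G.numV) : Prop := G.weightSum v ≠ 0

/-- Simplicity: every vertex with `deg v = 2` and `g(v) = n(v) = 0` is of type A. -/
def IsSimple : Prop :=
  ∀ v, G.degree v = 2 → G.genus v = 0 → G.numMarks v = 0 → G.IsTypeA v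

/-- The vertices that are removed by simplification. -/
def IsRemovable (v : Fin G.numV) : Prop :=
  G.degree v = 2 ∧ G.genus v = 0 ∧ G.numMarks v = 0 ∧ ¬ G.IsTypeA v

/-- `#edges - #vertices + 1` for the full subgraph generated by a set `W` of vertices; this is the
first Betti number of that subgraph whenever it is connected. (Each edge consists of two darts.) -/
def bettiOn (W : Finset (Fin G.numV)) : ℤ :=
  (((Finset.univ.filter fun d => G.src d ∈ W ∧ G.tgt d ∈ W).card / 2 : ℕ) : ℤ) - (W.card : ℤ) + 1

/-- The genus `b_1(Γ) + ∑ g(v)`. -/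
def totalGenus : ℤ := G.bettiOn Finset.univ + ∑ v, (G.genus v : ℤ)

/-- Isomorphisms of decorated graphs. -/
structure Iso {I : Type u} {n : ℕ} (G H : DecoratedGraph I n) where
  vert : Fin G.numV ≃ Fin H.numV
  dart : Fin G.numD ≃ Fin H.numD
  src_dart : ∀ d, H.src (dart d) = vert (G.src d)
  rev_dart : ∀ d, H.rev (dart d) = dart (G.rev d)
  weight_dart : ∀ d, H.weight (dart d) = G.weight d
  genus_vert : ∀ v, H.genus (vert v) = G.genus v
  mark_vert : ∀ i, H.mark i = vert (G.mark i)

/-- The identity isomorphism. -/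
def Iso.refl (G : DecoratedGraph I n) : Iso G G where
  vert := Equiv.refl _
  dart := Equiv.refl _
  src_dart _ := rfl
  rev_dart _ := rfl
  weight_dart _ := rfl
  genus_vert _ := rfl
  mark_vert _ := rfl

/-- The inverse isomorphism. -/
def Iso.symm {G H : DecoratedGraph I n} (φ : Iso G H) : Iso H G where
  vert := φ.vert.symm
  dart := φ.dart.symm
  src_dart d := by
    apply φ.vert.injective
    rw [← φ.src_dart]; simp
  rev_dart d := by
    apply φ.dart.injective
    rw [← φ.rev_dart]; simp
  weight_dart d := by rw [← φ.weight_dart]; simp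
  genus_vert v := by rw [← φ.genus_vert]; simp
  mark_vert i := by rw [φ.mark_vert]; simp

/-- The composition of isomorphisms. -/
def Iso.trans {G H K : DecoratedGraph I n} (φ : Iso G H) (ψ : Iso H K) : Iso G K where
  vert := φ.vert.trans ψ.vert
  dart := φ.dart.trans ψ.dart
  src_dart d := by simp [ψ.src_dart, φ.src_dart]
  rev_dart d := by simp [ψ.rev_dart, φ.rev_dart]
  weight_dart d := by simp [ψ.weight_dart, φ.weight_dart]
  genus_vert v := by simp [ψ.genus_vert, φ.genus_vert]
  mark_vert i := by simp [ψ.mark_vert, φ.mark_vert]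

/-- The conditions on a map `h` from the realization of `G` to the Clemens polytope which is affine
on every edge, expressed by the positions `p v = h v` of the vertices: vertices go to the polytope,
every edge goes to a segment in a face, and the weight vector `w_{(v,e)}` is parallel to the
direction of `h(e)` pointing away from `h(v)`.  (Since weight vectors are nonzero and integral, the
segment is then nondegenerate, so that the edge embeds, and it has rational slope.) -/
structure IsRealization [Fintype I] (S : ClemensPolytope I) (p : Fin G.numV → I → ℝ) : Prop where
  vertex_mem : ∀ v, p v ∈ S.carrier
  edge_mem : ∀ d, ∃ F ∈ S.faces, segment ℝ (p (G.src d)) (p (G.tgt d)) ⊆ S.closedFace F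
  parallel : ∀ d, ∃ l : ℝ, 0 < l ∧
    p (G.tgt d) - p (G.src d) = l • fun i => (G.weight d i : ℝ)

end DecoratedGraph

/-! ### Combinatorial types -/

/-- `n`-pointed combinatorial types in a Clemens polytope with index set `I`. -/
structure CombType (I : Type u) (n : ℕ) extends DecoratedGraph I n where
  face : Fin numV → Finset I
  face_nonempty : ∀ v, (face v).Nonempty

namespace CombType

variable {I : Type u} {n : ℕ}

/-- `φ` is an isomorphism of combinatorial types. -/
def IsIso (α β : CombType I n) (φ : α.toDecoratedGraph.Iso β.toDecoratedGraph) : Prop :=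
  ∀ v, β.face (φ.vert v) = α.face v

/-- Isomorphism of combinatorial types. -/
instance setoid (I : Type u) (n : ℕ) : Setoid (CombType I n) where
  r α β := ∃ φ, IsIso α β φ
  iseqv :=
    { refl := fun α => ⟨DecoratedGraph.Iso.refl _, fun _ => rfl⟩
      symm := fun {α β} ⟨φ, h⟩ =>
        ⟨φ.symm, fun v => by
          have := h (φ.vert.symm v)
          simpa [DecoratedGraph.Iso.symm] using this.symm⟩
      trans := fun {α β γ} ⟨φ, h⟩ ⟨ψ, k⟩ =>
        ⟨φ.trans ψ, fun v => by
          have h1 := h v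
          have h2 := k (φ.vert v)
          simp [DecoratedGraph.Iso.trans, h1, h2]⟩ }

variable [DecidableEq I] {S : ClemensPolytope I}

/-- The local degree `max_{j ∈ J_{I_v}} ω_{I_v, j} * |σ_v^j|`, with `∞ * 0 = 0`. -/
noncomputable def localDegree (α : CombType I n) (ω : SimpleDensity S) (v : Fin α.numV) : ℝ≥0∞ :=
  ⨆ j ∈ S.link (α.face v), ω.ω (α.face v) j * ((α.weightSum v j).natAbs : ℝ≥0∞)

/-- The tropical degree with respect to a simple density. -/
noncomputable def tropicalDegree (α : CombType I n) (ω : SimpleDensity S) : ℝ≥0∞ :=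
  ∑ v, α.localDegree ω v

end CombType

/-! ### Parametrized tropical curves -/

/-- `n`-pointed parametrized tropical curves in a Clemens polytope. -/
structure TropCurve {I : Type u} [Fintype I] (S : ClemensPolytope I) (n : ℕ) extends
    DecoratedGraph I n where
  pos : Fin numV → I → ℝ
  isRealization : toDecoratedGraph.IsRealization S pos

namespace TropCurve

variable {I : Type u} [Fintype I] {S : ClemensPolytope I} {n : ℕ}

/-- Isomorphism of parametrized tropical curves. -/
instance setoid (S : ClemensPolytope I) (n : ℕ) : Setoid (TropCurve S n) where
  r B C := ∃ φ : B.toDecoratedGraph.Iso C.toDecoratedGraph, ∀ v, C.pos (φ.vert v) = B.pos v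
  iseqv :=
    { refl := fun α => ⟨DecoratedGraph.Iso.refl _, fun _ => rfl⟩
      symm := fun {α β} ⟨φ, h⟩ =>
        ⟨φ.symm, fun v => by
          have := h (φ.vert.symm v)
          simpa [DecoratedGraph.Iso.symm] using this.symm⟩
      trans := fun {α β γ} ⟨φ, h⟩ ⟨ψ, k⟩ =>
        ⟨φ.trans ψ, fun v => by
          have h1 := h v
          have h2 := k (φ.vert v)
          simp [DecoratedGraph.Iso.trans, h1, h2]⟩ }

/-- The combinatorial type of a parametrized tropical curve: `I_v` is the set of indices such that
`h(v)` lies in the relative interior of `Δ^{I_v}`. -/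
noncomputable def type (C : TropCurve S n) : CombType I n where
  toDecoratedGraph := C.toDecoratedGraph
  face v := by
    classical
    exact Finset.univ.filter fun i => 0 < C.pos v i
  face_nonempty v := by
    classical
    by_contra h
    rw [Finset.not_nonempty_iff_eq_empty, Finset.filter_eq_empty_iff] at h
    obtain ⟨F, hF, hx⟩ := mem_iUnion₂.1 (C.isRealization.vertex_mem v)
    have h1 : ∑ i, C.pos v i ≤ 0 :=
      Finset.sum_nonpos fun i _ => not_lt.1 (h (Finset.mem_univ i))
    have h2 := S.scale_pos
    rw [← hx.2.1] at h2
    exact absurd h1 (not_le.2 h2)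

theorem mem_openFace_iff {F : Finset I} (C : TropCurve S n) (v : Fin C.numV) :
    C.pos v ∈ S.openFace F ↔ C.type.face v = F := by
  classical
  obtain ⟨F', hF', hx⟩ := mem_iUnion₂.1 (C.isRealization.vertex_mem v)
  constructor
  · intro h
    ext i
    simp only [type, Finset.mem_filter, Finset.mem_univ, true_and]
    refine ⟨fun hi => ?_, fun hi => h.2 i hi⟩
    by_contra hF
    exact hi.ne' (h.1.2.2 i hF)
  · rintro rfl
    refine ⟨⟨hx.1, hx.2.1, fun i hi => ?_⟩, fun i hi => ?_⟩
    · simp only [type, Finset.mem_filter, Finset.mem_univ, true_and, not_lt] at hi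
      exact le_antisymm hi (hx.1 i)
    · simpa [type] using hi

end TropCurve

namespace CombType

variable {I : Type u} [Fintype I] {n : ℕ}

/-- A combinatorial type is good if it comes from a parametrized tropical curve. -/
def IsGood (S : ClemensPolytope I) (α : CombType I n) : Prop :=
  ∃ C : TropCurve S n, C.type ≈ α

/-- The parametrized tropical curves with underlying combinatorial type exactly `α`, given by the
positions of the vertices in `ℝ^I`. -/
def realizations (S : ClemensPolytope I) (α : CombType I n) : Set (Fin α.numV → I → ℝ) :=
  {p | α.IsRealization S p ∧ ∀ v, p v ∈ S.openFace (α.face v)}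

/-- The curve with underlying graph that of `α` and given vertex positions. -/
def curve {S : ClemensPolytope I} (α : CombType I n) (p : α.realizations S) : TropCurve S n where
  toDecoratedGraph := α.toDecoratedGraph
  pos := p.1
  isRealization := p.2.1

theorem type_curve {S : ClemensPolytope I} (α : CombType I n) (p : α.realizations S) :
    (α.curve p).type = α := by
  have h : (α.curve p).type.face = α.face :=
    funext fun v => ((α.curve p).mem_openFace_iff v).1 (p.2.2 v)
  obtain ⟨G, f, hf⟩ := α
  change CombType.mk G _ _ = CombType.mk G _ _
  congr

end CombType

/-! ### The moduli space as a set, its strata -/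

section Moduli

variable {I : Type u} [Fintype I] [DecidableEq I] {S : ClemensPolytope I}

/-- Good simple `n`-pointed genus `g` combinatorial types of tropical degree at most `A`. -/
structure CombType.IsAdmissible {n : ℕ} (α : CombType I n) (ω : SimpleDensity S) (g : ℕ) (A : ℝ) :
    Prop where
  good : α.IsGood S
  simple : α.IsSimple
  genus : α.totalGenus = g
  degree : α.tropicalDegree ω ≤ ENNReal.ofReal A

/-- Simple `n`-pointed genus `g` parametrized tropical curves of tropical degree at most `A`. -/
def SimpleCurve (ω : SimpleDensity S) (g n : ℕ) (A : ℝ) : Type u :=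
  {C : TropCurve S n // C.IsSimple ∧ C.totalGenus = g ∧ C.type.tropicalDegree ω ≤ ENNReal.ofReal A}

/-- Isomorphism of parametrized tropical curves, on `SimpleCurve`. -/
instance SimpleCurve.setoid (ω : SimpleDensity S) (g n : ℕ) (A : ℝ) :
    Setoid (SimpleCurve ω g n A) :=
  (TropCurve.setoid S n).comap Subtype.val

/-- The set `M_{g,n}(S, A)` of isomorphism classes of simple `n`-pointed genus `g` parametrized
tropical curves whose tropical degree with respect to `ω` is bounded by `A`. -/
def Moduli (ω : SimpleDensity S) (g n : ℕ) (A : ℝ) : Type u :=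
  Quotient (SimpleCurve.setoid ω g n A)

/-- The point of the moduli space defined by a curve. -/
def Moduli.mk {ω : SimpleDensity S} {g n : ℕ} {A : ℝ} (C : SimpleCurve ω g n A) :
    Moduli ω g n A :=
  Quotient.mk _ C

/-- The isomorphism classes of good simple `n`-pointed genus `g` combinatorial types of tropical
degree at most `A`. -/
def admissibleTypes (ω : SimpleDensity S) (g n : ℕ) (A : ℝ) :
    Set (Quotient (CombType.setoid I n)) :=
  {τ | ∃ α : CombType I n, α.IsAdmissible ω g A ∧ Quotient.mk _ α = τ}

/-- The set of points of the moduli space with combinatorial type `τ`. -/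
def stratum (ω : SimpleDensity S) (g n : ℕ) (A : ℝ) (τ : Quotient (CombType.setoid I n)) :
    Set (Moduli ω g n A) :=
  {c | ∃ C : SimpleCurve ω g n A, Moduli.mk C = c ∧ Quotient.mk _ C.1.type = τ}

/-- The map from the realizations of an admissible type to its stratum. -/
def CombType.toStratum {n : ℕ} (α : CombType I n) {ω : SimpleDensity S} {g : ℕ} {A : ℝ}
    (h : α.IsAdmissible ω g A) (p : α.realizations S) :
    stratum ω g n A (Quotient.mk _ α) :=
  let C : SimpleCurve ω g n A :=
    ⟨α.curve p, h.simple, h.genus, by rw [α.type_curve p]; exact h.degree⟩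
  ⟨Moduli.mk C, C, rfl, congrArg _ (α.type_curve p)⟩

end Moduli

/-! ### The topology of the moduli space -/

/-- `B` is obtained from the graph `G` with vertex positions `p` (where edges may have length zero)
by contracting every connected subgraph that is mapped to a point by edges of length zero.
`vert` is the contraction on vertices, `dart` the inclusion of the remaining darts. -/
structure Contraction {I : Type u} [Fintype I] {S : ClemensPolytope I} {n : ℕ}
    (G : DecoratedGraph I n) (p : Fin G.numV → I → ℝ) (B : TropCurve S n) where
  vert : Fin G.numV → Fin B.numV
  vert_surjective : Function.Surjective vert
  vert_eq_iff : ∀ u v, vert u = vert v ↔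
    Relation.ReflTransGen (fun a b => ∃ d, G.src d = a ∧ G.tgt d = b ∧ p a = p b) u v
  dart : Fin B.numD → Fin G.numD
  dart_injective : Function.Injective dart
  range_dart : range dart = {d | p (G.src d) ≠ p (G.tgt d)}
  src_dart : ∀ d, B.src d = vert (G.src (dart d))
  rev_dart : ∀ d, dart (B.rev d) = G.rev (dart d)
  weight_dart : ∀ d, B.weight d = G.weight (dart d)
  pos_vert : ∀ v, B.pos (vert v) = p v
  genus_vert : ∀ b, (B.genus b : ℤ) = G.bettiOn (Finset.univ.filter fun v => vert v = b) +
    ∑ v ∈ Finset.univ.filter (fun v => vert v = b), (G.genus v : ℤ)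
  mark_vert : ∀ i, B.mark i = vert (G.mark i)

/-- The dart `d'` continues the dart `d` across a removable vertex. -/
def DecoratedGraph.Continues {I : Type u} {n : ℕ} (G : DecoratedGraph I n)
    (d d' : Fin G.numD) : Prop :=
  G.IsRemovable (G.tgt d) ∧ G.src d' = G.tgt d ∧ d' ≠ G.rev d

/-- `C` is the simplification of `B`: all removable vertices are removed, and every maximal chain
of edges through removable vertices is replaced by a single edge.  `vert` is the inclusion of the
remaining vertices, and `dart d` is the first dart of the chain which is replaced by `d`. -/
structure Simplification {I : Type u} [Fintype I] {S : ClemensPolytope I} {n : ℕ}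
    (B C : TropCurve S n) where
  vert : Fin C.numV → Fin B.numV
  vert_injective : Function.Injective vert
  range_vert : range vert = {v | ¬ B.IsRemovable v}
  dart : Fin C.numD → Fin B.numD
  dart_injective : Function.Injective dart
  range_dart : range dart = {d | ¬ B.IsRemovable (B.src d)}
  src_dart : ∀ d, B.src (dart d) = vert (C.src d)
  rev_dart : ∀ d, Relation.ReflTransGen B.Continues (dart d) (B.rev (dart (C.rev d)))
  weight_dart : ∀ d, C.weight d = B.weight (dart d)
  pos_vert : ∀ v, C.pos v = B.pos (vert v)
  genus_vert : ∀ v, C.genus v = B.genus (vert v)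
  mark_vert : ∀ i, vert (C.mark i) = B.mark i

section Topology

variable {I : Type u} [Fintype I] [DecidableEq I] {S : ClemensPolytope I}

/-- The relation `ι_α(p) = c` between vertex positions `p` in the closed polyhedron and points `c`
of the moduli space: `c` is the simplification of the contraction of `(α, p)`. -/
def IsLimit {n : ℕ} (α : CombType I n) (p : Fin α.numV → I → ℝ) {ω : SimpleDensity S} {g : ℕ}
    {A : ℝ} (c : Moduli ω g n A) : Prop :=
  ∃ (B : TropCurve S n) (C : SimpleCurve ω g n A),
    Nonempty (Contraction α.toDecoratedGraph p B) ∧ Nonempty (Simplification B C.1) ∧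
      Moduli.mk C = c

/-- The graph of the map `ι_α` from the closed polyhedron of `α` to the moduli space. -/
def LimitGraph {n : ℕ} (α : CombType I n) (ω : SimpleDensity S) (g : ℕ) (A : ℝ) : Type u :=
  {q : closure (α.realizations S) × Moduli ω g n A // IsLimit α q.1.1 q.2}

/-- The topology obtained by attaching the closed polyhedra of all good simple types along the maps
`ι_α`: the finest topology for which all `ι_α` are continuous.  (The graph of `ι_α` is identified
with the closed polyhedron by the first projection.) -/
instance (ω : SimpleDensity S) (g n : ℕ) (A : ℝ) : TopologicalSpace (Moduli ω g n A) :=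
  ⨆ α : {α : CombType I n // α.IsAdmissible ω g A},
    TopologicalSpace.coinduced (fun q : LimitGraph α.1 ω g A => q.1.2)
      (TopologicalSpace.induced (fun q : LimitGraph α.1 ω g A => q.1.1) inferInstance)

end Topology

/-! ### Open convex polyhedra and stratifications -/

/-- An open convex polyhedron in a real affine space: a subset of an affine subspace given by
finitely many strict affine inequalities. -/
def IsOpenConvexPolyhedron {E : Type*} [AddCommGroup E] [Module ℝ E] (P : Set E) : Prop :=
  ∃ (L : AffineSubspace ℝ E) (k : ℕ) (f : Fin k → E →ᵃ[ℝ] ℝ), P = {x | x ∈ L ∧ ∀ i, 0 < f i x}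

/-- A finite stratification of a topological space: a finite partition into (non-empty) locally
closed subsets such that the closure of every stratum is a union of strata. -/
structure IsFiniteStratification {X : Type*} [TopologicalSpace X] (𝒮 : Set (Set X)) : Prop where
  finite : 𝒮.Finite
  isPartition : Setoid.IsPartition 𝒮
  isLocallyClosed : ∀ s ∈ 𝒮, IsLocallyClosed s
  frontier : ∀ s ∈ 𝒮, ∀ t ∈ 𝒮, (s ∩ closure t).Nonempty → s ⊆ closure t

end TropicalModuli

/-!
# Moduli of simple parametrized tropical curves of bounded degree

Write `P_α` for the open polyhedron of vertex positions of an admissible type `α`. By definition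
the moduli space is glued from the closures of the `P_α` along the attaching maps `ι_α`. It is
compact Hausdorff because only finitely many closures occur, each of them is compact, and the pairs
of points that are identified form a closed set.

*Limits are well defined.* Both operations in the definition of `ι_α` are seen as instances of one
combinatorial notion, the `Collapse` of connected subgraphs of a graph: contraction collapses the
edges of length zero, and the removal of a single removable vertex `v` (`Removal`) collapses one of
the two edges at `v`. Collapses exist for every partition into connected subgraphs
(`exists_collapse`), factor through each other as the fibres tell (`Collapse.exists_cancel`), and
preserve the genus (`Collapse.totalGenus_eq`). Contractions are therefore unique up to isomorphism;
simplifications are so because a chain of edges through removable vertices is determined by its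
first dart. They exist by induction on the number of vertices: in a curve, the two edges at a
removable vertex form a straight segment, which lies in the face containing its interior point `v`.
The degree does not grow, since densities are monotone.

*Identifications are closed.* If `ι_α(p)` is the curve `C`, its vertices are certain vertices of
`α`, say via `s`. If `q` is another point such that all edges which have length zero for `p` also
have length zero for `q`, then the limit of `(α, q)` agrees with that of `(C, q ∘ s)`
(`IsLimitOf.specialize`). For a collapse of edges of length zero this is the factorization property.
For the removal of a vertex `v` either one of the edges at `v` has length zero for `q`, so that the
removal is such a collapse, or `v` stays removable in the contraction. Hence `ι_α(p) = ι_β(q)` forces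
`ι_α(p') = ι_β(q')` for all `(p', q')` that satisfy certain closed conditions, of which there are
only finitely many systems (`IsLimitOf.exists_relation`, `CombType.isClosed_limit_eq`). As the
closures are compact, the `ι_α` are closed maps, and the Hausdorff property follows.

*Finiteness.* The vertices with non-zero weight sum each contribute a definite amount to the degree;
the number of the others is bounded by an Euler characteristic argument (`DecoratedGraph.numV_le`).
A coordinate of a curve is a height function along which the corresponding weights flow upwards, so
every weight is at most the sum of the divergences of the flow (`DecoratedGraph.weight_le`).

*Strata.* For good types, faces of edges are determined by the type. So `P_α` is given by linear
equations and strict inequalities, and its closure by the corresponding weak ones. The closure of the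
stratum of `α` is the image of `ι_α`. A point of the boundary of `P_α` maps to a stratum of smaller
`CombType.rank`; this makes strata locally closed and makes `P_α` the full preimage of its stratum, so
that `P_α → M_α` is closed, hence also open, its fibres being orbits of a finite group. Finally, if
one curve of type `γ` is a limit of curves of type `α`, all of them are: their removed vertices can be
put back at midpoints (`Simplification.exists_extension`), and the weak inequalities for `α` only
depend on the type of the resulting curve.
-/

open Set Topology
open scoped ENNReal
namespace TropicalModuli
universe u

/-! ### Decorated graphs and their Betti numbers -/

theorem reflTransGen_imp {α : Type*} {r p : α → α → Prop} (h : ∀ a b, r a b → p a b) {u v : α}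
    (huv : Relation.ReflTransGen r u v) : Relation.ReflTransGen p u v :=
  Relation.ReflTransGen.mono (fun a b => h a b) u v huv

namespace DecoratedGraph
variable {I : Type u} {n : ℕ}

section Basic
variable (G : DecoratedGraph I n)

@[simp] theorem src_rev (d : Fin G.numD) : G.src (G.rev d) = G.tgt d := rfl

@[simp] theorem tgt_rev (d : Fin G.numD) : G.tgt (G.rev d) = G.src d := by
  simp [tgt, G.rev_rev]

theorem rev_injective : Function.Injective G.rev := fun a b h => by
  rw [← G.rev_rev a, h, G.rev_rev]

theorem tgt_ne_src (d : Fin G.numD) : G.tgt d ≠ G.src d := G.no_loop d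

theorem rev_ne (d : Fin G.numD) : G.rev d ≠ d := fun h => G.no_loop d (by rw [h])

/-- A set of darts that is stable under reversal has an even number of elements. -/
theorem even_card_of_rev_mem {s : Finset (Fin G.numD)} (h : ∀ d ∈ s, G.rev d ∈ s) :
    Even s.card := by
  have : ∑ _d ∈ s, (1 : ZMod 2) = 0 :=
    Finset.sum_involution (fun d _ => G.rev d) (fun _ _ => by decide)
      (fun d _ _ => G.rev_ne d) (fun d hd => h d hd) (fun d _ => G.rev_rev d)
  rw [← ZMod.natCast_eq_zero_iff_even]
  simpa using this

/-- The darts of the full subgraph generated by `W`. -/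
def dartsOn (W : Finset (Fin G.numV)) : Finset (Fin G.numD) :=
  Finset.univ.filter fun d => G.src d ∈ W ∧ G.tgt d ∈ W

theorem mem_dartsOn {W : Finset (Fin G.numV)} {d : Fin G.numD} :
    d ∈ G.dartsOn W ↔ G.src d ∈ W ∧ G.tgt d ∈ W := by simp [dartsOn]

theorem card_dartsOn (W : Finset (Fin G.numV)) :
    ((G.dartsOn W).card : ℤ) = 2 * (G.bettiOn W + W.card - 1) := by
  obtain ⟨k, hk⟩ := G.even_card_of_rev_mem (s := G.dartsOn W) (by
    intro d hd
    rw [mem_dartsOn] at hd ⊢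
    simpa using hd.symm)
  unfold bettiOn
  change _ = 2 * ((((G.dartsOn W).card / 2 : ℕ) : ℤ) - _ + 1 + _ - 1)
  rw [hk]
  have : (k + k) / 2 = k := by omega
  rw [this]; push_cast; ring

/-- A connected graph has non-negative first Betti number. -/
theorem bettiOn_nonneg {W : Finset (Fin G.numV)} (hW : W.Nonempty)
    (h : ∀ u ∈ W, ∀ v ∈ W, Relation.ReflTransGen
      (fun a b => ∃ d, G.src d = a ∧ G.tgt d = b ∧ b ∈ W) u v) : 0 ≤ G.bettiOn W := by
  classical
  let Q : SimpleGraph W := SimpleGraph.fromRel fun a b => ∃ d, G.src d = a ∧ G.tgt d = b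
  have hQ : Q.Connected := by
    have : Nonempty W := hW.to_subtype
    refine ⟨fun u v => ?_⟩
    have key : ∀ w, Relation.ReflTransGen
        (fun a b => ∃ d, G.src d = a ∧ G.tgt d = b ∧ b ∈ W) u.1 w →
        ∃ hw : w ∈ W, Q.Reachable u ⟨w, hw⟩ := by
      intro w hw
      induction hw with
      | refl => exact ⟨u.2, .refl _⟩
      | @tail b c _ hbc ih =>
        obtain ⟨hb, hr⟩ := ih
        obtain ⟨d, h1, h2, h3⟩ := hbc
        refine ⟨h3, hr.trans (SimpleGraph.Adj.reachable ?_)⟩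
        rw [SimpleGraph.fromRel_adj]
        refine ⟨fun e => G.tgt_ne_src d ?_, Or.inl ⟨d, h1, h2⟩⟩
        rw [h1, h2]; exact (congrArg Subtype.val e).symm
    exact (key v.1 (h u u.2 v v.2)).2
  have h1 := hQ.card_vert_le_card_edgeSet_add_one
  have h2 := Q.dart_card_eq_twice_card_edges
  have h3 : ∀ e : Q.Dart, ∃ d, G.src d = e.fst ∧ G.tgt d = e.snd := by
    intro e
    have := e.adj
    rw [SimpleGraph.fromRel_adj] at this
    obtain ⟨_, ⟨d, h⟩ | ⟨d, h⟩⟩ := this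
    · exact ⟨d, h⟩
    · exact ⟨G.rev d, by simp [h.1, h.2]⟩
  choose φ hφ1 hφ2 using h3
  have h4 : Fintype.card Q.Dart ≤ (G.dartsOn W).card := by
    rw [← Finset.card_univ]
    refine Finset.card_le_card_of_injOn φ (fun e _ => ?_) (fun e _ f _ hef => ?_)
    · simp [mem_dartsOn, hφ1, hφ2]
    · have h8 : e.fst = f.fst := Subtype.ext (by rw [← hφ1, hef, hφ1])
      have h9 : e.snd = f.snd := Subtype.ext (by rw [← hφ2, hef, hφ2])
      exact (SimpleGraph.Dart.ext_iff e f).2 (Prod.ext h8 h9)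
  have h5 := G.card_dartsOn W
  have h6 : Nat.card W = W.card := by simp
  have h7 : Nat.card Q.edgeSet = Q.edgeFinset.card := by
    rw [Nat.card_eq_fintype_card, SimpleGraph.edgeFinset_card]
  omega

theorem bettiOn_singleton (v : Fin G.numV) : G.bettiOn {v} = 0 := by
  have h := G.card_dartsOn {v}
  have : G.dartsOn {v} = ∅ := by
    ext d
    simp only [mem_dartsOn, Finset.mem_singleton, Finset.notMem_empty, iff_false, not_and]
    exact fun h1 h2 => G.tgt_ne_src d (h2.trans h1.symm)
  rw [this] at h
  simp at h
  exact h

theorem weight_real_ne_zero (d : Fin G.numD) :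
    (fun i => (G.weight d i : ℝ)) ≠ 0 := fun h =>
  G.weight_ne_zero d (funext fun i => by simpa using congrFun h i)

theorem sum_degree : ∑ v, G.degree v = G.numD := by
  have := Finset.card_eq_sum_card_fiberwise (f := G.src) (s := Finset.univ) (t := Finset.univ)
    (fun _ _ => by simp)
  simpa [degree] using this.symm

theorem sum_weightSum (W : Finset (Fin G.numV)) :
    ∑ v ∈ W, G.weightSum v = ∑ d ∈ Finset.univ.filter (fun d => G.src d ∈ W), G.weight d := by
  unfold weightSum
  rw [← Finset.sum_fiberwise_of_maps_to (s := Finset.univ.filter (fun d => G.src d ∈ W)) (t := W)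
    (g := G.src) (fun d hd => by simpa using hd)]
  refine Finset.sum_congr rfl fun v hv => Finset.sum_congr ?_ fun _ _ => rfl
  ext d
  simp only [Finset.mem_filter, Finset.mem_univ, true_and]
  exact ⟨fun h => ⟨h ▸ hv, h⟩, fun h => h.2⟩

/-- The weights of the two darts of an edge cancel. -/
theorem sum_weight_dartsOn (W : Finset (Fin G.numV)) : ∑ d ∈ G.dartsOn W, G.weight d = 0 := by
  refine Finset.sum_involution (fun d _ => G.rev d) (fun d _ => ?_) (fun d _ _ => G.rev_ne d)
    (fun d hd => ?_) (fun d _ => G.rev_rev d)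
  · rw [G.weight_rev, add_neg_cancel]
  · rw [mem_dartsOn] at hd ⊢
    simpa using hd.symm

end Basic

/-! ### Collapses -/

/-- A collapse of `G` onto `H`: connected subgraphs of `G` are contracted to vertices of `H`, and
the first Betti number of a contracted subgraph is added to the genus.  `vert` is the contraction
on vertices, and `dart` the inclusion of the remaining darts.  In contrast to `Contraction`, there
are no vertex positions. -/
structure Collapse (G H : DecoratedGraph I n) where
  vert : Fin G.numV → Fin H.numV
  vert_surjective : Function.Surjective vert
  fibre_connected : ∀ u v, vert u = vert v →
    Relation.ReflTransGen (fun a b => ∃ d, G.src d = a ∧ G.tgt d = b ∧ vert a = vert b) u v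
  dart : Fin H.numD → Fin G.numD
  dart_injective : Function.Injective dart
  range_dart : range dart = {d | vert (G.src d) ≠ vert (G.tgt d)}
  src_dart : ∀ d, H.src d = vert (G.src (dart d))
  rev_dart : ∀ d, dart (H.rev d) = G.rev (dart d)
  weight_dart : ∀ d, H.weight d = G.weight (dart d)
  genus_vert : ∀ b, (H.genus b : ℤ) = G.bettiOn (Finset.univ.filter fun v => vert v = b) +
    ∑ v ∈ Finset.univ.filter (fun v => vert v = b), (G.genus v : ℤ)
  mark_vert : ∀ i, H.mark i = vert (G.mark i)

namespace Collapse
variable {G H K : DecoratedGraph I n}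

theorem tgt_dart (f : Collapse G H) (d : Fin H.numD) : H.tgt d = f.vert (G.tgt (f.dart d)) := by
  rw [tgt, f.src_dart, f.rev_dart, src_rev]

theorem exists_dart (f : Collapse G H) {d : Fin G.numD}
    (h : f.vert (G.src d) ≠ f.vert (G.tgt d)) : ∃ e, f.dart e = d := by
  have : d ∈ range f.dart := by rw [f.range_dart]; exact h
  exact this

theorem vert_dart_ne (f : Collapse G H) (d : Fin H.numD) :
    f.vert (G.src (f.dart d)) ≠ f.vert (G.tgt (f.dart d)) := by
  have : f.dart d ∈ range f.dart := ⟨d, rfl⟩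
  rw [f.range_dart] at this
  exact this

/-- The fibre of a collapse over a vertex. -/
def fibre (f : Collapse G H) (b : Fin H.numV) : Finset (Fin G.numV) :=
  Finset.univ.filter fun v => f.vert v = b

/-- The preimage of a set of vertices. -/
def preimage (f : Collapse G H) (W : Finset (Fin H.numV)) : Finset (Fin G.numV) :=
  Finset.univ.filter fun v => f.vert v ∈ W

theorem mem_fibre (f : Collapse G H) {b v} : v ∈ f.fibre b ↔ f.vert v = b := by simp [fibre]

theorem mem_preimage (f : Collapse G H) {W v} : v ∈ f.preimage W ↔ f.vert v ∈ W := by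
  simp [preimage]

theorem sum_preimage {M : Type*} [AddCommMonoid M] (f : Collapse G H) (W : Finset (Fin H.numV))
    (φ : Fin G.numV → M) :
    ∑ b ∈ W, ∑ v ∈ f.fibre b, φ v = ∑ v ∈ f.preimage W, φ v := by
  rw [← Finset.sum_fiberwise_of_maps_to (s := f.preimage W) (t := W)
    (g := f.vert) (fun d hd => by simpa [preimage] using hd)]
  refine Finset.sum_congr rfl fun v hv => Finset.sum_congr ?_ fun _ _ => rfl
  ext d
  simp only [fibre, preimage, Finset.mem_filter, Finset.mem_univ, true_and]
  exact ⟨fun h => ⟨h ▸ hv, h⟩, fun h => h.2⟩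

theorem card_dartsOn_preimage (f : Collapse G H) (W : Finset (Fin H.numV)) :
    (G.dartsOn (f.preimage W)).card =
      (H.dartsOn W).card + ∑ b ∈ W, (G.dartsOn (f.fibre b)).card := by
  classical
  rw [← Finset.card_filter_add_card_filter_not (s := G.dartsOn (f.preimage W))
    (fun d => f.vert (G.src d) ≠ f.vert (G.tgt d))]
  congr 1
  · symm
    refine Finset.card_bij (fun d _ => f.dart d) (fun d hd => ?_)
      (fun d _ e _ h => f.dart_injective h) (fun d hd => ?_)
    · rw [mem_dartsOn, f.src_dart, f.tgt_dart] at hd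
      simp only [Finset.mem_filter, mem_dartsOn, mem_preimage]
      exact ⟨hd, f.vert_dart_ne d⟩
    · simp only [Finset.mem_filter, mem_dartsOn, mem_preimage] at hd
      obtain ⟨e, rfl⟩ := f.exists_dart hd.2
      exact ⟨e, by rw [mem_dartsOn, f.src_dart, f.tgt_dart]; exact hd.1, rfl⟩
  · rw [Finset.card_eq_sum_card_fiberwise (f := fun d => f.vert (G.src d)) (t := W)]
    · refine Finset.sum_congr rfl fun b hb => ?_
      congr 1
      ext d
      simp only [Finset.mem_filter, mem_dartsOn, mem_preimage, mem_fibre, not_not]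
      grind
    · intro d hd
      simp only [Finset.mem_coe, Finset.mem_filter, mem_dartsOn, mem_preimage] at hd
      exact hd.1.1

theorem card_preimage (f : Collapse G H) (W : Finset (Fin H.numV)) :
    (f.preimage W).card = ∑ b ∈ W, (f.fibre b).card := by
  simpa using (f.sum_preimage W (fun _ => (1 : ℕ))).symm

/-- Betti numbers are additive under collapses. -/
theorem bettiOn_preimage (f : Collapse G H) (W : Finset (Fin H.numV)) :
    G.bettiOn (f.preimage W) = H.bettiOn W + ∑ b ∈ W, G.bettiOn (f.fibre b) := by
  have h1 := G.card_dartsOn (f.preimage W)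
  have h2 := H.card_dartsOn W
  have h3 : ∀ b ∈ W, G.bettiOn (f.fibre b) * 2 =
      (G.dartsOn (f.fibre b)).card - 2 * ((f.fibre b).card : ℤ) + 2 := by
    intro b _
    have := G.card_dartsOn (f.fibre b)
    linarith
  have h4 := Finset.sum_congr rfl h3
  rw [← Finset.sum_mul, Finset.sum_add_distrib, Finset.sum_sub_distrib, ← Finset.mul_sum] at h4
  have h5 := f.card_dartsOn_preimage W
  have h6 := f.card_preimage W
  simp only [Finset.sum_const, nsmul_eq_mul] at h4
  zify at h5 h6
  rw [h5, h6, h2] at h1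
  linarith

theorem bettiOn_add_sum_genus (f : Collapse G H) (W : Finset (Fin H.numV)) :
    G.bettiOn (f.preimage W) + ∑ v ∈ f.preimage W, (G.genus v : ℤ) =
      H.bettiOn W + ∑ b ∈ W, (H.genus b : ℤ) := by
  rw [f.bettiOn_preimage, ← f.sum_preimage, add_assoc, ← Finset.sum_add_distrib]
  congr 1
  exact Finset.sum_congr rfl fun b _ => (f.genus_vert b).symm

/-- The genus is invariant under collapses. -/
theorem totalGenus_eq (f : Collapse G H) : H.totalGenus = G.totalGenus := by
  have h := f.bettiOn_add_sum_genus Finset.univ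
  have : f.preimage Finset.univ = Finset.univ := by ext; simp [mem_preimage]
  rw [this] at h
  exact h.symm

/-- The sum of weight vectors around a vertex is additive under collapses. -/
theorem weightSum_eq (f : Collapse G H) (b : Fin H.numV) :
    H.weightSum b = ∑ v ∈ f.fibre b, G.weightSum v := by
  classical
  rw [sum_weightSum, ← Finset.sum_filter_add_sum_filter_not (s := Finset.univ.filter _)
    (fun d => f.vert (G.src d) ≠ f.vert (G.tgt d))]
  have h2 : ∑ d ∈ (Finset.univ.filter fun d => G.src d ∈ f.fibre b) with
      ¬ f.vert (G.src d) ≠ f.vert (G.tgt d), G.weight d = 0 := by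
    rw [← G.sum_weight_dartsOn (f.fibre b)]
    refine Finset.sum_congr ?_ fun _ _ => rfl
    ext d
    simp only [Finset.mem_filter, Finset.mem_univ, true_and, mem_dartsOn, mem_fibre]
    grind
  rw [h2, add_zero]
  refine Finset.sum_bij (fun d _ => f.dart d) (fun d hd => ?_)
      (fun d _ e _ h => f.dart_injective h) (fun d hd => ?_) (fun d _ => f.weight_dart d)
  · simp only [Finset.mem_filter, Finset.mem_univ, true_and] at hd ⊢
    exact ⟨by rw [mem_fibre, ← f.src_dart, hd], f.vert_dart_ne d⟩
  · simp only [Finset.mem_filter, Finset.mem_univ, true_and, mem_fibre] at hd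
    obtain ⟨e, rfl⟩ := f.exists_dart hd.2
    exact ⟨e, by simp [f.src_dart, hd.1], rfl⟩

/-- The composition of collapses. -/
def comp (f : Collapse G H) (g : Collapse H K) : Collapse G K where
  vert := g.vert ∘ f.vert
  vert_surjective := g.vert_surjective.comp f.vert_surjective
  fibre_connected u v huv := by
    have lift : ∀ u v, f.vert u = f.vert v → Relation.ReflTransGen
        (fun a b => ∃ d, G.src d = a ∧ G.tgt d = b ∧ g.vert (f.vert a) = g.vert (f.vert b)) u v :=
      fun u v h => reflTransGen_imp (fun a b ⟨d, h1, h2, h3⟩ =>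
        ⟨d, h1, h2, congrArg g.vert h3⟩) (f.fibre_connected u v h)
    have key : ∀ y, Relation.ReflTransGen
        (fun a b => ∃ d, H.src d = a ∧ H.tgt d = b ∧ g.vert a = g.vert b) (f.vert u) y →
        ∀ v, f.vert v = y → Relation.ReflTransGen
        (fun a b => ∃ d, G.src d = a ∧ G.tgt d = b ∧ g.vert (f.vert a) = g.vert (f.vert b)) u v := by
      intro y hy
      induction hy with
      | refl => exact fun v hv => lift u v hv.symm
      | tail _ hbc ih =>
        obtain ⟨d, rfl, rfl, h3⟩ := hbc
        intro v hv
        rw [f.src_dart, f.tgt_dart] at h3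
        refine ((ih _ (f.src_dart d).symm).tail ⟨f.dart d, rfl, rfl, h3⟩).trans (lift _ _ ?_)
        rw [hv, f.tgt_dart]
    exact key _ (g.fibre_connected _ _ huv) v rfl
  dart := f.dart ∘ g.dart
  dart_injective := f.dart_injective.comp g.dart_injective
  range_dart := by
    ext d
    simp only [mem_range, Function.comp, mem_ofPred_eq]
    constructor
    · rintro ⟨e, rfl⟩
      rw [← f.src_dart, ← f.tgt_dart]
      exact g.vert_dart_ne e
    · intro h
      obtain ⟨e, rfl⟩ := f.exists_dart (d := d) (fun h' => h (by rw [h']))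
      rw [← f.src_dart, ← f.tgt_dart] at h
      obtain ⟨e', rfl⟩ := g.exists_dart h
      exact ⟨e', rfl⟩
  src_dart d := by rw [g.src_dart, f.src_dart]; rfl
  rev_dart d := by simp only [Function.comp, g.rev_dart, f.rev_dart]
  weight_dart d := by rw [g.weight_dart, f.weight_dart]; rfl
  genus_vert b := by
    have h := f.bettiOn_add_sum_genus (g.fibre b)
    rw [g.genus_vert]
    refine h.symm.trans ?_
    have : f.preimage (g.fibre b) = Finset.univ.filter fun v => (g.vert ∘ f.vert) v = b := by
      ext; simp [mem_preimage, mem_fibre]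
    rw [this]
  mark_vert i := by rw [g.mark_vert, f.mark_vert]; rfl

/-- A collapse `G → K` that is constant on the fibres of a collapse `G → H` factors through `H`. -/
theorem exists_cancel (f : Collapse G H) (g : Collapse G K)
    (h : ∀ u v, f.vert u = f.vert v → g.vert u = g.vert v) :
    ∃ k : Collapse H K, ∀ v, k.vert (f.vert v) = g.vert v := by
  choose s hs using f.vert_surjective
  have hgs : ∀ v, g.vert (s (f.vert v)) = g.vert v := fun v => h _ _ (hs _)
  have hd : ∀ d, ∃ e, f.dart e = g.dart d := fun d =>
    f.exists_dart fun h' => g.vert_dart_ne d (h _ _ h')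
  choose t ht using hd
  have hsrc : ∀ d, g.vert (s (H.src d)) = g.vert (G.src (f.dart d)) := fun d => by
    rw [f.src_dart, hgs]
  have htgt : ∀ d, g.vert (s (H.tgt d)) = g.vert (G.tgt (f.dart d)) := fun d => by
    rw [f.tgt_dart, hgs]
  refine ⟨⟨g.vert ∘ s, ?_, ?_, t, ?_, ?_, ?_, ?_, ?_, ?_, ?_⟩, hgs⟩
  · intro b
    obtain ⟨v, rfl⟩ := g.vert_surjective b
    exact ⟨f.vert v, hgs v⟩
  · intro u v huv
    have key : ∀ y, Relation.ReflTransGen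
        (fun a b => ∃ d, G.src d = a ∧ G.tgt d = b ∧ g.vert a = g.vert b) (s u) y →
        Relation.ReflTransGen (fun a b => ∃ d, H.src d = a ∧ H.tgt d = b ∧
          (g.vert ∘ s) a = (g.vert ∘ s) b) u (f.vert y) := by
      intro y hy
      induction hy with
      | refl => rw [hs]
      | tail _ hbc ih =>
        obtain ⟨d, rfl, rfl, h3⟩ := hbc
        by_cases hd : f.vert (G.src d) = f.vert (G.tgt d)
        · rwa [← hd]
        · obtain ⟨e, rfl⟩ := f.exists_dart hd
          refine ih.tail ⟨e, f.src_dart e, f.tgt_dart e, ?_⟩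
          simp only [Function.comp, hgs]
          exact h3
    have := key _ (g.fibre_connected _ _ huv)
    rwa [hs] at this
  · intro d e hde
    apply g.dart_injective
    rw [← ht, ← ht, hde]
  · ext d
    simp only [mem_range, Function.comp, mem_ofPred_eq, hsrc, htgt]
    constructor
    · rintro ⟨e, rfl⟩
      rw [ht]
      exact g.vert_dart_ne e
    · intro h'
      obtain ⟨e, he⟩ := g.exists_dart h'
      exact ⟨e, f.dart_injective (by rw [ht, he])⟩
  · intro d
    rw [g.src_dart, Function.comp, hsrc, ht]
  · intro d
    apply f.dart_injective
    rw [ht, g.rev_dart, f.rev_dart, ht]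
  · intro d
    rw [g.weight_dart, f.weight_dart, ht]
  · intro b
    have h' := f.bettiOn_add_sum_genus (Finset.univ.filter fun v => (g.vert ∘ s) v = b)
    refine (g.genus_vert b).trans (Eq.trans ?_ h')
    have : f.preimage (Finset.univ.filter fun v => (g.vert ∘ s) v = b) =
        Finset.univ.filter fun v => g.vert v = b := by
      ext; simp [mem_preimage, hgs]
    rw [this]
  · intro i
    rw [g.mark_vert, f.mark_vert]
    exact (hgs _).symm

/-- A collapse that is injective on vertices is an isomorphism. -/
theorem exists_iso (f : Collapse G H) (h : Function.Injective f.vert) :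
    ∃ φ : Iso G H, (∀ v, φ.vert v = f.vert v) ∧ ∀ d, φ.dart (f.dart d) = d := by
  have hsurj : Function.Surjective f.dart := fun d =>
    f.exists_dart fun h' => G.tgt_ne_src d (h h').symm
  let e := Equiv.ofBijective f.dart ⟨f.dart_injective, hsurj⟩
  have he : ∀ d, f.dart (e.symm d) = d := fun d => e.apply_symm_apply d
  refine ⟨⟨Equiv.ofBijective f.vert ⟨h, f.vert_surjective⟩, e.symm, ?_, ?_, ?_, ?_, ?_⟩,
    fun v => rfl, fun d => e.symm_apply_apply d⟩
  · intro d
    rw [f.src_dart, he]; rfl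
  · intro d
    apply f.dart_injective
    rw [f.rev_dart, he, he]
  · intro d
    rw [f.weight_dart, he]
  · intro v
    have h1 := f.genus_vert (f.vert v)
    have : (Finset.univ.filter fun x => f.vert x = f.vert v) = {v} := by
      ext x; simp [h.eq_iff]
    rw [this, bettiOn_singleton] at h1
    exact_mod_cast (by simpa using h1 : (H.genus (f.vert v) : ℤ) = G.genus v)
  · intro i
    rw [f.mark_vert]; rfl

end Collapse

/-- An isomorphism is a collapse. -/
def Iso.toCollapse {G H : DecoratedGraph I n} (φ : Iso G H) : Collapse G H where
  vert := φ.vert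
  vert_surjective := φ.vert.surjective
  fibre_connected u v huv := by rw [φ.vert.injective huv]
  dart := φ.dart.symm
  dart_injective := φ.dart.symm.injective
  range_dart := by
    ext d
    simp only [EquivLike.range_eq_univ, mem_univ, mem_ofPred_eq, true_iff]
    exact fun h => G.tgt_ne_src d (φ.vert.injective h).symm
  src_dart d := by rw [← φ.src_dart, Equiv.apply_symm_apply]
  rev_dart d := by
    apply φ.dart.injective
    rw [← φ.rev_dart]; simp
  weight_dart d := by rw [← φ.weight_dart, Equiv.apply_symm_apply]
  genus_vert b := by
    have : (Finset.univ.filter fun x => φ.vert x = b) = {φ.vert.symm b} := by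
      ext x; simp [Equiv.eq_symm_apply]
    rw [this, bettiOn_singleton]
    simp [← φ.genus_vert]
  mark_vert := φ.mark_vert

/-- Every partition of the vertices into connected subgraphs, given as the partition into the
fibres of a function `f`, is the partition into the fibres of a collapse. -/
theorem exists_collapse (G : DecoratedGraph I n) {β : Type*} (f : Fin G.numV → β)
    (hf : ∀ u v, f u = f v → Relation.ReflTransGen
      (fun a b => ∃ d, G.src d = a ∧ G.tgt d = b ∧ f a = f b) u v) :
    ∃ (H : DecoratedGraph I n) (c : Collapse G H), ∀ u v, c.vert u = c.vert v ↔ f u = f v := by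
  classical
  let eV := Fintype.equivFin (range f)
  let eD := Fintype.equivFin {d : Fin G.numD // f (G.src d) ≠ f (G.tgt d)}
  let π : Fin G.numV → Fin (Fintype.card (range f)) := fun v => eV ⟨f v, v, rfl⟩
  have hπ : ∀ u v, π u = π v ↔ f u = f v := fun u v => by
    simp only [π, eV.apply_eq_iff_eq]
    exact Subtype.mk_eq_mk
  have hπs : Function.Surjective π := by
    intro b
    obtain ⟨v, hv⟩ := (eV.symm b).2
    refine ⟨v, ?_⟩
    rw [← eV.apply_symm_apply b]
    exact congrArg eV (Subtype.ext hv)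
  let δ : Fin (Fintype.card {d : Fin G.numD // f (G.src d) ≠ f (G.tgt d)}) → Fin G.numD :=
    fun d => (eD.symm d).1
  have hδ : ∀ d, f (G.src (δ d)) ≠ f (G.tgt (δ d)) := fun d => (eD.symm d).2
  have hδr : ∀ d, f (G.src (G.rev (δ d))) ≠ f (G.tgt (G.rev (δ d))) := fun d => by
    simpa using (hδ d).symm
  let ρ : Fin (Fintype.card {d : Fin G.numD // f (G.src d) ≠ f (G.tgt d)}) →
      Fin (Fintype.card {d : Fin G.numD // f (G.src d) ≠ f (G.tgt d)}) :=
    fun d => eD ⟨G.rev (δ d), hδr d⟩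
  have hρ : ∀ d, δ (ρ d) = G.rev (δ d) := fun d => by simp [δ, ρ]
  have hδi : Function.Injective δ := fun d e h => eD.symm.injective (Subtype.ext h)
  have hδs : ∀ d, f (G.src d) ≠ f (G.tgt d) → ∃ e, δ e = d := fun d hd =>
    ⟨eD ⟨d, hd⟩, by simp [δ]⟩
  have hgen : ∀ b, 0 ≤ G.bettiOn (Finset.univ.filter fun v => π v = b) +
      ∑ v ∈ Finset.univ.filter (fun v => π v = b), (G.genus v : ℤ) := by
    intro b
    refine add_nonneg (G.bettiOn_nonneg ?_ ?_) (Finset.sum_nonneg fun _ _ => by positivity)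
    · obtain ⟨v, hv⟩ := hπs b
      exact ⟨v, by simp [hv]⟩
    · intro u hu v hv
      simp only [Finset.mem_filter, Finset.mem_univ, true_and] at hu hv ⊢
      have h1 := hf u v ((hπ u v).1 (hu.trans hv.symm))
      have key : ∀ w, Relation.ReflTransGen
          (fun a b => ∃ d, G.src d = a ∧ G.tgt d = b ∧ f a = f b) u w →
          π w = b ∧ Relation.ReflTransGen
          (fun a c => ∃ d, G.src d = a ∧ G.tgt d = c ∧ π c = b) u w := by
        intro w hw
        induction hw with
        | refl => exact ⟨hu, .refl⟩
        | tail _ hbc ih =>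
          obtain ⟨d, h1, h2, h3⟩ := hbc
          have := ((hπ _ _).2 h3).symm.trans ih.1
          exact ⟨this, ih.2.tail ⟨d, h1, h2, this⟩⟩
      exact (key v h1).2
  refine ⟨{ numV := Fintype.card (range f)
            numD := Fintype.card {d : Fin G.numD // f (G.src d) ≠ f (G.tgt d)}
            src := fun d => π (G.src (δ d))
            rev := ρ
            rev_rev := fun d => hδi (by rw [hρ, hρ, G.rev_rev])
            no_loop := fun d => by
              rw [hρ]
              exact fun h => hδ d ((hπ _ _).1 h).symm
            numV_pos := Fin.pos (π ⟨0, G.numV_pos⟩)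
            connected := ?_
            weight := fun d => G.weight (δ d)
            weight_ne_zero := fun d => G.weight_ne_zero _
            weight_rev := fun d => by rw [hρ, G.weight_rev]
            genus := fun b => (G.bettiOn (Finset.univ.filter fun v => π v = b) +
              ∑ v ∈ Finset.univ.filter (fun v => π v = b), (G.genus v : ℤ)).toNat
            mark := fun i => π (G.mark i) },
          { vert := π
            vert_surjective := hπs
            fibre_connected := fun u v huv => reflTransGen_imp
              (fun a b ⟨d, h1, h2, h3⟩ => ⟨d, h1, h2, (hπ _ _).2 h3⟩) (hf u v ((hπ u v).1 huv))
            dart := δ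
            dart_injective := hδi
            range_dart := ?_
            src_dart := fun d => rfl
            rev_dart := hρ
            weight_dart := fun d => rfl
            genus_vert := fun b => Int.toNat_of_nonneg (hgen b)
            mark_vert := fun i => rfl }, hπ⟩
  · intro u v
    obtain ⟨x, rfl⟩ := hπs u
    obtain ⟨y, rfl⟩ := hπs v
    have := G.connected x y
    induction this with
    | refl => exact .refl
    | @tail a b _ hbc ih =>
      obtain ⟨d, rfl, rfl⟩ := hbc
      by_cases hd : f (G.src d) = f (G.tgt d)
      · rw [(hπ _ _).2 hd] at ih; exact ih
      · obtain ⟨e, rfl⟩ := hδs d hd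
        exact ih.tail ⟨e, rfl, by rw [hρ]⟩
  · ext d
    simp only [mem_range, mem_ofPred_eq, ne_eq, hπ]
    exact ⟨fun ⟨e, he⟩ => he ▸ hδ e, hδs d⟩

end DecoratedGraph

/-! ### Points of the Clemens polytope -/

theorem ClemensPolytope.mem_faces_of_subset {I : Type u} (S : ClemensPolytope I)
    {F F' : Finset I} (hF : F ∈ S.faces) (h : F' ⊆ F) (hne : F'.Nonempty) : F' ∈ S.faces :=
  (S.complex.isRelLowerSet_faces hF).2 h hne

section Support
variable {I : Type u} [Fintype I]

/-- The set of indices of the positive coordinates of a point.  For a point `x` of a Clemens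
polytope it is the index set of the face that contains `x` in its relative interior. -/
noncomputable def posSupp (x : I → ℝ) : Finset I := by
  classical
  exact Finset.univ.filter fun i => 0 < x i

@[simp] theorem mem_posSupp {x : I → ℝ} {i : I} : i ∈ posSupp x ↔ 0 < x i := by simp [posSupp]

namespace ClemensPolytope
variable (S : ClemensPolytope I)

/-- The simplex that is spanned by all points `S.scale • e_i`. -/
def simplex : Set (I → ℝ) := {x | (∀ i, 0 ≤ x i) ∧ ∑ i, x i = S.scale}

variable {S}

theorem posSupp_nonempty {x : I → ℝ} (hx : x ∈ S.simplex) : (posSupp x).Nonempty := by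
  by_contra h
  rw [Finset.not_nonempty_iff_eq_empty] at h
  have h1 : ∑ i, x i ≤ 0 := Finset.sum_nonpos fun i _ => by
    by_contra hi
    have : i ∈ posSupp x := by simpa using hi
    simp [h] at this
  rw [hx.2] at h1
  exact absurd h1 (not_le.2 S.scale_pos)

theorem mem_closedFace_iff {x : I → ℝ} {F : Finset I} :
    x ∈ S.closedFace F ↔ x ∈ S.simplex ∧ posSupp x ⊆ F := by
  constructor
  · rintro ⟨h1, h2, h3⟩
    refine ⟨⟨h1, h2⟩, fun i hi => ?_⟩
    by_contra hF
    exact (mem_posSupp.1 hi).ne' (h3 i hF)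
  · rintro ⟨⟨h1, h2⟩, h3⟩
    refine ⟨h1, h2, fun i hi => le_antisymm ?_ (h1 i)⟩
    by_contra h
    exact hi (h3 (mem_posSupp.2 (not_le.1 h)))

theorem mem_openFace_iff {x : I → ℝ} {F : Finset I} :
    x ∈ S.openFace F ↔ x ∈ S.simplex ∧ posSupp x = F := by
  rw [openFace, mem_ofPred_eq, mem_closedFace_iff, and_assoc]
  refine and_congr_right fun _ => ⟨fun h => h.1.antisymm fun i hi => mem_posSupp.2 (h.2 i hi), ?_⟩
  rintro rfl
  exact ⟨subset_rfl, fun i hi => mem_posSupp.1 hi⟩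

theorem mem_carrier_iff {x : I → ℝ} :
    x ∈ S.carrier ↔ x ∈ S.simplex ∧ posSupp x ∈ S.faces := by
  simp only [carrier, mem_iUnion, mem_closedFace_iff, exists_prop]
  constructor
  · rintro ⟨F, hF, hx, hs⟩
    exact ⟨hx, S.mem_faces_of_subset hF hs (posSupp_nonempty hx)⟩
  · rintro ⟨hx, hF⟩
    exact ⟨_, hF, hx, subset_rfl⟩

theorem convex_closedFace (F : Finset I) : Convex ℝ (S.closedFace F) := by
  rintro x ⟨hx1, hx2, hx3⟩ y ⟨hy1, hy2, hy3⟩ a b ha hb hab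
  refine ⟨fun i => ?_, ?_, fun i hi => ?_⟩
  · have := hx1 i
    have := hy1 i
    simp only [Pi.add_apply, Pi.smul_apply, smul_eq_mul]
    positivity
  · simp only [Pi.add_apply, Pi.smul_apply, smul_eq_mul, Finset.sum_add_distrib,
      ← Finset.mul_sum, hx2, hy2]
    rw [← add_mul, hab, one_mul]
  · simp [hx3 i hi, hy3 i hi]

end ClemensPolytope

open ClemensPolytope

theorem segment_subset_closedFace_iff {S : ClemensPolytope I} {x y : I → ℝ} (hx : x ∈ S.simplex)
    (hy : y ∈ S.simplex) {F : Finset I} :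
    segment ℝ x y ⊆ S.closedFace F ↔ posSupp x ⊆ F ∧ posSupp y ⊆ F := by
  constructor
  · intro h
    exact ⟨(mem_closedFace_iff.1 (h (left_mem_segment ℝ x y))).2,
      (mem_closedFace_iff.1 (h (right_mem_segment ℝ x y))).2⟩
  · rintro ⟨h1, h2⟩
    exact (convex_closedFace F).segment_subset (mem_closedFace_iff.2 ⟨hx, h1⟩)
      (mem_closedFace_iff.2 ⟨hy, h2⟩)

end Support

namespace DecoratedGraph
variable {I : Type u} {n : ℕ} [Fintype I] {S : ClemensPolytope I}
open ClemensPolytope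

theorem isRealization_iff {G : DecoratedGraph I n} {p : Fin G.numV → I → ℝ} :
    G.IsRealization S p ↔ (∀ v, p v ∈ S.carrier) ∧
      (∀ d, ∃ F ∈ S.faces, posSupp (p (G.src d)) ⊆ F ∧ posSupp (p (G.tgt d)) ⊆ F) ∧
      ∀ d, ∃ l : ℝ, 0 < l ∧ p (G.tgt d) - p (G.src d) = l • fun i => (G.weight d i : ℝ) := by
  constructor
  · rintro ⟨h1, h2, h3⟩
    refine ⟨h1, fun d => ?_, h3⟩
    obtain ⟨F, hF, h⟩ := h2 d
    exact ⟨F, hF, (segment_subset_closedFace_iff (mem_carrier_iff.1 (h1 _)).1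
      (mem_carrier_iff.1 (h1 _)).1).1 h⟩
  · rintro ⟨h1, h2, h3⟩
    refine ⟨h1, fun d => ?_, h3⟩
    obtain ⟨F, hF, h⟩ := h2 d
    exact ⟨F, hF, (segment_subset_closedFace_iff (mem_carrier_iff.1 (h1 _)).1
      (mem_carrier_iff.1 (h1 _)).1).2 h⟩

theorem IsRealization.pos_ne {G : DecoratedGraph I n} {p : Fin G.numV → I → ℝ}
    (h : G.IsRealization S p) (d : Fin G.numD) : p (G.src d) ≠ p (G.tgt d) := by
  obtain ⟨l, hl, e⟩ := h.parallel d
  intro h'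
  rw [h', sub_self, eq_comm, smul_eq_zero] at e
  exact e.elim hl.ne' (G.weight_real_ne_zero d)

/-- Vertex positions for which every edge has a non-negative multiple of its weight vector as
direction vector, possibly zero. -/
def WeakParallel (G : DecoratedGraph I n) (p : Fin G.numV → I → ℝ) : Prop :=
  ∀ d, ∃ l : ℝ, 0 ≤ l ∧ p (G.tgt d) - p (G.src d) = l • fun i => (G.weight d i : ℝ)

theorem IsRealization.weakParallel {G : DecoratedGraph I n} {p : Fin G.numV → I → ℝ}
    (h : G.IsRealization S p) : G.WeakParallel p := fun d =>
  let ⟨l, hl, e⟩ := h.parallel d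
  ⟨l, hl.le, e⟩

end DecoratedGraph

/-! ### Contractions -/

section Contraction
variable {I : Type u} {n : ℕ} [Fintype I] {S : ClemensPolytope I}
variable {G : DecoratedGraph I n} {p : Fin G.numV → I → ℝ} {B C : TropCurve S n}
open DecoratedGraph

theorem TropCurve.posSupp_pos (B : TropCurve S n) (v : Fin B.numV) :
    posSupp (B.pos v) = B.type.face v := rfl

/-- The collapse underlying a contraction. -/
def Contraction.toCollapse (c : Contraction G p B) : Collapse G B.toDecoratedGraph where
  vert := c.vert
  vert_surjective := c.vert_surjective
  fibre_connected u v huv := reflTransGen_imp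
    (fun a b ⟨d, h1, h2, h3⟩ => ⟨d, h1, h2, (c.vert_eq_iff a b).2 (.single ⟨d, h1, h2, h3⟩)⟩)
    ((c.vert_eq_iff u v).1 huv)
  dart := c.dart
  dart_injective := c.dart_injective
  range_dart := by
    rw [c.range_dart]
    ext d
    simp only [mem_ofPred_eq]
    refine not_congr ⟨fun h => ?_, fun h => ?_⟩
    · exact (c.vert_eq_iff _ _).2 (.single ⟨d, rfl, rfl, h⟩)
    · rw [← c.pos_vert, h, c.pos_vert]
  src_dart := c.src_dart
  rev_dart := c.rev_dart
  weight_dart := c.weight_dart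
  genus_vert := c.genus_vert
  mark_vert := c.mark_vert

/-- A collapse onto a tropical curve with compatible vertex positions is a contraction, because
every edge of a tropical curve has positive length. -/
def DecoratedGraph.Collapse.toContraction (f : Collapse G B.toDecoratedGraph)
    (hp : ∀ v, B.pos (f.vert v) = p v) : Contraction G p B where
  vert := f.vert
  vert_surjective := f.vert_surjective
  vert_eq_iff u v := by
    constructor
    · exact fun h => reflTransGen_imp
        (fun a b ⟨d, h1, h2, h3⟩ => ⟨d, h1, h2, by rw [← hp, h3, hp]⟩) (f.fibre_connected u v h)
    · intro h
      induction h with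
      | refl => rfl
      | tail _ hbc ih =>
        obtain ⟨d, rfl, rfl, h3⟩ := hbc
        rw [ih]
        by_contra hne
        obtain ⟨e, rfl⟩ := f.exists_dart hne
        rw [← hp, ← hp, ← f.src_dart, ← f.tgt_dart] at h3
        exact B.isRealization.pos_ne e h3
  dart := f.dart
  dart_injective := f.dart_injective
  range_dart := by
    rw [f.range_dart]
    ext d
    simp only [mem_ofPred_eq]
    refine not_congr ⟨fun h => by rw [← hp, h, hp], fun h => ?_⟩
    by_contra hne
    obtain ⟨e, rfl⟩ := f.exists_dart hne
    rw [← hp, ← hp, ← f.src_dart, ← f.tgt_dart] at h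
    exact B.isRealization.pos_ne e h
  src_dart := f.src_dart
  rev_dart := f.rev_dart
  weight_dart := f.weight_dart
  pos_vert := hp
  genus_vert := f.genus_vert
  mark_vert := f.mark_vert

theorem exists_contraction (h1 : ∀ v, p v ∈ S.carrier)
    (h2 : ∀ d, ∃ F ∈ S.faces, posSupp (p (G.src d)) ⊆ F ∧ posSupp (p (G.tgt d)) ⊆ F)
    (h3 : G.WeakParallel p) : ∃ B : TropCurve S n, Nonempty (Contraction G p B) := by
  let r : Fin G.numV → Fin G.numV → Prop :=
    Relation.ReflTransGen (fun a b => ∃ d, G.src d = a ∧ G.tgt d = b ∧ p a = p b)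
  have hsymm : ∀ u v, r u v → r v u := fun u v huv => by
    induction huv with
    | refl => exact .refl
    | tail _ hbc ih =>
      obtain ⟨d, rfl, rfl, h⟩ := hbc
      exact .head ⟨G.rev d, by simp, by simp, h.symm⟩ ih
  let f : Fin G.numV → Set (Fin G.numV) := fun u => {v | r u v}
  have hf : ∀ u v, f u = f v ↔ r u v := by
    intro u v
    constructor
    · intro h
      have : v ∈ f v := Relation.ReflTransGen.refl
      rw [← h] at this
      exact this
    · intro h
      ext w
      exact ⟨fun hw => (hsymm _ _ h).trans hw, fun hw => h.trans hw⟩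
  have hfp : ∀ u v, f u = f v → p u = p v := by
    intro u v h
    have := (hf u v).1 h
    induction this with
    | refl => rfl
    | @tail b c hb hbc ih =>
      obtain ⟨d, _, _, h'⟩ := hbc
      exact (ih ((hf _ _).2 hb)).trans h'
  obtain ⟨H, c, hc⟩ := G.exists_collapse f fun u v huv => reflTransGen_imp
    (fun a b ⟨d, e1, e2, e3⟩ => ⟨d, e1, e2, (hf a b).2 (.single ⟨d, e1, e2, e3⟩)⟩) ((hf u v).1 huv)
  choose s hs using c.vert_surjective
  have hps : ∀ v, p (s (c.vert v)) = p v := fun v => hfp _ _ ((hc _ _).1 (hs _))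
  have hsrc : ∀ d, p (s (H.src d)) = p (G.src (c.dart d)) := fun d => by rw [c.src_dart, hps]
  have htgt : ∀ d, p (s (H.tgt d)) = p (G.tgt (c.dart d)) := fun d => by rw [c.tgt_dart, hps]
  refine ⟨⟨H, p ∘ s, isRealization_iff.2 ⟨fun v => h1 _, fun d => ?_, fun d => ?_⟩⟩,
    ⟨c.toContraction (B := ⟨H, p ∘ s, _⟩) hps⟩⟩
  · simp only [Function.comp, hsrc, htgt]
    exact h2 _
  · simp only [Function.comp, hsrc, htgt, c.weight_dart]
    obtain ⟨l, hl, e⟩ := h3 (c.dart d)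
    refine ⟨l, lt_of_le_of_ne hl ?_, e⟩
    rintro rfl
    rw [zero_smul, sub_eq_zero] at e
    exact c.vert_dart_ne d ((hc _ _).2 ((hf _ _).2 (.single ⟨_, rfl, rfl, e.symm⟩)))

theorem Contraction.exists_iso (c : Contraction G p B) (c' : Contraction G p C) :
    ∃ φ : Iso B.toDecoratedGraph C.toDecoratedGraph, ∀ v, φ.vert (c.vert v) = c'.vert v := by
  have hcc : ∀ u v, c.vert u = c.vert v ↔ c'.vert u = c'.vert v := fun u v => by
    rw [c.vert_eq_iff, c'.vert_eq_iff]
  obtain ⟨k, hk⟩ := c.toCollapse.exists_cancel c'.toCollapse fun u v => (hcc u v).1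
  obtain ⟨φ, hφ, -⟩ := k.exists_iso (by
    intro x y hxy
    obtain ⟨u, rfl⟩ := c.vert_surjective x
    obtain ⟨v, rfl⟩ := c.vert_surjective y
    rw [hcc]
    have h1 := hk u
    have h2 := hk v
    exact h1.symm.trans (hxy.trans h2))
  exact ⟨φ, fun v => (hφ _).trans (hk v)⟩

theorem Contraction.pos_iso (c : Contraction G p B) (c' : Contraction G p C)
    {φ : Iso B.toDecoratedGraph C.toDecoratedGraph} (h : ∀ v, φ.vert (c.vert v) = c'.vert v)
    (v : Fin B.numV) : C.pos (φ.vert v) = B.pos v := by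
  obtain ⟨u, rfl⟩ := c.vert_surjective v
  rw [h, c'.pos_vert, c.pos_vert]

end Contraction

/-! ### Star embeddings and chains of darts -/

namespace DecoratedGraph
variable {I : Type u} {n : ℕ}

/-- An injection of the vertices of `H` into those of `G` such that corresponding vertices look
alike: they have the same genus and the same marked points, and there is a bijection between the
darts that start at them, which preserves weights.  Nothing is said about the other endpoints of
these darts. -/
structure StarEmbedding (H G : DecoratedGraph I n) where
  vert : Fin H.numV → Fin G.numV
  vert_injective : Function.Injective vert
  dart : Fin H.numD → Fin G.numD
  dart_injective : Function.Injective dart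
  src_dart : ∀ d, G.src (dart d) = vert (H.src d)
  exists_dart : ∀ e v, G.src e = vert v → ∃ d, dart d = e
  weight_dart : ∀ d, H.weight d = G.weight (dart d)
  genus_vert : ∀ v, H.genus v = G.genus (vert v)
  mark_vert : ∀ i, vert (H.mark i) = G.mark i

namespace StarEmbedding
variable {G H K : DecoratedGraph I n}

theorem degree_vert (f : StarEmbedding H G) (v : Fin H.numV) :
    G.degree (f.vert v) = H.degree v := by
  symm
  refine Finset.card_bij (fun d _ => f.dart d) (fun d hd => ?_)
    (fun d _ e _ h => f.dart_injective h) (fun d hd => ?_)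
  · simp only [Finset.mem_filter, Finset.mem_univ, true_and] at hd ⊢
    rw [f.src_dart, hd]
  · simp only [Finset.mem_filter, Finset.mem_univ, true_and] at hd
    obtain ⟨e, rfl⟩ := f.exists_dart d v hd
    rw [f.src_dart] at hd
    exact ⟨e, by simpa using f.vert_injective hd, rfl⟩

theorem weightSum_vert (f : StarEmbedding H G) (v : Fin H.numV) :
    G.weightSum (f.vert v) = H.weightSum v := by
  symm
  refine Finset.sum_bij (fun d _ => f.dart d) (fun d hd => ?_)
    (fun d _ e _ h => f.dart_injective h) (fun d hd => ?_) (fun d _ => f.weight_dart d)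
  · simp only [Finset.mem_filter, Finset.mem_univ, true_and] at hd ⊢
    rw [f.src_dart, hd]
  · simp only [Finset.mem_filter, Finset.mem_univ, true_and] at hd
    obtain ⟨e, rfl⟩ := f.exists_dart d v hd
    rw [f.src_dart] at hd
    exact ⟨e, by simpa using f.vert_injective hd, rfl⟩

theorem numMarks_vert (f : StarEmbedding H G) (v : Fin H.numV) :
    G.numMarks (f.vert v) = H.numMarks v := by
  unfold numMarks
  congr 1
  ext i
  simp only [Finset.mem_filter, Finset.mem_univ, true_and]
  rw [← f.mark_vert, f.vert_injective.eq_iff]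

theorem isRemovable_vert (f : StarEmbedding H G) (v : Fin H.numV) :
    G.IsRemovable (f.vert v) ↔ H.IsRemovable v := by
  simp only [IsRemovable, IsTypeA, f.degree_vert, f.weightSum_vert, f.numMarks_vert, f.genus_vert]

end StarEmbedding

/-- An isomorphism, as a star embedding. -/
def Iso.toStarEmbedding {H G : DecoratedGraph I n} (φ : Iso H G) : StarEmbedding H G where
  vert := φ.vert
  vert_injective := φ.vert.injective
  dart := φ.dart
  dart_injective := φ.dart.injective
  src_dart := φ.src_dart
  exists_dart e _ _ := ⟨φ.dart.symm e, by simp⟩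
  weight_dart d := (φ.weight_dart d).symm
  genus_vert v := (φ.genus_vert v).symm
  mark_vert i := (φ.mark_vert i).symm

theorem Iso.tgt_dart {H G : DecoratedGraph I n} (φ : Iso H G) (d : Fin H.numD) :
    G.tgt (φ.dart d) = φ.vert (H.tgt d) := by
  rw [tgt, φ.rev_dart, φ.src_dart]; rfl

theorem Iso.continues {H G : DecoratedGraph I n} (φ : Iso H G) {d e : Fin H.numD}
    (h : H.Continues d e) : G.Continues (φ.dart d) (φ.dart e) := by
  obtain ⟨h1, h2, h3⟩ := h
  refine ⟨?_, ?_, ?_⟩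
  · rw [φ.tgt_dart]
    exact (φ.toStarEmbedding.isRemovable_vert _).2 h1
  · rw [φ.src_dart, φ.tgt_dart, h2]
  · rw [φ.rev_dart]
    exact fun h => h3 (φ.dart.injective h)

theorem continues_unique {G : DecoratedGraph I n} {d e e' : Fin G.numD} (h : G.Continues d e)
    (h' : G.Continues d e') : e = e' := by
  obtain ⟨h1, h2, h3⟩ := h
  obtain ⟨-, h2', h3'⟩ := h'
  obtain ⟨x, y, -, hxy⟩ := Finset.card_eq_two.1 h1.1
  have key : ∀ z, G.src z = G.tgt d → z = x ∨ z = y := fun z hz => by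
    have : z ∈ Finset.univ.filter fun z => G.src z = G.tgt d := by simpa using hz
    rw [hxy] at this
    simpa using this
  have := key (G.rev d) rfl
  have := key e h2
  have := key e' h2'
  grind

/-- A chain of darts through removable vertices is determined by its first dart. -/
theorem reflTransGen_continues_unique {G : DecoratedGraph I n} {d e e' : Fin G.numD}
    (h : Relation.ReflTransGen G.Continues d e) (h' : Relation.ReflTransGen G.Continues d e')
    (he : ¬ G.IsRemovable (G.tgt e)) (he' : ¬ G.IsRemovable (G.tgt e')) : e = e' := by
  induction h using Relation.ReflTransGen.head_induction_on with
  | refl =>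
    rcases Relation.ReflTransGen.cases_head h' with h | ⟨x, hx, -⟩
    · exact h
    · exact absurd hx.1 he
  | head hab _ ih =>
    rcases Relation.ReflTransGen.cases_head h' with rfl | ⟨x, hx, hx'⟩
    · exact absurd hab.1 he'
    · rw [← continues_unique hab hx] at hx'
      exact ih hx'

end DecoratedGraph

/-! ### Simplifications -/

namespace Simplification
variable {I : Type u} {n : ℕ} [Fintype I] {S : ClemensPolytope I} {B B' C C' : TropCurve S n}
open DecoratedGraph

theorem not_isRemovable_vert (h : Simplification B C) (v : Fin C.numV) :
    ¬ B.IsRemovable (h.vert v) := by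
  have : h.vert v ∈ range h.vert := ⟨v, rfl⟩
  rw [h.range_vert] at this
  exact this

theorem exists_vert (h : Simplification B C) {v : Fin B.numV} (hv : ¬ B.IsRemovable v) :
    ∃ x, h.vert x = v := by
  have : v ∈ range h.vert := by rw [h.range_vert]; exact hv
  exact this

theorem exists_dart (h : Simplification B C) {d : Fin B.numD} (hd : ¬ B.IsRemovable (B.src d)) :
    ∃ x, h.dart x = d := by
  have : d ∈ range h.dart := by rw [h.range_dart]; exact hd
  exact this

/-- The star embedding underlying a simplification. -/
def toStarEmbedding (h : Simplification B C) :
    StarEmbedding C.toDecoratedGraph B.toDecoratedGraph where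
  vert := h.vert
  vert_injective := h.vert_injective
  dart := h.dart
  dart_injective := h.dart_injective
  src_dart := h.src_dart
  exists_dart e v he := h.exists_dart (by rw [he]; exact h.not_isRemovable_vert v)
  weight_dart := h.weight_dart
  genus_vert := h.genus_vert
  mark_vert := h.mark_vert

theorem isSimple (h : Simplification B C) : C.IsSimple := by
  intro v h1 h2 h3
  by_contra h4
  exact h.not_isRemovable_vert v ((h.toStarEmbedding.isRemovable_vert v).2 ⟨h1, h2, h3, h4⟩)

/-- A curve without removable vertices is its own simplification. -/
def refl (hB : ∀ v, ¬ B.IsRemovable v) : Simplification B B where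
  vert := id
  vert_injective := Function.injective_id
  range_vert := by ext v; simp [hB v]
  dart := id
  dart_injective := Function.injective_id
  range_dart := by ext v; simp [hB]
  src_dart _ := rfl
  rev_dart d := by rw [id, id, B.rev_rev]
  weight_dart _ := rfl
  pos_vert _ := rfl
  genus_vert _ := rfl
  mark_vert _ := rfl

/-- Transport of a simplification along an isomorphism of its source. -/
def congrLeft (h : Simplification B C) (φ : Iso B.toDecoratedGraph B'.toDecoratedGraph)
    (hφ : ∀ v, B'.pos (φ.vert v) = B.pos v) : Simplification B' C where
  vert := φ.vert ∘ h.vert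
  vert_injective := φ.vert.injective.comp h.vert_injective
  range_vert := by
    ext v
    obtain ⟨w, rfl⟩ := φ.vert.surjective v
    rw [range_comp, φ.vert.injective.mem_set_image, h.range_vert]
    exact not_congr (φ.toStarEmbedding.isRemovable_vert w).symm
  dart := φ.dart ∘ h.dart
  dart_injective := φ.dart.injective.comp h.dart_injective
  range_dart := by
    ext d
    obtain ⟨e, rfl⟩ := φ.dart.surjective d
    rw [range_comp, φ.dart.injective.mem_set_image, h.range_dart, mem_ofPred_eq, mem_ofPred_eq,
      φ.src_dart]
    exact not_congr (φ.toStarEmbedding.isRemovable_vert _).symm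
  src_dart d := by simp only [Function.comp, φ.src_dart, h.src_dart]
  rev_dart d := by
    simp only [Function.comp, φ.rev_dart]
    exact Relation.ReflTransGen.lift φ.dart (fun a b hab => φ.continues hab) _ _ (h.rev_dart d)
  weight_dart d := by simp only [Function.comp, φ.weight_dart, h.weight_dart]
  pos_vert v := by simp only [Function.comp, hφ, h.pos_vert]
  genus_vert v := by simp only [Function.comp, φ.genus_vert, h.genus_vert]
  mark_vert i := by simp only [Function.comp, h.mark_vert, φ.mark_vert]

/-- Transport of a simplification along an isomorphism of its target. -/
def congrRight (h : Simplification B C) (φ : Iso C'.toDecoratedGraph C.toDecoratedGraph)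
    (hφ : ∀ v, C.pos (φ.vert v) = C'.pos v) : Simplification B C' where
  vert := h.vert ∘ φ.vert
  vert_injective := h.vert_injective.comp φ.vert.injective
  range_vert := by rw [φ.vert.surjective.range_comp, h.range_vert]
  dart := h.dart ∘ φ.dart
  dart_injective := h.dart_injective.comp φ.dart.injective
  range_dart := by rw [φ.dart.surjective.range_comp, h.range_dart]
  src_dart d := by simp only [Function.comp, φ.src_dart, h.src_dart]
  rev_dart d := by
    have := h.rev_dart (φ.dart d)
    rwa [φ.rev_dart] at this
  weight_dart d := by simp only [Function.comp, ← φ.weight_dart, h.weight_dart]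
  pos_vert v := by simp only [Function.comp, ← hφ, h.pos_vert]
  genus_vert v := by simp only [Function.comp, ← φ.genus_vert, h.genus_vert]
  mark_vert i := by simp only [Function.comp, ← h.mark_vert, φ.mark_vert]

theorem exists_iso (h : Simplification B C) (h' : Simplification B C') :
    ∃ φ : Iso C.toDecoratedGraph C'.toDecoratedGraph, ∀ v, h'.vert (φ.vert v) = h.vert v := by
  let eV := (Equiv.ofInjective _ h.vert_injective).trans ((Equiv.setCongr
    (h.range_vert.trans h'.range_vert.symm)).trans (Equiv.ofInjective _ h'.vert_injective).symm)
  let eD := (Equiv.ofInjective _ h.dart_injective).trans ((Equiv.setCongr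
    (h.range_dart.trans h'.range_dart.symm)).trans (Equiv.ofInjective _ h'.dart_injective).symm)
  have hV : ∀ v, h'.vert (eV v) = h.vert v := fun v => by
    simp [eV, Equiv.apply_ofInjective_symm]
  have hD : ∀ d, h'.dart (eD d) = h.dart d := fun d => by
    simp [eD, Equiv.apply_ofInjective_symm]
  refine ⟨⟨eV, eD, ?_, ?_, ?_, ?_, ?_⟩, hV⟩
  · intro d
    apply h'.vert_injective
    rw [hV, ← h'.src_dart, ← h.src_dart, hD]
  · intro d
    apply h'.dart_injective
    rw [hD]
    apply B.rev_injective
    have h1 := h'.rev_dart (eD d)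
    rw [hD] at h1
    refine reflTransGen_continues_unique h1 (h.rev_dart d) ?_ ?_
    · rw [tgt_rev, h'.src_dart]; exact h'.not_isRemovable_vert _
    · rw [tgt_rev, h.src_dart]; exact h.not_isRemovable_vert _
  · intro d
    rw [h'.weight_dart, h.weight_dart, hD]
  · intro d
    rw [h'.genus_vert, h.genus_vert, hV]
  · intro i
    apply h'.vert_injective
    rw [h'.mark_vert, hV, h.mark_vert]

theorem pos_iso (h : Simplification B C) (h' : Simplification B C')
    {φ : Iso C.toDecoratedGraph C'.toDecoratedGraph} (hφ : ∀ v, h'.vert (φ.vert v) = h.vert v)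
    (v : Fin C.numV) : C'.pos (φ.vert v) = C.pos v := by
  rw [h'.pos_vert, hφ, h.pos_vert]

end Simplification

/-! ### Removal of a vertex of degree two -/

namespace DecoratedGraph
variable {I : Type u} {n : ℕ}

/-- `K` is obtained from `H` by removing the removable vertex `v`, with darts `a` and `b`, and
joining the two edges connected to it.  This is the collapse of the edge of `a`; but the other
vertices of `H` keep their darts in `K`, so that `K` also has a star embedding into `H`.  The two
inclusions of darts differ: the dart of the new edge that starts at `tgt a` is `b` as a dart that
survives the collapse, and `rev a` as a dart of `H` with the same source. -/
structure Removal (H K : DecoratedGraph I n) where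
  v : Fin H.numV
  a : Fin H.numD
  b : Fin H.numD
  removable : H.IsRemovable v
  src_a : H.src a = v
  src_b : H.src b = v
  ne : a ≠ b
  eq_or_eq : ∀ d, H.src d = v → d = a ∨ d = b
  weight_b : H.weight b = -H.weight a
  col : Collapse H K
  emb : StarEmbedding K H
  mem_range : ∀ x, x ≠ v → x ∈ range emb.vert
  vert_ne : ∀ k, emb.vert k ≠ v
  col_emb : ∀ k, col.vert (emb.vert k) = k
  col_v : col.vert v = col.vert (H.tgt a)
  dart_emb : ∀ d, emb.dart d = if col.dart d = b then H.rev a else col.dart d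

/-- The two darts at a removable vertex. -/
theorem IsRemovable.exists_darts {H : DecoratedGraph I n} {v : Fin H.numV} (hv : H.IsRemovable v) :
    ∃ a b, H.src a = v ∧ H.src b = v ∧ a ≠ b ∧ (∀ d, H.src d = v → d = a ∨ d = b) ∧
      H.weight b = -H.weight a := by
  obtain ⟨a, b, hab, h⟩ := Finset.card_eq_two.1 hv.1
  have key : ∀ d, H.src d = v ↔ d = a ∨ d = b := fun d => by
    have : d ∈ Finset.univ.filter (fun d => H.src d = v) ↔ d ∈ ({a, b} : Finset _) := by rw [h]
    simpa using this
  refine ⟨a, b, (key a).2 (.inl rfl), (key b).2 (.inr rfl), hab, fun d => (key d).1, ?_⟩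
  have h0 : H.weightSum v = 0 := not_not.1 hv.2.2.2
  rw [weightSum, h, Finset.sum_pair hab] at h0
  exact (neg_eq_of_add_eq_zero_right h0).symm

theorem exists_removal {H : DecoratedGraph I n} {v : Fin H.numV} (hv : H.IsRemovable v)
    {a b : Fin H.numD} (ha : H.src a = v) (hb : H.src b = v) (hab : a ≠ b)
    (hd : ∀ d, H.src d = v → d = a ∨ d = b) (hw : H.weight b = -H.weight a)
    (hne : H.tgt a ≠ H.tgt b) :
    ∃ (K : DecoratedGraph I n) (R : Removal H K), R.v = v ∧ R.a = a ∧ R.b = b := by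
  classical
  have hta : H.tgt a ≠ v := fun h => H.tgt_ne_src a (h.trans ha.symm)
  let f : Fin H.numV → Fin H.numV := Function.update id v (H.tgt a)
  have hfv : f v = H.tgt a := by simp [f]
  have hfx : ∀ x, x ≠ v → f x = x := fun x hx => by simp [f, hx]
  have hff : ∀ x y, f x = f y → x = y ∨ (x = v ∧ y = H.tgt a) ∨ (x = H.tgt a ∧ y = v) := by
    intro x y hxy
    by_cases hx : x = v <;> by_cases hy : y = v <;> grind
  obtain ⟨K, c, hc⟩ := H.exists_collapse f fun x y hxy => by
    rcases hff x y hxy with rfl | ⟨rfl, rfl⟩ | ⟨rfl, rfl⟩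
    · exact .refl
    · exact .single ⟨a, ha, rfl, hxy⟩
    · exact .single ⟨H.rev a, by simp, by simpa using ha, hxy⟩
  have hcv : c.vert v = c.vert (H.tgt a) := (hc _ _).2 (by rw [hfv, hfx _ hta])
  have hsec : ∀ k, ∃ x, x ≠ v ∧ c.vert x = k := by
    intro k
    obtain ⟨x, rfl⟩ := c.vert_surjective k
    by_cases hx : x = v
    · exact ⟨H.tgt a, hta, by rw [hx, hcv]⟩
    · exact ⟨x, hx, rfl⟩
  choose s hsv hs using hsec
  have hinj : ∀ x y, x ≠ v → y ≠ v → c.vert x = c.vert y → x = y := fun x y hx hy hxy => by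
    have := (hc _ _).1 hxy
    rwa [hfx _ hx, hfx _ hy] at this
  have hsc : ∀ x, x ≠ v → s (c.vert x) = x := fun x hx => hinj _ _ (hsv _) hx (hs _)
  have hrev : ∀ d, H.rev d ≠ d := H.rev_ne
  -- The darts of `K` are those of `H` except `a` and its reverse.
  have hca : ∀ d, c.dart d ≠ a := fun d h => by
    have := c.vert_dart_ne d
    rw [h, ha] at this
    exact this hcv
  have hcra : ∀ d, c.dart d ≠ H.rev a := fun d h => by
    have := c.vert_dart_ne d
    rw [h, src_rev, tgt_rev, ha] at this
    exact this hcv.symm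
  have hcd : ∀ d, d ≠ a → d ≠ H.rev a → ∃ e, c.dart e = d := by
    intro d h1 h2
    refine c.exists_dart fun h => ?_
    rcases hff _ _ ((hc _ _).1 h) with h | ⟨h, h'⟩ | ⟨h, h'⟩
    · exact H.tgt_ne_src d h.symm
    · rcases hd d h with rfl | rfl
      · exact h1 rfl
      · exact hne h'.symm
    · rcases hd (H.rev d) h' with h3 | h3
      · exact h2 (by rw [← h3, H.rev_rev])
      · rw [← h3, tgt_rev] at hne
        exact hne h.symm
  let δ : Fin K.numD → Fin H.numD := fun d => if c.dart d = b then H.rev a else c.dart d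
  refine ⟨K, ⟨v, a, b, hv, ha, hb, hab, hd, hw, c, ⟨s, ?_, δ, ?_, ?_, ?_, ?_, ?_, ?_⟩,
    fun x hx => ⟨_, hsc x hx⟩, hsv, hs, hcv, fun d => rfl⟩, rfl, rfl, rfl⟩
  · intro k l hkl
    rw [← hs k, hkl, hs]
  · intro d e hde
    simp only [δ] at hde
    apply c.dart_injective
    grind
  · intro d
    apply hinj _ _ _ (hsv _)
    · rw [hs, c.src_dart]
      simp only [δ]
      split_ifs with h
      · rw [h, src_rev, hb, hcv]
      · rfl
    · simp only [δ]
      split_ifs with h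
      · exact hta
      · intro h'
        rcases hd _ h' with h1 | h1
        · exact hca d h1
        · exact h h1
  · intro e k he
    have hev : H.src e ≠ v := by rw [he]; exact hsv k
    by_cases h : e = H.rev a
    · obtain ⟨e', he'⟩ := hcd b hab.symm (fun h' => hta (by
        rw [← hb, h', src_rev]))
      exact ⟨e', by simp only [δ, he', if_true, h]⟩
    · obtain ⟨e', he'⟩ := hcd e (fun h' => hev (by rw [h', ha])) h
      refine ⟨e', ?_⟩
      have : e ≠ b := fun h' => hev (by rw [h', hb])
      simp only [δ, he', this, if_false]
  · intro d
    rw [c.weight_dart]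
    simp only [δ]
    split_ifs with h
    · rw [h, hw, H.weight_rev]
    · rfl
  · intro k
    -- A fibre of the collapse is either a point or an edge, hence has Betti number zero.
    have h1 := c.genus_vert k
    by_cases hk : k = c.vert v
    · have h2 : (Finset.univ.filter fun x => c.vert x = k) = {v, s k} := by
        ext x
        simp only [Finset.mem_filter, Finset.mem_univ, true_and, Finset.mem_insert,
          Finset.mem_singleton]
        constructor
        · intro hx
          by_cases hxv : x = v
          · exact .inl hxv
          · exact .inr (hinj _ _ hxv (hsv k) (by rw [hx, hs]))
        · rintro (rfl | rfl)
          · exact hk.symm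
          · exact hs k
      have h3 : s k = H.tgt a := by rw [hk, hcv, hsc _ hta]
      have h4 : H.bettiOn {v, s k} = 0 := by
        have h5 := H.card_dartsOn {v, s k}
        have h6 : H.dartsOn {v, s k} = {a, H.rev a} := by
          ext d
          simp only [mem_dartsOn, Finset.mem_insert, Finset.mem_singleton, h3]
          constructor
          · rintro ⟨h | h, h'⟩
            · rcases hd d h with rfl | rfl
              · exact .inl rfl
              · rcases h' with h' | h'
                · exact absurd (h'.trans h.symm) (H.tgt_ne_src _)
                · exact absurd h'.symm hne
            · rcases h' with h' | h'
              · rcases hd (H.rev d) h' with h7 | h7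
                · exact .inr (by rw [← h7, H.rev_rev])
                · exact absurd (by rw [← h7, tgt_rev, h]) hne
              · exact absurd (h'.trans h.symm) (H.tgt_ne_src _)
          · rintro (rfl | rfl)
            · exact ⟨.inl ha, .inr rfl⟩
            · exact ⟨.inr rfl, .inl (by simpa using ha)⟩
        rw [h6, Finset.card_pair (hrev a).symm, Finset.card_pair (hsv k).symm] at h5
        push_cast at h5
        linarith
      rw [h2, h4, Finset.sum_pair (hsv k).symm, hv.2.1] at h1
      push_cast at h1
      linarith
    · have h2 : (Finset.univ.filter fun x => c.vert x = k) = {s k} := by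
        ext x
        simp only [Finset.mem_filter, Finset.mem_univ, true_and, Finset.mem_singleton]
        constructor
        · intro hx
          refine hinj _ _ (fun h => hk ?_) (hsv k) (by rw [hx, hs])
          rw [← hx, h]
        · rintro rfl
          exact hs k
      rw [h2, bettiOn_singleton] at h1
      simpa using h1
  · intro i
    rw [c.mark_vert]
    refine hsc _ fun h => ?_
    have : i ∈ Finset.univ.filter fun i => H.mark i = v := by simpa using h
    rw [Finset.card_eq_zero.1 hv.2.2.1] at this
    simp at this

namespace Removal
variable {H K : DecoratedGraph I n} (R : Removal H K)

theorem emb_col {x : Fin H.numV} (hx : x ≠ R.v) : R.emb.vert (R.col.vert x) = x := by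
  obtain ⟨k, rfl⟩ := R.mem_range x hx
  rw [R.col_emb]

theorem tgt_a_ne : H.tgt R.a ≠ R.v := fun h => H.tgt_ne_src R.a (h.trans R.src_a.symm)

theorem tgt_b_ne : H.tgt R.b ≠ R.v := fun h => H.tgt_ne_src R.b (h.trans R.src_b.symm)

theorem col_eq {x y : Fin H.numV} (h : R.col.vert x = R.col.vert y) :
    x = y ∨ (x = R.v ∧ y = H.tgt R.a) ∨ (x = H.tgt R.a ∧ y = R.v) := by
  have h1 := fun z (hz : z ≠ R.v) => R.emb_col hz
  have h2 := R.col_v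
  have h3 := R.tgt_a_ne
  by_cases hx : x = R.v <;> by_cases hy : y = R.v <;> grind

theorem numV_lt {H K : DecoratedGraph I n} (R : Removal H K) : K.numV < H.numV := by
  have : ¬ Function.Surjective R.emb.vert := fun h => by
    obtain ⟨k, hk⟩ := h R.v
    exact R.vert_ne k hk
  simpa using Fintype.card_lt_of_injective_not_surjective _ R.emb.vert_injective this

/-- The edges of `K` are those of `H` not connected to the removed vertex, and the edge that joins
the two edges at the removed vertex. -/
theorem dart_cases (d : Fin K.numD) :
    (R.emb.dart d = H.rev R.a ∧ R.emb.dart (K.rev d) = H.rev R.b) ∨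
    (R.emb.dart d = H.rev R.b ∧ R.emb.dart (K.rev d) = H.rev R.a) ∨
    R.emb.dart (K.rev d) = H.rev (R.emb.dart d) := by
  have hrev : ∀ e, H.rev (H.rev e) = e := H.rev_rev
  have h1 := H.rev_ne R.b
  have h2 := R.dart_emb d
  have h3 := R.dart_emb (K.rev d)
  rw [R.col.rev_dart] at h3
  by_cases hb : R.col.dart d = R.b
  · left
    rw [if_pos hb] at h2
    rw [hb, if_neg h1] at h3
    exact ⟨h2, h3⟩
  · rw [if_neg hb] at h2
    by_cases hb' : H.rev (R.col.dart d) = R.b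
    · right; left
      rw [if_pos hb'] at h3
      exact ⟨by rw [h2, ← hb', hrev], h3⟩
    · right; right
      rw [if_neg hb'] at h3
      rw [h2, h3]

theorem emb_tgt (d : Fin K.numD) : R.emb.vert (K.tgt d) = H.src (R.emb.dart (K.rev d)) :=
  (R.emb.src_dart _).symm

/-- There is a dart of `K` that joins the two edges at the removed vertex. -/
theorem exists_joined : ∃ d, R.emb.dart d = H.rev R.a ∧ R.emb.dart (K.rev d) = H.rev R.b := by
  obtain ⟨d, hd⟩ := R.emb.exists_dart (H.rev R.a) (R.col.vert (H.tgt R.a)) (by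
    rw [R.emb_col R.tgt_a_ne, src_rev])
  rcases R.dart_cases d with h | ⟨h, -⟩ | h
  · exact ⟨d, h⟩
  · rw [hd] at h
    exact absurd (H.rev_injective h) R.ne
  · rw [hd, H.rev_rev] at h
    have := R.emb.src_dart (K.rev d)
    rw [h, R.src_a] at this
    exact absurd this.symm (R.vert_ne _)

theorem exists_of_src_ne {e : Fin H.numD} (h1 : H.src e ≠ R.v) (h2 : H.tgt e ≠ R.v) :
    ∃ d, R.emb.dart d = e ∧ R.emb.dart (K.rev d) = H.rev e := by
  obtain ⟨d, rfl⟩ := R.emb.exists_dart e (R.col.vert (H.src e)) (R.emb_col h1).symm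
  refine ⟨d, rfl, ?_⟩
  rcases R.dart_cases d with ⟨h, -⟩ | ⟨h, -⟩ | h
  · rw [h, tgt_rev, R.src_a] at h2
    exact absurd rfl h2
  · rw [h, tgt_rev, R.src_b] at h2
    exact absurd rfl h2
  · exact h

end Removal
end DecoratedGraph

section Curves
open DecoratedGraph ClemensPolytope
variable {I : Type u} {n : ℕ} [Fintype I] {S : ClemensPolytope I}

namespace DecoratedGraph.Removal
variable {H K : DecoratedGraph I n} (R : Removal H K)

/-- The two edges at a removed vertex form a straight segment, with that vertex in its interior. -/
theorem exists_combination {p : Fin H.numV → I → ℝ} (h : H.IsRealization S p) :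
    ∃ s t : ℝ, 0 < s ∧ 0 < t ∧ s + t = 1 ∧ p R.v = s • p (H.tgt R.a) + t • p (H.tgt R.b) := by
  obtain ⟨l, hl, e⟩ := h.parallel R.a
  obtain ⟨m, hm, e'⟩ := h.parallel R.b
  rw [R.src_a] at e
  rw [R.src_b] at e'
  have hlm : 0 < l + m := by positivity
  refine ⟨m / (l + m), l / (l + m), by positivity, by positivity, by field_simp; ring, ?_⟩
  ext i
  have h1 := congrFun e i
  have h2 := congrFun e' i
  simp only [R.weight_b, Pi.sub_apply, Pi.smul_apply, Pi.neg_apply, Int.cast_neg, smul_eq_mul,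
    Pi.add_apply] at h1 h2 ⊢
  field_simp
  linear_combination (-m) * h1 - l * h2

theorem posSupp_v_iff {p : Fin H.numV → I → ℝ} (h : H.IsRealization S p) (i : I) :
    i ∈ posSupp (p R.v) ↔ i ∈ posSupp (p (H.tgt R.a)) ∨ i ∈ posSupp (p (H.tgt R.b)) := by
  obtain ⟨s, t, hs, ht, -, e⟩ := R.exists_combination h
  have h1 := (mem_carrier_iff.1 (h.vertex_mem (H.tgt R.a))).1.1 i
  have h2 := (mem_carrier_iff.1 (h.vertex_mem (H.tgt R.b))).1.1 i
  simp only [mem_posSupp, e, Pi.add_apply, Pi.smul_apply, smul_eq_mul]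
  constructor
  · intro h3
    by_contra! h4
    rw [le_antisymm h4.1 h1, le_antisymm h4.2 h2] at h3
    simp at h3
  · rintro (h3 | h3) <;> positivity

theorem isRealization {p : Fin H.numV → I → ℝ} (h : H.IsRealization S p) :
    K.IsRealization S (p ∘ R.emb.vert) := by
  rw [isRealization_iff]
  have h' := isRealization_iff.1 h
  obtain ⟨la, hla, ea⟩ := h.parallel R.a
  obtain ⟨lb, hlb, eb⟩ := h.parallel R.b
  rw [R.src_a] at ea
  rw [R.src_b, R.weight_b] at eb
  have hw : ∀ d, R.emb.dart d = H.rev R.a → K.weight d = - H.weight R.a := fun d hd => by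
    rw [R.emb.weight_dart, hd, H.weight_rev]
  have hw' : ∀ d, R.emb.dart d = H.rev R.b → K.weight d = H.weight R.a := fun d hd => by
    rw [R.emb.weight_dart, hd, H.weight_rev, R.weight_b, neg_neg]
  refine ⟨fun v => h'.1 _, fun d => ?_, fun d => ?_⟩
  · simp only [Function.comp, R.emb_tgt, ← R.emb.src_dart]
    have hv := (mem_carrier_iff.1 (h'.1 R.v)).2
    rcases R.dart_cases d with ⟨h1, h2⟩ | ⟨h1, h2⟩ | h1
    · rw [h1, h2]
      exact ⟨_, hv, fun i hi => (R.posSupp_v_iff h i).2 (.inl hi),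
        fun i hi => (R.posSupp_v_iff h i).2 (.inr hi)⟩
    · rw [h1, h2]
      exact ⟨_, hv, fun i hi => (R.posSupp_v_iff h i).2 (.inr hi),
        fun i hi => (R.posSupp_v_iff h i).2 (.inl hi)⟩
    · rw [h1]
      exact h'.2.1 _
  · simp only [Function.comp, R.emb_tgt, ← R.emb.src_dart]
    rcases R.dart_cases d with ⟨h1, h2⟩ | ⟨h1, h2⟩ | h1
    · refine ⟨la + lb, by positivity, ?_⟩
      rw [h1, h2, hw d h1]
      ext i
      have e1 := congrFun ea i
      have e2 := congrFun eb i
      simp only [Pi.sub_apply, Pi.smul_apply, Pi.neg_apply, Int.cast_neg, smul_eq_mul,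
        src_rev] at e1 e2 ⊢
      linear_combination e2 - e1
    · refine ⟨la + lb, by positivity, ?_⟩
      rw [h1, h2, hw' d h1]
      ext i
      have e1 := congrFun ea i
      have e2 := congrFun eb i
      simp only [Pi.sub_apply, Pi.smul_apply, Pi.neg_apply, Int.cast_neg, smul_eq_mul,
        src_rev] at e1 e2 ⊢
      linear_combination e1 - e2
    · rw [h1, R.emb.weight_dart]
      exact h'.2.2 _

/-- Vertex positions for `K` with the same supports as those of a given realization extend to `H`,
by placing the removed vertex at the midpoint of the edge. -/
theorem exists_extension {p : Fin H.numV → I → ℝ} (h : H.IsRealization S p)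
    {r : Fin K.numV → I → ℝ} (hr : K.IsRealization S r)
    (hs : ∀ k, posSupp (r k) = posSupp (p (R.emb.vert k))) :
    ∃ q : Fin H.numV → I → ℝ, H.IsRealization S q ∧ (∀ v, posSupp (q v) = posSupp (p v)) ∧
      q ∘ R.emb.vert = r := by
  classical
  let q : Fin H.numV → I → ℝ := fun x => if x = R.v then
    (1 / 2 : ℝ) • (r (R.col.vert (H.tgt R.a)) + r (R.col.vert (H.tgt R.b))) else r (R.col.vert x)
  have hqv : q R.v =
      (1 / 2 : ℝ) • (r (R.col.vert (H.tgt R.a)) + r (R.col.vert (H.tgt R.b))) := by simp [q]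
  have hqx : ∀ x, x ≠ R.v → q x = r (R.col.vert x) := fun x hx => by simp [q, hx]
  have hqs : ∀ v, posSupp (q v) = posSupp (p v) := by
    intro v
    by_cases hv : v = R.v
    · subst hv
      ext i
      rw [R.posSupp_v_iff h, ← R.emb_col R.tgt_a_ne, ← R.emb_col R.tgt_b_ne, ← hs, ← hs, hqv]
      have h1 := (mem_carrier_iff.1 (hr.vertex_mem (R.col.vert (H.tgt R.a)))).1.1 i
      have h2 := (mem_carrier_iff.1 (hr.vertex_mem (R.col.vert (H.tgt R.b)))).1.1 i
      simp only [mem_posSupp, Pi.add_apply, Pi.smul_apply, smul_eq_mul]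
      grind
    · rw [hqx v hv, hs, R.emb_col hv]
  have hsimp : ∀ v, q v ∈ S.simplex := by
    intro v
    by_cases hv : v = R.v
    · subst hv
      have h1 := (mem_carrier_iff.1 (hr.vertex_mem (R.col.vert (H.tgt R.a)))).1
      have h2 := (mem_carrier_iff.1 (hr.vertex_mem (R.col.vert (H.tgt R.b)))).1
      rw [hqv]
      refine ⟨fun i => ?_, ?_⟩
      · have := h1.1 i
        have := h2.1 i
        simp only [Pi.add_apply, Pi.smul_apply, smul_eq_mul]
        positivity
      · simp only [Pi.add_apply, Pi.smul_apply, smul_eq_mul]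
        rw [← Finset.mul_sum, Finset.sum_add_distrib, h1.2, h2.2]
        ring
    · rw [hqx v hv]
      exact (mem_carrier_iff.1 (hr.vertex_mem _)).1
  have h' := isRealization_iff.1 h
  -- The edge of `K` between the two neighbours of the removed vertex.
  obtain ⟨d, hd1, hd2⟩ := R.exists_joined
  have hsrc : K.src d = R.col.vert (H.tgt R.a) := by
    rw [← R.col_emb (K.src d), ← R.emb.src_dart, hd1, src_rev]
  have htgt : K.tgt d = R.col.vert (H.tgt R.b) := by
    rw [← R.col_emb (K.tgt d), R.emb_tgt, hd2, src_rev]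
  obtain ⟨l, hl, e⟩ := hr.parallel d
  rw [hsrc, htgt, R.emb.weight_dart, hd1, H.weight_rev] at e
  have key : ∀ d', H.src d' = R.v → ∃ l : ℝ, 0 < l ∧
      q (H.tgt d') - q (H.src d') = l • fun i => (H.weight d' i : ℝ) := by
    intro d' hd'
    refine ⟨l / 2, by positivity, ?_⟩
    rcases R.eq_or_eq d' hd' with rfl | rfl
    · rw [hqx _ R.tgt_a_ne, R.src_a, hqv]
      ext i
      have := congrFun e i
      simp only [Pi.sub_apply, Pi.smul_apply, Pi.neg_apply, Pi.add_apply, Int.cast_neg,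
        smul_eq_mul] at this ⊢
      linear_combination (-1 / 2) * this
    · rw [hqx _ R.tgt_b_ne, R.src_b, hqv, R.weight_b]
      ext i
      have := congrFun e i
      simp only [Pi.sub_apply, Pi.smul_apply, Pi.neg_apply, Pi.add_apply, Int.cast_neg,
        smul_eq_mul] at this ⊢
      linear_combination (1 / 2) * this
  refine ⟨q, isRealization_iff.2 ⟨fun v => mem_carrier_iff.2 ⟨hsimp v, ?_⟩, fun d => ?_,
    fun d => ?_⟩, hqs, ?_⟩
  · rw [hqs]
    exact (mem_carrier_iff.1 (h'.1 v)).2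
  · rw [hqs, hqs]
    exact h'.2.1 d
  · by_cases h1 : H.src d = R.v
    · exact key d h1
    by_cases h2 : H.tgt d = R.v
    · obtain ⟨m, hm, em⟩ := key (H.rev d) h2
      refine ⟨m, hm, ?_⟩
      rw [tgt_rev, src_rev, H.weight_rev] at em
      rw [← neg_sub, em, ← smul_neg]
      congr 1
      ext i; simp
    · obtain ⟨e, he1, he2⟩ := R.exists_of_src_ne h1 h2
      obtain ⟨m, hm, em⟩ := hr.parallel e
      refine ⟨m, hm, ?_⟩
      rw [hqx _ h1, hqx _ h2, ← he1, ← R.emb.weight_dart, ← em, R.emb.src_dart, R.col_emb, he1]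
      congr 2
      rw [← R.col_emb (K.tgt e), R.emb_tgt, he2, src_rev]
  · ext1 k
    rw [Function.comp, hqx _ (R.vert_ne k), R.col_emb]

end DecoratedGraph.Removal

/-- The tropical curve obtained by removing a removable vertex. -/
abbrev TropCurve.remove (B : TropCurve S n) {K : DecoratedGraph I n}
    (R : Removal B.toDecoratedGraph K) : TropCurve S n :=
  ⟨K, B.pos ∘ R.emb.vert, R.isRealization B.isRealization⟩

/-- A removable vertex of a tropical curve can be removed, with a choice of the edge that is
collapsed. -/
theorem TropCurve.exists_removal (B : TropCurve S n) {v : Fin B.numV} (hv : B.IsRemovable v)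
    (P : Fin B.numD → Prop) :
    ∃ (K : DecoratedGraph I n) (R : Removal B.toDecoratedGraph K), R.v = v ∧ (P R.b → P R.a) := by
  obtain ⟨a, b, ha, hb, hab, hd, hw⟩ := hv.exists_darts
  have hne : B.tgt a ≠ B.tgt b := by
    intro h
    obtain ⟨l, hl, e⟩ := B.isRealization.parallel a
    obtain ⟨m, hm, e'⟩ := B.isRealization.parallel b
    rw [ha] at e
    rw [hb, ← h, e, hw] at e'
    have : (l + m) • (fun i => (B.weight a i : ℝ)) = 0 := by
      rw [add_smul, e', ← smul_add]
      convert smul_zero m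
      ext i
      simp
    rw [smul_eq_zero] at this
    exact this.elim (by positivity) (B.weight_real_ne_zero a)
  by_cases hP : P b → P a
  · obtain ⟨K, R, h1, h2, h3⟩ := DecoratedGraph.exists_removal hv ha hb hab hd hw hne
    exact ⟨K, R, h1, by rwa [h2, h3]⟩
  · have hw' : B.weight a = -B.weight b := by rw [hw, neg_neg]
    obtain ⟨K, R, h1, h2, h3⟩ := DecoratedGraph.exists_removal hv hb ha hab.symm
      (fun d h => (hd d h).symm) hw' hne.symm
    refine ⟨K, R, h1, ?_⟩
    rw [h2, h3]
    tauto

/-- A simplification of the curve obtained by removing a vertex is a simplification. -/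
def Simplification.ofRemove {B C : TropCurve S n} {K : DecoratedGraph I n}
    (R : Removal B.toDecoratedGraph K) (h : Simplification (B.remove R) C) :
    Simplification B C where
  vert := R.emb.vert ∘ h.vert
  vert_injective := R.emb.vert_injective.comp h.vert_injective
  range_vert := by
    ext v
    simp only [mem_range, Function.comp, mem_ofPred_eq]
    constructor
    · rintro ⟨x, rfl⟩
      rw [R.emb.isRemovable_vert]
      exact h.not_isRemovable_vert x
    · intro hv
      obtain ⟨k, rfl⟩ := R.mem_range v fun h' => hv (h' ▸ R.removable)
      rw [R.emb.isRemovable_vert] at hv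
      obtain ⟨x, rfl⟩ := h.exists_vert hv
      exact ⟨x, rfl⟩
  dart := R.emb.dart ∘ h.dart
  dart_injective := R.emb.dart_injective.comp h.dart_injective
  range_dart := by
    ext d
    simp only [mem_range, Function.comp, mem_ofPred_eq]
    constructor
    · rintro ⟨x, rfl⟩
      rw [R.emb.src_dart, R.emb.isRemovable_vert, show K.src (h.dart x) = _ from h.src_dart x]
      exact h.not_isRemovable_vert _
    · intro hd
      obtain ⟨k, hk⟩ := R.mem_range (B.src d) fun h' => hd (h' ▸ R.removable)
      obtain ⟨e, rfl⟩ := R.emb.exists_dart d k hk.symm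
      rw [R.emb.src_dart, R.emb.isRemovable_vert] at hd
      obtain ⟨x, rfl⟩ := h.exists_dart hd
      exact ⟨x, rfl⟩
  src_dart d := by
    exact (R.emb.src_dart _).trans (congrArg R.emb.vert (h.src_dart d))
  rev_dart d := by
    -- A dart `y` of `K` starts with the dart `emb y` of `B` and ends with the following one.
    let fin : Fin K.numD → Fin B.numD := fun y => B.rev (R.emb.dart (K.rev y))
    have hfin : ∀ y, Relation.ReflTransGen B.Continues (R.emb.dart y) (fin y) := by
      intro y
      have hr := R.removable
      rcases R.dart_cases y with ⟨h1, h2⟩ | ⟨h1, h2⟩ | h1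
      · refine .single ?_
        simp only [fin, h1, h2, B.rev_rev]
        refine ⟨?_, ?_, ?_⟩
        · rw [tgt_rev, R.src_a]; exact hr
        · rw [tgt_rev, R.src_a, R.src_b]
        · rw [B.rev_rev]; exact R.ne.symm
      · refine .single ?_
        simp only [fin, h1, h2, B.rev_rev]
        refine ⟨?_, ?_, ?_⟩
        · rw [tgt_rev, R.src_b]; exact hr
        · rw [tgt_rev, R.src_a, R.src_b]
        · rw [B.rev_rev]; exact R.ne
      · simp only [fin, h1, B.rev_rev]
        exact .refl
    have key : ∀ x y, Relation.ReflTransGen K.Continues x y →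
        Relation.ReflTransGen B.Continues (R.emb.dart x) (fin y) := by
      intro x y hxy
      induction hxy with
      | refl => exact hfin x
      | @tail y z _ hyz ih =>
        obtain ⟨h1, h2, h3⟩ := hyz
        have htgt : B.tgt (fin y) = R.emb.vert (K.tgt y) := by
          simp only [fin, tgt_rev, R.emb_tgt]
        refine (ih.tail ⟨?_, ?_, ?_⟩).trans (hfin z)
        · rw [htgt]
          exact (R.emb.isRemovable_vert _).2 h1
        · rw [htgt, R.emb.src_dart, h2]
        · simp only [fin, B.rev_rev]
          exact fun h => h3 (R.emb.dart_injective h)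
    have := key _ _ (h.rev_dart d)
    simp only [fin] at this
    rwa [show K.rev ((B.remove R).rev (h.dart (C.rev d))) = h.dart (C.rev d) from
      K.rev_rev _] at this
  weight_dart d := (h.weight_dart d).trans (R.emb.weight_dart _)
  pos_vert v := h.pos_vert v
  genus_vert v := (h.genus_vert v).trans (R.emb.genus_vert _)
  mark_vert i := (congrArg R.emb.vert (h.mark_vert i)).trans (R.emb.mark_vert i)

/-- Every tropical curve has a simplification.  It has the same genus, and every realization of
its combinatorial type extends to a realization of the type of the given curve. -/
theorem TropCurve.exists_simplification (B : TropCurve S n) :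
    ∃ (C : TropCurve S n) (h : Simplification B C), C.totalGenus = B.totalGenus ∧
      ∀ r : Fin C.numV → I → ℝ, C.IsRealization S r → (∀ k, posSupp (r k) = posSupp (C.pos k)) →
        ∃ q : Fin B.numV → I → ℝ, B.IsRealization S q ∧ (∀ v, posSupp (q v) = posSupp (B.pos v)) ∧
          q ∘ h.vert = r := by
  obtain ⟨N, hN⟩ : ∃ N, B.numV = N := ⟨_, rfl⟩
  induction N using Nat.strong_induction_on generalizing B with
  | _ N ih =>
    by_cases hB : ∀ v, ¬ B.IsRemovable v
    · exact ⟨B, Simplification.refl hB, rfl, fun r h1 h2 => ⟨r, h1, h2, rfl⟩⟩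
    · push Not at hB
      obtain ⟨v, hv⟩ := hB
      obtain ⟨K, R, -, -⟩ := B.exists_removal hv (fun _ => True)
      obtain ⟨C, h, hg, hl⟩ := ih _ (hN ▸ R.numV_lt) (B.remove R) rfl
      refine ⟨C, h.ofRemove R, hg.trans R.col.totalGenus_eq, fun r h1 h2 => ?_⟩
      obtain ⟨q, h3, h4, h5⟩ := hl r h1 h2
      obtain ⟨q', h6, h7, h8⟩ := R.exists_extension B.isRealization h3 h4
      refine ⟨q', h6, h7, ?_⟩
      rw [← h5, ← h8]
      rfl

end Curves

/-! ### Limits of families of curves -/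

section Limits
open DecoratedGraph ClemensPolytope
variable {I : Type u} {n : ℕ} [Fintype I] [DecidableEq I] {S : ClemensPolytope I}
  {ω : SimpleDensity S} {g : ℕ} {A : ℝ}

/-- The relation `IsLimit`, which only depends on the graph underlying a combinatorial type. -/
def IsLimitOf (G : DecoratedGraph I n) (p : Fin G.numV → I → ℝ) (c : Moduli ω g n A) : Prop :=
  ∃ (B : TropCurve S n) (C : SimpleCurve ω g n A),
    Nonempty (Contraction G p B) ∧ Nonempty (Simplification B C.1) ∧ Moduli.mk C = c

theorem Moduli.mk_eq_iff {C D : SimpleCurve ω g n A} :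
    Moduli.mk C = Moduli.mk D ↔ ∃ φ : C.1.toDecoratedGraph.Iso D.1.toDecoratedGraph,
      ∀ v, D.1.pos (φ.vert v) = C.1.pos v := Quotient.eq

theorem IsLimitOf.unique {G : DecoratedGraph I n} {p : Fin G.numV → I → ℝ}
    {c c' : Moduli ω g n A} (h : IsLimitOf G p c) (h' : IsLimitOf G p c') : c = c' := by
  obtain ⟨B, C, ⟨f⟩, ⟨s⟩, rfl⟩ := h
  obtain ⟨B', C', ⟨f'⟩, ⟨s'⟩, rfl⟩ := h'
  obtain ⟨φ, hφ⟩ := f.exists_iso f'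
  have t := s.congrLeft φ (f.pos_iso f' hφ)
  obtain ⟨ψ, hψ⟩ := t.exists_iso s'
  exact Moduli.mk_eq_iff.2 ⟨ψ, t.pos_iso s' hψ⟩

/-- The limit does not change if edges of length zero are collapsed. -/
theorem IsLimitOf.collapse {G H : DecoratedGraph I n} {p : Fin G.numV → I → ℝ}
    {c : Moduli ω g n A} (h : IsLimitOf G p c) (f : Collapse G H) {q : Fin H.numV → I → ℝ}
    (hq : ∀ v, q (f.vert v) = p v) : IsLimitOf H q c := by
  obtain ⟨B, C, ⟨k⟩, s, hc⟩ := h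
  obtain ⟨k', hk'⟩ := f.exists_cancel k.toCollapse fun u v huv => (k.vert_eq_iff u v).2 <|
    reflTransGen_imp (fun a b ⟨d, h1, h2, h3⟩ => ⟨d, h1, h2, by rw [← hq, h3, hq]⟩)
      (f.fibre_connected u v huv)
  refine ⟨B, C, ⟨k'.toContraction fun x => ?_⟩, s, hc⟩
  obtain ⟨v, rfl⟩ := f.vert_surjective x
  rw [hk', hq]
  exact k.pos_vert v

/-- The limit does not change if a removable vertex is removed. -/
theorem IsLimitOf.removal {B : TropCurve S n} {K : DecoratedGraph I n}
    (R : Removal B.toDecoratedGraph K) {q : Fin B.numV → I → ℝ} {c : Moduli ω g n A}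
    (h : IsLimitOf B.toDecoratedGraph q c)
    (hq : q R.v = q (B.tgt R.b) → q R.v = q (B.tgt R.a)) :
    IsLimitOf K (q ∘ R.emb.vert) c := by
  by_cases ha : q R.v = q (B.tgt R.a)
  · -- The removal is the collapse of an edge of length zero.
    refine h.collapse R.col fun x => ?_
    by_cases hx : x = R.v
    · rw [hx, R.col_v, Function.comp, R.emb_col R.tgt_a_ne, ha]
    · rw [Function.comp, R.emb_col hx]
  · -- The removed vertex remains removable after the contraction of the edges of length zero.
    have hb : q R.v ≠ q (B.tgt R.b) := fun h => ha (hq h)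
    obtain ⟨B₁, C, ⟨k⟩, ⟨s⟩, hc⟩ := h
    have hfib : ∀ x, k.vert R.v = k.vert x → x = R.v := by
      intro x hx
      rcases Relation.ReflTransGen.cases_head ((k.vert_eq_iff _ _).1 hx) with h | ⟨y, hy, -⟩
      · exact h.symm
      · obtain ⟨d, h1, rfl, h3⟩ := hy
        rcases R.eq_or_eq d h1 with rfl | rfl
        · exact absurd h3 ha
        · exact absurd h3 hb
    have hdart : ∀ d, q (B.src d) ≠ q (B.tgt d) → ∃ e, k.dart e = d := by
      intro d hd
      have : d ∈ range k.dart := by rw [k.range_dart]; exact hd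
      exact this
    obtain ⟨a₁, ha₁⟩ := hdart R.a (by rwa [R.src_a])
    obtain ⟨b₁, hb₁⟩ := hdart R.b (by rwa [R.src_b])
    have hsrc : ∀ d, B₁.src d = k.vert R.v ↔ d = a₁ ∨ d = b₁ := by
      intro d
      rw [k.src_dart]
      constructor
      · intro h
        rcases R.eq_or_eq _ (hfib _ h.symm) with h | h
        · exact .inl (k.dart_injective (h.trans ha₁.symm))
        · exact .inr (k.dart_injective (h.trans hb₁.symm))
      · rintro (rfl | rfl)
        · rw [ha₁, R.src_a]
        · rw [hb₁, R.src_b]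
    have hab : a₁ ≠ b₁ := fun h => R.ne (by rw [← ha₁, h, hb₁])
    have hfibre : (Finset.univ.filter fun x => k.vert x = k.vert R.v) = {R.v} := by
      ext x
      simp only [Finset.mem_filter, Finset.mem_univ, true_and, Finset.mem_singleton]
      exact ⟨fun h => hfib x h.symm, fun h => by rw [h]⟩
    have hrem : B₁.IsRemovable (k.vert R.v) := by
      obtain ⟨h1, h2, h3, h4⟩ := R.removable
      refine ⟨?_, ?_, ?_, ?_⟩
      · have : (Finset.univ.filter fun d => B₁.src d = k.vert R.v) = {a₁, b₁} := by
          ext d; simp [hsrc]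
        rw [degree, this, Finset.card_pair hab]
      · have := k.genus_vert (k.vert R.v)
        rw [hfibre, bettiOn_singleton, Finset.sum_singleton, h2] at this
        simpa using this
      · rw [numMarks, Finset.card_eq_zero, Finset.filter_eq_empty_iff] at h3 ⊢
        intro i hi h
        rw [k.mark_vert] at h
        exact h3 hi (hfib _ h.symm)
      · have := k.toCollapse.weightSum_eq (k.vert R.v)
        rw [IsTypeA, not_not] at h4 ⊢
        rw [this]
        refine (Finset.sum_congr hfibre fun _ _ => rfl).trans ?_
        rw [Finset.sum_singleton, h4]
    obtain ⟨K₁, R₁, hv, hR⟩ := B₁.exists_removal hrem (fun d => d = a₁)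
    have ha' : a₁ = R₁.a := by
      rcases R₁.eq_or_eq a₁ (by rw [hv]; exact (hsrc a₁).2 (.inl rfl)) with h | h
      · exact h
      · exact absurd ((hR h.symm).trans h) R₁.ne
    have htgt : k.vert (B.tgt R.a) = B₁.tgt a₁ := by
      rw [← ha₁]
      exact (k.toCollapse.tgt_dart a₁).symm
    obtain ⟨m, hm⟩ := R.col.exists_cancel (k.toCollapse.comp R₁.col) (by
      have hva : R₁.col.vert (k.vert R.v) = R₁.col.vert (k.vert (B.tgt R.a)) := by
        rw [htgt, ha', ← hv]
        exact R₁.col_v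
      intro x y hxy
      rcases R.col_eq hxy with rfl | ⟨rfl, rfl⟩ | ⟨rfl, rfl⟩
      · rfl
      · exact hva
      · exact hva.symm)
    obtain ⟨C', t, -⟩ := (B₁.remove R₁).exists_simplification
    obtain ⟨φ, hφ⟩ := s.exists_iso (t.ofRemove R₁)
    refine ⟨B₁.remove R₁, C, ⟨m.toContraction fun x => ?_⟩,
      ⟨t.congrRight φ (s.pos_iso (t.ofRemove R₁) hφ)⟩, hc⟩
    have h1 : m.vert x = R₁.col.vert (k.vert (R.emb.vert x)) := by
      rw [← R.col_emb x, hm, R.col_emb]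
      rfl
    have h2 : k.vert (R.emb.vert x) ≠ R₁.v := by
      rw [hv]
      exact fun h => R.vert_ne x (hfib _ h.symm)
    rw [h1]
    change B₁.pos (R₁.emb.vert _) = _
    rw [R₁.emb_col h2, k.pos_vert]
    rfl

/-- The limit does not change if a curve is simplified first. -/
theorem IsLimitOf.simplification {B C : TropCurve S n} (h : Simplification B C)
    {q : Fin B.numV → I → ℝ} {c : Moduli ω g n A} (hc : IsLimitOf B.toDecoratedGraph q c) :
    IsLimitOf C.toDecoratedGraph (q ∘ h.vert) c := by
  have key : ∃ (C' : TropCurve S n) (h' : Simplification B C'),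
      IsLimitOf C'.toDecoratedGraph (q ∘ h'.vert) c := by
    clear h
    obtain ⟨N, hN⟩ : ∃ N, B.numV = N := ⟨_, rfl⟩
    induction N using Nat.strong_induction_on generalizing B with
    | _ N ih =>
      by_cases hB : ∀ v, ¬ B.IsRemovable v
      · exact ⟨B, Simplification.refl hB, hc⟩
      · push Not at hB
        obtain ⟨v, hv⟩ := hB
        obtain ⟨K, R, rfl, hR⟩ := B.exists_removal hv (fun d => q v = q (B.tgt d))
        obtain ⟨C', h', hc'⟩ := ih _ (hN ▸ R.numV_lt) (B := B.remove R) (hc.removal R hR) rfl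
        exact ⟨C', h'.ofRemove R, hc'⟩
  obtain ⟨C', h', hc'⟩ := key
  obtain ⟨φ, hφ⟩ := h'.exists_iso h
  exact hc'.collapse φ.toCollapse fun v => congrArg q (hφ v)

/-- The limit of `(G, q)` is determined by the vertices of the limit of `(G, p)`, if every edge
that has length zero for `p` also has length zero for `q`. -/
theorem IsLimitOf.specialize {G : DecoratedGraph I n} {p : Fin G.numV → I → ℝ}
    {C : SimpleCurve ω g n A} (h : IsLimitOf G p (Moduli.mk C)) :
    ∃ s : Fin C.1.numV → Fin G.numV, (∀ x, p (s x) = C.1.pos x) ∧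
      ∀ q : Fin G.numV → I → ℝ, (∀ d, p (G.src d) = p (G.tgt d) → q (G.src d) = q (G.tgt d)) →
        ∀ c : Moduli ω g n A, IsLimitOf G q c → IsLimitOf C.1.toDecoratedGraph (q ∘ s) c := by
  obtain ⟨B, C', ⟨k⟩, ⟨h⟩, hC⟩ := h
  obtain ⟨φ, hφ⟩ := Moduli.mk_eq_iff.1 hC.symm
  replace h := h.congrRight φ hφ
  choose s hs using k.vert_surjective
  refine ⟨s ∘ h.vert, fun x => ?_, fun q hq c hc => ?_⟩
  · rw [Function.comp, ← k.pos_vert, hs, h.pos_vert]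
  · have hfib : ∀ u v, k.vert u = k.vert v → q u = q v := by
      intro u v huv
      have := (k.vert_eq_iff u v).1 huv
      clear huv
      induction this with
      | refl => rfl
      | tail _ hbc ih =>
        obtain ⟨d, rfl, rfl, h3⟩ := hbc
        rw [ih, hq d h3]
    have h1 : IsLimitOf B.toDecoratedGraph (q ∘ s) c :=
      hc.collapse k.toCollapse fun v => hfib _ _ (hs _)
    exact h1.simplification h

/-- If `(G, p)` and `(H, q)` have the same limit, then so do all `(G, p')` and `(H, q')` that
satisfy finitely many closed conditions, which are satisfied by `(p, q)`: edges of length zero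
stay so, and certain vertices of `G` and `H` have the same positions. -/
theorem IsLimitOf.exists_relation {G H : DecoratedGraph I n} {p : Fin G.numV → I → ℝ}
    {q : Fin H.numV → I → ℝ} {c : Moduli ω g n A} (hp : IsLimitOf G p c) (hq : IsLimitOf H q c) :
    ∃ T : Set (Fin G.numV × Fin H.numV), (∀ x ∈ T, p x.1 = q x.2) ∧
      ∀ (p' : Fin G.numV → I → ℝ) (q' : Fin H.numV → I → ℝ),
        (∀ d, p (G.src d) = p (G.tgt d) → p' (G.src d) = p' (G.tgt d)) →
        (∀ d, q (H.src d) = q (H.tgt d) → q' (H.src d) = q' (H.tgt d)) →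
        (∀ x ∈ T, p' x.1 = q' x.2) →
        ∀ c c' : Moduli ω g n A, IsLimitOf G p' c → IsLimitOf H q' c' → c = c' := by
  obtain ⟨C, rfl⟩ := Quotient.exists_rep c
  obtain ⟨s, hs, hs'⟩ := hp.specialize
  obtain ⟨t, ht, ht'⟩ := hq.specialize
  refine ⟨range fun x => (s x, t x), ?_, fun p' q' h1 h2 h3 c c' h4 h5 => ?_⟩
  · rintro _ ⟨x, rfl⟩
    exact (hs x).trans (ht x).symm
  · have h6 := hs' p' h1 c h4
    have h7 := ht' q' h2 c' h5
    have : p' ∘ s = q' ∘ t := funext fun x => h3 _ ⟨x, rfl⟩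
    rw [this] at h6
    exact h6.unique h7

end Limits

/-! ### Vectors on a ray -/

section Ray
variable {I : Type u}

theorem eq_smul_of_cross {w x : I → ℝ} {i : I} (hi : w i ≠ 0)
    (h : ∀ i k, w k * x i = w i * x k) : x = (x i / w i) • w := by
  ext k
  have := h i k
  simp only [Pi.smul_apply, smul_eq_mul]
  field_simp
  linarith

theorem exists_pos_smul_iff {w x : I → ℝ} (hw : w ≠ 0) :
    (∃ l : ℝ, 0 < l ∧ x = l • w) ↔
      (∀ i k, w k * x i = w i * x k) ∧ ∀ i, w i ≠ 0 → 0 < w i * x i := by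
  constructor
  · rintro ⟨l, hl, rfl⟩
    refine ⟨fun i k => ?_, fun i hi => ?_⟩
    · simp only [Pi.smul_apply, smul_eq_mul]; ring
    · simp only [Pi.smul_apply, smul_eq_mul]
      have := mul_pos hl (mul_self_pos.2 hi)
      linarith
  · rintro ⟨h1, h2⟩
    obtain ⟨i, hi⟩ := Function.ne_iff.1 hw
    refine ⟨_, ?_, eq_smul_of_cross hi h1⟩
    have h3 := h2 i hi
    have : x i / w i = (w i * x i) / (w i * w i) := by
      rw [mul_div_mul_left _ _ hi]
    rw [this]
    exact div_pos h3 (mul_self_pos.2 hi)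

theorem exists_nonneg_smul_iff {w x : I → ℝ} (hw : w ≠ 0) :
    (∃ l : ℝ, 0 ≤ l ∧ x = l • w) ↔
      (∀ i k, w k * x i = w i * x k) ∧ ∀ i, 0 ≤ w i * x i := by
  constructor
  · rintro ⟨l, hl, rfl⟩
    refine ⟨fun i k => ?_, fun i => ?_⟩
    · simp only [Pi.smul_apply, smul_eq_mul]; ring
    · simp only [Pi.smul_apply, smul_eq_mul]
      have := mul_nonneg hl (mul_self_nonneg (w i))
      linarith
  · rintro ⟨h1, h2⟩
    obtain ⟨i, hi⟩ := Function.ne_iff.1 hw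
    refine ⟨_, ?_, eq_smul_of_cross hi h1⟩
    have h3 := h2 i
    have : x i / w i = (w i * x i) / (w i * w i) := by
      rw [mul_div_mul_left _ _ hi]
    rw [this]
    exact div_nonneg h3 (mul_self_nonneg _)

end Ray

/-! ### The polyhedron of a combinatorial type -/

namespace CombType
open DecoratedGraph ClemensPolytope
variable {I : Type u} {n : ℕ} [Fintype I] {S : ClemensPolytope I} {α : CombType I n}

theorem IsGood.realizations_nonempty (h : α.IsGood S) : (α.realizations S).Nonempty := by
  obtain ⟨C, φ, hφ⟩ := h
  let ψ : Iso α.toDecoratedGraph C.toDecoratedGraph := φ.symm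
  have hψ : ∀ v, φ.vert (ψ.vert v) = v := fun v => φ.vert.apply_symm_apply v
  have hC := isRealization_iff.1 C.isRealization
  refine ⟨C.pos ∘ ψ.vert, isRealization_iff.2 ⟨fun v => hC.1 _, fun d => ?_, fun d => ?_⟩,
    fun v => mem_openFace_iff.2 ⟨(mem_carrier_iff.1 (hC.1 _)).1, ?_⟩⟩
  · have := hC.2.1 (ψ.dart d)
    rwa [ψ.tgt_dart, ψ.src_dart] at this
  · have := hC.2.2 (ψ.dart d)
    rwa [ψ.tgt_dart, ψ.src_dart, ψ.weight_dart] at this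
  · exact (hφ (ψ.vert v)).symm.trans (congrArg α.face (hψ v))

theorem IsGood.face_mem (h : α.IsGood S) (v : Fin α.numV) : α.face v ∈ S.faces := by
  obtain ⟨p, hp⟩ := h.realizations_nonempty
  rw [← (mem_openFace_iff.1 (hp.2 v)).2]
  exact (mem_carrier_iff.1 (hp.1.vertex_mem v)).2

theorem IsGood.exists_face (h : α.IsGood S) (d : Fin α.numD) :
    ∃ F ∈ S.faces, α.face (α.src d) ⊆ F ∧ α.face (α.tgt d) ⊆ F := by
  obtain ⟨p, hp⟩ := h.realizations_nonempty
  rw [← (mem_openFace_iff.1 (hp.2 _)).2, ← (mem_openFace_iff.1 (hp.2 (α.tgt d))).2]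
  exact (isRealization_iff.1 hp.1).2.1 d

/-- For a good type, the conditions on faces only depend on the type. -/
theorem IsGood.mem_realizations_iff (h : α.IsGood S) {p : Fin α.numV → I → ℝ} :
    p ∈ α.realizations S ↔ (∀ v, p v ∈ S.openFace (α.face v)) ∧
      ∀ d, ∃ l : ℝ, 0 < l ∧ p (α.tgt d) - p (α.src d) = l • fun i => (α.weight d i : ℝ) := by
  constructor
  · exact fun hp => ⟨hp.2, hp.1.parallel⟩
  · rintro ⟨h1, h2⟩
    have h3 := fun v => mem_openFace_iff.1 (h1 v)
    refine ⟨isRealization_iff.2 ⟨fun v => mem_carrier_iff.2 ⟨(h3 v).1, ?_⟩, fun d => ?_, h2⟩, h1⟩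
    · rw [(h3 v).2]; exact h.face_mem v
    · rw [(h3 _).2, (h3 (α.tgt d)).2]; exact h.exists_face d

/-- The vertex positions satisfying the weak inequalities corresponding to the strict inequalities
that define the realizations of a type: vertices may move to the boundary of their face, and edges
may have length zero. -/
def weakRealizations (S : ClemensPolytope I) (α : CombType I n) : Set (Fin α.numV → I → ℝ) :=
  {p | (∀ v, p v ∈ S.closedFace (α.face v)) ∧ α.WeakParallel p}

theorem realizations_subset_weak : α.realizations S ⊆ α.weakRealizations S :=
  fun _ hp => ⟨fun v => (hp.2 v).1, hp.1.weakParallel⟩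

theorem isClosed_closedFace (F : Finset I) : IsClosed (S.closedFace F) := by
  simp only [closedFace, ofPred_and, ofPred_forall]
  refine .inter (isClosed_iInter fun i => ?_) (.inter ?_ (isClosed_iInter fun i =>
    isClosed_iInter fun _ => ?_))
  · exact isClosed_le continuous_const (continuous_apply i)
  · exact isClosed_eq (by fun_prop) continuous_const
  · exact isClosed_eq (by fun_prop) continuous_const

theorem isClosed_weakRealizations : IsClosed (α.weakRealizations S) := by
  have : α.weakRealizations S = (⋂ v, (fun p => p v) ⁻¹' S.closedFace (α.face v)) ∩
      ⋂ d, {p | (∀ i k, (α.weight d k : ℝ) * (p (α.tgt d) - p (α.src d)) i =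
        α.weight d i * (p (α.tgt d) - p (α.src d)) k) ∧
        ∀ i, 0 ≤ (α.weight d i : ℝ) * (p (α.tgt d) - p (α.src d)) i} := by
    ext p
    simp only [weakRealizations, WeakParallel, mem_inter_iff, mem_iInter, mem_preimage,
      mem_ofPred_eq]
    exact and_congr_right fun _ => forall_congr' fun d =>
      exists_nonneg_smul_iff (α.weight_real_ne_zero d)
  rw [this]
  refine .inter (isClosed_iInter fun v => (isClosed_closedFace _).preimage (continuous_apply v))
    (isClosed_iInter fun d => ?_)
  simp only [ofPred_and, ofPred_forall]
  refine .inter (isClosed_iInter fun i => isClosed_iInter fun k => ?_) (isClosed_iInter fun i => ?_)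
  · exact isClosed_eq (by simp only [Pi.sub_apply]; fun_prop) (by simp only [Pi.sub_apply]; fun_prop)
  · exact isClosed_le continuous_const (by simp only [Pi.sub_apply]; fun_prop)

/-- The segment from a realization to a weak realization consists of realizations, except possibly
for the endpoint. -/
theorem IsGood.combination_mem (h : α.IsGood S) {p q : Fin α.numV → I → ℝ}
    (hp : p ∈ α.realizations S) (hq : q ∈ α.weakRealizations S) {s t : ℝ} (hs : 0 < s)
    (ht : 0 ≤ t) (hst : s + t = 1) : s • p + t • q ∈ α.realizations S := by
  rw [h.mem_realizations_iff] at hp ⊢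
  refine ⟨fun v => ?_, fun d => ?_⟩
  · refine ⟨convex_closedFace _ (hp.1 v).1 (hq.1 v) hs.le ht hst, fun i hi => ?_⟩
    have h1 := (hp.1 v).2 i hi
    have h2 := (hq.1 v).1 i
    simp only [Pi.add_apply, Pi.smul_apply, smul_eq_mul]
    positivity
  · obtain ⟨l, hl, e⟩ := hp.2 d
    obtain ⟨m, hm, e'⟩ := hq.2 d
    refine ⟨s * l + t * m, by positivity, ?_⟩
    simp only [Pi.add_apply, Pi.smul_apply]
    rw [add_sub_add_comm, ← smul_sub, ← smul_sub, e, e', add_smul, mul_smul, mul_smul]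

theorem IsGood.closure_realizations (h : α.IsGood S) :
    closure (α.realizations S) = α.weakRealizations S := by
  refine (closure_minimal realizations_subset_weak isClosed_weakRealizations).antisymm
    fun q hq => ?_
  obtain ⟨p, hp⟩ := h.realizations_nonempty
  have hc : Continuous fun s : ℝ => s • p + (1 - s) • q := by fun_prop
  have h0 : (0 : ℝ) ∈ closure (Ioo 0 1) := by
    rw [closure_Ioo zero_ne_one]; simp
  have h1 := image_closure_subset_closure_image hc (s := Ioo 0 1)
  have h2 : q ∈ (fun s : ℝ => s • p + (1 - s) • q) '' closure (Ioo 0 1) := ⟨0, h0, by simp⟩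
  refine closure_mono ?_ (h1 h2)
  rintro _ ⟨s, hs, rfl⟩
  exact h.combination_mem hp hq hs.1 (by linarith [hs.2]) (by ring)

theorem IsGood.isOpenConvexPolyhedron (h : α.IsGood S) :
    IsOpenConvexPolyhedron (α.realizations S) := by
  classical
  let L : AffineSubspace ℝ (Fin α.numV → I → ℝ) :=
    { carrier := {p | (∀ v i, i ∉ α.face v → p v i = 0) ∧ (∀ v, ∑ i, p v i = S.scale) ∧
        ∀ d i k, (α.weight d k : ℝ) * (p (α.tgt d) - p (α.src d)) i =
          α.weight d i * (p (α.tgt d) - p (α.src d)) k}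
      smul_vsub_vadd_mem' := by
        rintro c p q r ⟨hp1, hp2, hp3⟩ ⟨hq1, hq2, hq3⟩ ⟨hr1, hr2, hr3⟩
        refine ⟨fun v i hi => ?_, fun v => ?_, fun d i k => ?_⟩
        · simp [hp1 v i hi, hq1 v i hi, hr1 v i hi]
        · simp [Finset.sum_add_distrib, ← Finset.mul_sum, hp2, hq2, hr2]
        · have e1 := hp3 d i k
          have e2 := hq3 d i k
          have e3 := hr3 d i k
          simp only [vsub_eq_sub, vadd_eq_add, Pi.add_apply, Pi.sub_apply, Pi.smul_apply,
            smul_eq_mul] at e1 e2 e3 ⊢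
          linear_combination c * e1 - c * e2 + e3 }
  let ι := (Fin α.numV × I) ⊕ (Fin α.numD × I)
  let e := Fintype.equivFin ι
  let coord (v : Fin α.numV) (i : I) : (Fin α.numV → I → ℝ) →ₗ[ℝ] ℝ :=
    LinearMap.proj i ∘ₗ LinearMap.proj v
  have coord_apply : ∀ v i p, coord v i p = p v i := fun _ _ _ => rfl
  let f : ι → (Fin α.numV → I → ℝ) →ᵃ[ℝ] ℝ := Sum.elim
    (fun x => if x.2 ∈ α.face x.1 then (coord x.1 x.2).toAffineMap else AffineMap.const ℝ _ 1)
    (fun x => if (α.weight x.1 x.2 : ℝ) ≠ 0 then ((α.weight x.1 x.2 : ℝ) •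
      (coord (α.tgt x.1) x.2 - coord (α.src x.1) x.2)).toAffineMap else AffineMap.const ℝ _ 1)
  refine ⟨L, Fintype.card ι, f ∘ e.symm, ?_⟩
  ext p
  have h1 : (∀ i, 0 < (f ∘ e.symm) i p) ↔ (∀ v, ∀ i ∈ α.face v, 0 < p v i) ∧
      ∀ d i, (α.weight d i : ℝ) ≠ 0 →
        0 < (α.weight d i : ℝ) * (p (α.tgt d) - p (α.src d)) i := by
    simp only [Function.comp]
    rw [← e.symm.surjective.forall (p := fun x => 0 < f x p), Sum.forall, Prod.forall, Prod.forall]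
    refine and_congr (forall_congr' fun v => forall_congr' fun i => ?_)
      (forall_congr' fun d => forall_congr' fun i => ?_)
    · by_cases hi : i ∈ α.face v <;> simp [f, hi, coord_apply]
    · by_cases hi : (α.weight d i : ℝ) ≠ 0
      · have h3 : f (.inr (d, i)) p =
            (α.weight d i : ℝ) * (p (α.tgt d) - p (α.src d)) i := by
          simp only [f, Sum.elim_inr, if_pos hi]
          simp [coord_apply]
        rw [h3]
        exact ⟨fun h _ => h, fun h => h hi⟩
      · have h3 : f (.inr (d, i)) p = 1 := by
          simp only [f, Sum.elim_inr, if_neg hi]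
          simp
        rw [h3]
        exact ⟨fun _ h => absurd h hi, fun _ => one_pos⟩
  have h2 : p ∈ L ↔ (∀ v i, i ∉ α.face v → p v i = 0) ∧ (∀ v, ∑ i, p v i = S.scale) ∧
        ∀ d i k, (α.weight d k : ℝ) * (p (α.tgt d) - p (α.src d)) i =
          α.weight d i * (p (α.tgt d) - p (α.src d)) k := Iff.rfl
  rw [mem_ofPred_eq, h1, h2, h.mem_realizations_iff]
  simp only [exists_pos_smul_iff (α.weight_real_ne_zero _), openFace, closedFace, mem_ofPred_eq]
  constructor
  · rintro ⟨h3, h4⟩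
    exact ⟨⟨fun v => (h3 v).1.2.2, fun v => (h3 v).1.2.1, fun d => (h4 d).1⟩,
      fun v => (h3 v).2, fun d => (h4 d).2⟩
  · rintro ⟨⟨h3, h4, h5⟩, h6, h7⟩
    refine ⟨fun v => ⟨⟨fun i => ?_, h4 v, h3 v⟩, h6 v⟩, fun d => ⟨h5 d, h7 d⟩⟩
    by_cases hi : i ∈ α.face v
    · exact (h6 v i hi).le
    · exact (h3 v i hi).ge

theorem weakRealizations_subset_pi :
    α.weakRealizations S ⊆ Set.pi univ fun _ => Set.pi univ fun _ => Icc 0 S.scale := by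
  intro p hp v _ i _
  obtain ⟨h1, h2, -⟩ := hp.1 v
  refine ⟨h1 i, ?_⟩
  rw [← h2]
  exact Finset.single_le_sum (fun j _ => h1 j) (Finset.mem_univ i)

theorem isCompact_weakRealizations : IsCompact (α.weakRealizations S) :=
  (isCompact_univ_pi fun _ => isCompact_univ_pi fun _ => isCompact_Icc).of_isClosed_subset
    isClosed_weakRealizations weakRealizations_subset_pi

/-! ### The degree of limits -/

section Degree
variable [DecidableEq I] {ω : SimpleDensity S}

theorem IsGood.mem_link_of_weight (h : α.IsGood S) {d : Fin α.numD} {j : I}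
    (hj : α.weight d j ≠ 0) : j ∈ S.link (α.face (α.src d)) := by
  obtain ⟨p, hp⟩ := h.realizations_nonempty
  obtain ⟨F, hF, h1, h2⟩ := h.exists_face d
  have h3 : j ∈ F := by
    by_contra hjF
    obtain ⟨l, hl, e⟩ := hp.1.parallel d
    have e := congrFun e j
    have h4 := (hp.2 (α.src d)).1.2.2 j fun h => hjF (h1 h)
    have h5 := (hp.2 (α.tgt d)).1.2.2 j fun h => hjF (h2 h)
    simp only [Pi.sub_apply, h4, h5, Pi.smul_apply, smul_eq_mul, sub_zero] at e
    rcases mul_eq_zero.1 e.symm with h | h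
    · exact hl.ne' h
    · exact hj (by exact_mod_cast h)
  exact S.mem_faces_of_subset hF (Finset.insert_subset h3 h1) (Finset.insert_nonempty _ _)

theorem IsGood.mem_link_of_weightSum (h : α.IsGood S) {v : Fin α.numV} {j : I}
    (hj : α.weightSum v j ≠ 0) : j ∈ S.link (α.face v) := by
  rw [weightSum, Finset.sum_apply] at hj
  obtain ⟨d, hd, hj⟩ := Finset.exists_ne_zero_of_sum_ne_zero hj
  simp only [Finset.mem_filter, Finset.mem_univ, true_and] at hd
  rw [← hd]
  exact h.mem_link_of_weight hj

/-- The degree does not increase under contractions, because densities are monotone. -/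
theorem IsGood.tropicalDegree_contraction_le (h : α.IsGood S) {p : Fin α.numV → I → ℝ}
    (hp : p ∈ α.weakRealizations S) {B : TropCurve S n} (c : Contraction α.toDecoratedGraph p B) :
    B.type.tropicalDegree ω ≤ α.tropicalDegree ω := by
  have hsub : ∀ v, B.type.face (c.vert v) ⊆ α.face v := fun v => by
    rw [← B.posSupp_pos, c.pos_vert]
    exact (mem_closedFace_iff.1 (hp.1 v)).2
  have huniv : c.toCollapse.preimage Finset.univ = Finset.univ := by
    ext; simp [Collapse.mem_preimage]
  unfold tropicalDegree
  rw [← huniv, ← c.toCollapse.sum_preimage]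
  refine Finset.sum_le_sum fun b _ => iSup₂_le fun j hj => ?_
  have h1 : (B.type.weightSum b j).natAbs ≤
      ∑ v ∈ c.toCollapse.fibre b, (α.weightSum v j).natAbs := by
    have : B.type.weightSum b = _ := c.toCollapse.weightSum_eq b
    rw [this, Finset.sum_apply]
    exact Int.natAbs_sum_le _ _
  calc _ ≤ ω.ω (B.type.face b) j *
        ((∑ v ∈ c.toCollapse.fibre b, (α.weightSum v j).natAbs : ℕ) : ℝ≥0∞) := by gcongr
    _ = ∑ v ∈ c.toCollapse.fibre b, ω.ω (B.type.face b) j * ((α.weightSum v j).natAbs : ℝ≥0∞) := by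
        rw [Nat.cast_sum, Finset.mul_sum]
    _ ≤ _ := by
        refine Finset.sum_le_sum fun v hv => ?_
        obtain rfl : c.vert v = b := c.toCollapse.mem_fibre.1 hv
        by_cases hz : α.weightSum v j = 0
        · simp [hz]
        · have hl := h.mem_link_of_weightSum hz
          refine le_trans ?_ (le_iSup₂ (f := fun j _ =>
            ω.ω (α.face v) j * ((α.weightSum v j).natAbs : ℝ≥0∞)) j hl)
          gcongr
          refine ω.mono _ (h.face_mem v) _ ?_ (hsub v) j hl
          have := (mem_carrier_iff.1 (B.isRealization.vertex_mem (c.vert v))).2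
          rwa [B.posSupp_pos] at this

theorem tropicalDegree_simplification_le {B C : TropCurve S n} (h : Simplification B C) :
    C.type.tropicalDegree ω ≤ B.type.tropicalDegree ω := by
  have key : ∀ x : Fin C.numV, C.type.localDegree ω x = B.type.localDegree ω (h.vert x) := by
    intro x
    have h1 : B.type.face (h.vert x) = C.type.face x :=
      congrArg posSupp (h.pos_vert x).symm
    have h2 : B.type.weightSum (h.vert x) = C.type.weightSum x :=
      h.toStarEmbedding.weightSum_vert x
    unfold localDegree
    rw [h1, h2]
  unfold tropicalDegree
  calc ∑ x : Fin C.numV, C.type.localDegree ω x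
      = ∑ x : Fin C.numV, B.type.localDegree ω (h.vert x) := Finset.sum_congr rfl fun x _ => key x
    _ = ∑ v ∈ Finset.univ.image h.vert, B.type.localDegree ω v :=
        (Finset.sum_image h.vert_injective.injOn).symm
    _ ≤ ∑ v : Fin B.numV, B.type.localDegree ω v :=
        Finset.sum_le_sum_of_subset (Finset.subset_univ _)

/-- Every point of the closed polyhedron of an admissible type has a limit. -/
theorem IsAdmissible.exists_limit {g : ℕ} {A : ℝ} (hα : α.IsAdmissible ω g A)
    {p : Fin α.numV → I → ℝ} (hp : p ∈ α.weakRealizations S) :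
    ∃ c : Moduli ω g n A, IsLimit α p c := by
  have h0 := fun v => mem_closedFace_iff.1 (hp.1 v)
  obtain ⟨B, ⟨c⟩⟩ := exists_contraction (S := S) (G := α.toDecoratedGraph) (p := p)
    (fun v => mem_carrier_iff.2 ⟨(h0 v).1, S.mem_faces_of_subset (hα.good.face_mem v) (h0 v).2
      (posSupp_nonempty (h0 v).1)⟩)
    (fun d => by
      obtain ⟨F, hF, h1, h2⟩ := hα.good.exists_face d
      exact ⟨F, hF, (h0 _).2.trans h1, (h0 _).2.trans h2⟩) hp.2
  obtain ⟨C, h, hg, -⟩ := B.exists_simplification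
  refine ⟨_, B, ⟨C, h.isSimple, ?_, ?_⟩, ⟨c⟩, ⟨h⟩, rfl⟩
  · rw [hg, c.toCollapse.totalGenus_eq]
    exact hα.genus
  · exact (tropicalDegree_simplification_le h).trans
      ((hα.good.tropicalDegree_contraction_le hp c).trans hα.degree)

end Degree
end CombType

/-! ### Finiteness of the set of types of bounded degree -/

namespace DecoratedGraph
variable {I : Type u} {n : ℕ} (G : DecoratedGraph I n)

theorem dartsOn_univ : G.dartsOn Finset.univ = Finset.univ := by
  ext; simp [mem_dartsOn]

theorem numD_eq : (G.numD : ℤ) = 2 * (G.bettiOn Finset.univ + G.numV - 1) := by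
  have := G.card_dartsOn Finset.univ
  simpa [dartsOn_univ] using this

theorem bettiOn_univ_nonneg : 0 ≤ G.bettiOn Finset.univ :=
  G.bettiOn_nonneg ⟨⟨0, G.numV_pos⟩, Finset.mem_univ _⟩ fun u _ v _ =>
    reflTransGen_imp (fun _ _ ⟨d, h1, h2⟩ => ⟨d, h1, h2, Finset.mem_univ _⟩) (G.connected u v)

theorem sum_genus_le : ∑ v, (G.genus v : ℤ) ≤ G.totalGenus := by
  have := G.bettiOn_univ_nonneg
  unfold totalGenus
  omega

theorem numD_le : (G.numD : ℤ) ≤ 2 * (G.totalGenus + G.numV) := by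
  have h1 := G.numD_eq
  have h2 : 0 ≤ ∑ v, (G.genus v : ℤ) := Finset.sum_nonneg fun _ _ => by positivity
  unfold totalGenus
  omega

theorem sum_numMarks : ∑ v, G.numMarks v = n := by
  have := Finset.card_eq_sum_card_fiberwise (f := G.mark) (s := Finset.univ) (t := Finset.univ)
    (fun _ _ => by simp)
  simpa [numMarks] using this.symm

theorem degree_pos (h : 2 ≤ G.numV) (v : Fin G.numV) : 0 < G.degree v := by
  have : Nontrivial (Fin G.numV) := Fin.nontrivial_iff_two_le.2 h
  obtain ⟨u, hu⟩ := exists_ne v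
  rcases Relation.ReflTransGen.cases_head (G.connected v u) with h | ⟨w, ⟨d, hd, -⟩, -⟩
  · exact absurd h.symm hu
  · exact Finset.card_pos.2 ⟨d, by simpa using hd⟩

theorem isTypeA_of_degree_eq_one {v : Fin G.numV} (h : G.degree v = 1) : G.IsTypeA v := by
  obtain ⟨d, hd⟩ := Finset.card_eq_one.1 h
  rw [IsTypeA, weightSum, hd, Finset.sum_singleton]
  exact G.weight_ne_zero d

open Classical in
/-- The number of vertices of a simple graph is bounded in terms of its genus, the number of marked
points and the number of vertices of type A, by an Euler characteristic argument. -/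
theorem numV_le (hG : G.IsSimple) :
    (G.numV : ℤ) ≤ 2 * G.totalGenus + n + 3 * (Finset.univ.filter G.IsTypeA).card + 1 := by
  have hg : 0 ≤ G.totalGenus :=
    (Finset.sum_nonneg fun _ _ => by positivity).trans G.sum_genus_le
  rcases Nat.lt_or_ge G.numV 2 with h | h
  · have : (G.numV : ℤ) < 2 := by exact_mod_cast h
    linarith [Int.natCast_nonneg n,
      Int.natCast_nonneg (Finset.univ.filter G.IsTypeA).card]
  · have key : ∀ v, (1 : ℤ) ≤ G.degree v - 2 + 2 * G.genus v + G.numMarks v +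
        3 * (if G.IsTypeA v then 1 else 0) := by
      intro v
      have h1 := G.degree_pos h v
      have h2 := hG v
      have h3 := G.isTypeA_of_degree_eq_one (v := v)
      split_ifs with hA
      · omega
      · have : G.degree v ≠ 1 := fun h => hA (h3 h)
        have : ¬ (G.degree v = 2 ∧ G.genus v = 0 ∧ G.numMarks v = 0) :=
          fun h => hA (h2 h.1 h.2.1 h.2.2)
        omega
    have hs := Finset.sum_le_sum fun v (_ : v ∈ Finset.univ) => key v
    simp only [Finset.sum_add_distrib, Finset.sum_sub_distrib, ← Finset.mul_sum] at hs
    have h1 : ∑ v, (G.degree v : ℤ) = G.numD := by exact_mod_cast G.sum_degree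
    have h2 : ∑ v, (G.numMarks v : ℤ) = n := by exact_mod_cast G.sum_numMarks
    have h3 : ∑ v, (if G.IsTypeA v then (1 : ℤ) else 0) =
        (Finset.univ.filter G.IsTypeA).card := by
      rw [Finset.sum_boole]
    rw [h1, h2, h3, G.numD_eq] at hs
    simp only [Finset.sum_const, Finset.card_univ, Fintype.card_fin, nsmul_eq_mul] at hs
    unfold totalGenus
    linarith

/-- The weights of a realizable graph are bounded by the weight sums at the vertices: in the
`j`-th coordinate all edges that leave the sublevel set of the source of `d` have positive weight,
and the sum of these weights is the sum of the weight sums over the sublevel set. -/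
theorem weight_le [Fintype I] {S : ClemensPolytope I} {p : Fin G.numV → I → ℝ}
    (hp : G.IsRealization S p) (d : Fin G.numD) (j : I) :
    (G.weight d j).natAbs ≤ ∑ v, (G.weightSum v j).natAbs := by
  classical
  have key : ∀ d, 0 < G.weight d j → G.weight d j ≤ ∑ v, |G.weightSum v j| := by
    intro d hd
    let W : Finset (Fin G.numV) := Finset.univ.filter fun v => p v j ≤ p (G.src d) j
    have hW : ∀ v, v ∈ W ↔ p v j ≤ p (G.src d) j := fun v => by simp [W]
    have hpar : ∀ e, ∃ l : ℝ, 0 < l ∧ p (G.tgt e) j - p (G.src e) j = l * G.weight e j := by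
      intro e
      obtain ⟨l, hl, h⟩ := hp.parallel e
      exact ⟨l, hl, congrFun h j⟩
    have h1 : ∑ v ∈ W, G.weightSum v j =
        ∑ e ∈ Finset.univ.filter (fun e => G.src e ∈ W ∧ G.tgt e ∉ W), G.weight e j := by
      have e1 := congrFun (G.sum_weightSum W) j
      have e2 := congrFun (G.sum_weight_dartsOn W) j
      rw [Finset.sum_apply, Finset.sum_apply] at e1
      rw [Finset.sum_apply, Pi.zero_apply] at e2
      rw [e1, ← Finset.sum_filter_add_sum_filter_not _ (fun e => G.tgt e ∈ W)]
      simp only [Finset.filter_filter]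
      rw [show (Finset.univ.filter fun e => G.src e ∈ W ∧ G.tgt e ∈ W) = G.dartsOn W from rfl,
        e2, zero_add]
    have h2 : d ∈ Finset.univ.filter (fun e => G.src e ∈ W ∧ G.tgt e ∉ W) := by
      simp only [Finset.mem_filter, Finset.mem_univ, true_and, hW, le_refl, not_le]
      obtain ⟨l, hl, h⟩ := hpar d
      have : (0 : ℝ) < G.weight d j := by exact_mod_cast hd
      have := mul_pos hl this
      linarith
    calc G.weight d j ≤ ∑ v ∈ W, G.weightSum v j := by
          rw [h1]
          refine Finset.single_le_sum (f := fun e => G.weight e j) (fun e he => ?_) h2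
          simp only [Finset.mem_filter, Finset.mem_univ, true_and, hW, not_le] at he
          obtain ⟨l, hl, h⟩ := hpar e
          have h3 : 0 < l * G.weight e j := by linarith [he.1, he.2]
          have h4 := (pos_iff_pos_of_mul_pos h3).1 hl
          exact_mod_cast h4.le
      _ ≤ ∑ v ∈ W, |G.weightSum v j| := Finset.sum_le_sum fun v _ => le_abs_self _
      _ ≤ ∑ v, |G.weightSum v j| :=
          Finset.sum_le_sum_of_subset_of_nonneg (Finset.subset_univ _) fun _ _ _ => abs_nonneg _
  zify
  rcases lt_trichotomy (G.weight d j) 0 with h | h | h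
  · have h1 : G.weight (G.rev d) j = -G.weight d j := by rw [G.weight_rev]; rfl
    have := key (G.rev d) (by omega)
    rw [abs_of_neg h]
    omega
  · rw [h, abs_zero]
    positivity
  · rw [abs_of_pos h]
    exact key d h

end DecoratedGraph

theorem SimpleDensity.exists_pos_le {I : Type u} [Fintype I] [DecidableEq I]
    {S : ClemensPolytope I} (ω : SimpleDensity S) :
    ∃ m : ℝ≥0∞, 0 < m ∧ ∀ F ∈ S.faces, ∀ j ∈ S.link F, m ≤ ω.ω F j := by
  classical
  refine ⟨Finset.univ.inf fun x : Finset I × I =>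
    if x.1 ∈ S.faces ∧ x.2 ∈ S.link x.1 then ω.ω x.1 x.2 else ⊤, ?_, fun F hF j hj => ?_⟩
  · rw [Finset.lt_inf_iff ENNReal.zero_lt_top]
    rintro ⟨F, j⟩ -
    dsimp only
    split_ifs with h
    · exact ω.pos _ h.1 _ h.2
    · exact ENNReal.zero_lt_top
  · refine (Finset.inf_le (Finset.mem_univ (F, j))).trans ?_
    simp [hF, hj]

namespace CombType
variable {I : Type u} {n : ℕ}

/-- The data of a combinatorial type, without the conditions they satisfy. -/
abbrev RawData (I : Type u) (n a b : ℕ) : Type u :=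
  (Fin b → Fin a) × (Fin b → Fin b) × (Fin b → I → ℤ) × (Fin a → ℕ) × (Fin n → Fin a) ×
    (Fin a → Finset I)

/-- The data underlying a combinatorial type. -/
def toRawData (α : CombType I n) : Σ (a : ℕ) (b : ℕ), RawData I n a b :=
  ⟨α.numV, α.numD, α.src, α.rev, α.weight, α.genus, α.mark, α.face⟩

theorem toRawData_injective : Function.Injective (toRawData (I := I) (n := n)) := by
  rintro ⟨⟨a, b, s, r, _, _, _, _, w, _, _, g, m⟩, f, _⟩
    ⟨⟨a', b', s', r', _, _, _, _, w', _, _, g', m'⟩, f', _⟩ h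
  simp only [toRawData, Sigma.mk.injEq] at h
  obtain ⟨rfl, h⟩ := h
  rw [heq_eq_eq, Sigma.mk.injEq] at h
  obtain ⟨rfl, h⟩ := h
  rw [heq_eq_eq] at h
  simp only [Prod.mk.injEq] at h
  obtain ⟨rfl, rfl, rfl, rfl, rfl, rfl⟩ := h
  rfl

theorem finite_of_bounds [Finite I] (N M K L : ℕ) :
    {α : CombType I n | α.numV ≤ N ∧ α.numD ≤ M ∧ (∀ d j, (α.weight d j).natAbs ≤ K) ∧
      ∀ v, α.genus v ≤ L}.Finite := by
  let X : ∀ a b : ℕ, Set (RawData I n a b) := fun a b =>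
    univ ×ˢ univ ×ˢ {w | ∀ d, w d ∈ {x : I → ℤ | ∀ j, x j ∈ Icc (-K : ℤ) K}} ×ˢ
      {x | ∀ v, x v ∈ Iic L} ×ˢ univ ×ˢ univ
  have hX : ∀ a b, (X a b).Finite := fun a b =>
    finite_univ.prod <| finite_univ.prod <|
      (Finite.pi' fun _ => Finite.pi' fun _ => finite_Icc _ _).prod <|
      (Finite.pi' fun _ => finite_Iic _).prod <| finite_univ.prod finite_univ
  have hfin : (⋃ a ∈ Iic N, ⋃ b ∈ Iic M,
      (fun x : RawData I n a b => (⟨a, b, x⟩ : Σ (a : ℕ) (b : ℕ), RawData I n a b)) ''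
        X a b).Finite :=
    (finite_Iic N).biUnion fun a _ => (finite_Iic M).biUnion fun b _ => (hX a b).image _
  refine (hfin.preimage toRawData_injective.injOn).subset ?_
  rintro α ⟨h1, h2, h3, h4⟩
  simp only [mem_preimage, mem_iUnion]
  refine ⟨α.numV, h1, α.numD, h2, _, ?_, rfl⟩
  refine ⟨mem_univ _, mem_univ _, fun d j => ?_, h4, mem_univ _, mem_univ _⟩
  have := h3 d j
  simp only [mem_Icc]
  omega

open DecoratedGraph

theorem finite_isAdmissible [Fintype I] [DecidableEq I] {S : ClemensPolytope I}
    (ω : SimpleDensity S) (g n : ℕ) (A : ℝ) :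
    {α : CombType I n | α.IsAdmissible ω g A}.Finite := by
  classical
  obtain ⟨m, hm, hω⟩ := ω.exists_pos_le
  obtain ⟨K, hK⟩ := ENNReal.exists_nat_gt
    (ENNReal.div_ne_top (ENNReal.ofReal_ne_top (r := A)) hm.ne')
  have hbound : ∀ N : ℕ, (N : ℝ≥0∞) * m ≤ ENNReal.ofReal A → N ≤ K := by
    intro N hN
    have h1 : (N : ℝ≥0∞) ≤ ENNReal.ofReal A / m := by
      rw [ENNReal.le_div_iff_mul_le (.inl hm.ne') (.inr ENNReal.ofReal_ne_top)]
      exact hN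
    exact_mod_cast (h1.trans_lt hK).le
  refine (finite_of_bounds (I := I) (n := n) (2 * g + n + 3 * K + 1)
    (2 * (g + (2 * g + n + 3 * K + 1))) K g).subset ?_
  intro α hα
  have hloc : ∀ v j, ((α.weightSum v j).natAbs : ℝ≥0∞) * m ≤ α.localDegree ω v := by
    intro v j
    by_cases hz : α.weightSum v j = 0
    · simp [hz]
    · have hl := hα.good.mem_link_of_weightSum hz
      refine le_trans ?_ (le_iSup₂ (f := fun j _ =>
        ω.ω (α.face v) j * ((α.weightSum v j).natAbs : ℝ≥0∞)) j hl)
      rw [mul_comm]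
      gcongr
      exact hω _ (hα.good.face_mem v) j hl
  have hA : (Finset.univ.filter α.IsTypeA).card ≤ K := by
    refine hbound _ (le_trans ?_ hα.degree)
    rw [← nsmul_eq_mul, ← Finset.sum_const]
    refine (Finset.sum_le_sum fun v hv => ?_).trans
      (Finset.sum_le_sum_of_subset (Finset.filter_subset _ _))
    simp only [Finset.mem_filter, Finset.mem_univ, true_and] at hv
    obtain ⟨j, hj⟩ := Function.ne_iff.1 hv
    refine le_trans ?_ (hloc v j)
    have : (1 : ℝ≥0∞) ≤ ((α.weightSum v j).natAbs : ℝ≥0∞) := by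
      have : 1 ≤ (α.weightSum v j).natAbs := Int.natAbs_pos.2 hj
      exact_mod_cast this
    calc m = 1 * m := (one_mul m).symm
      _ ≤ _ := by gcongr
  have hV : α.numV ≤ 2 * g + n + 3 * K + 1 := by
    have := α.numV_le hα.simple
    rw [hα.genus] at this
    omega
  refine ⟨hV, ?_, fun d j => ?_, fun v => ?_⟩
  · have := α.numD_le
    rw [hα.genus] at this
    omega
  · obtain ⟨p, hp⟩ := hα.good.realizations_nonempty
    refine (α.weight_le hp.1 d j).trans (hbound _ (le_trans ?_ hα.degree))
    rw [Nat.cast_sum, Finset.sum_mul]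
    exact Finset.sum_le_sum fun v _ => hloc v j
  · have h1 := α.sum_genus_le
    rw [hα.genus] at h1
    have h2 := Finset.single_le_sum (f := fun v => (α.genus v : ℤ)) (fun _ _ => by positivity)
      (Finset.mem_univ v)
    have h3 : (α.genus v : ℤ) ≤ g := h2.trans h1
    exact_mod_cast h3

end CombType

/-! ### Curves of a given type -/

section Rank
variable {I : Type u} {n : ℕ}

/-- The number of vertices plus the sum of the numbers of elements of the sets `I_v`.  It drops
when a family of curves degenerates. -/
def CombType.rank (α : CombType I n) : ℕ := ∑ v, ((α.face v).card + 1)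

theorem CombType.rank_eq_of_isIso {α β : CombType I n}
    {φ : DecoratedGraph.Iso α.toDecoratedGraph β.toDecoratedGraph} (hφ : IsIso α β φ) : α.rank = β.rank :=
  Fintype.sum_equiv φ.vert _ _ fun v => by rw [hφ]

end Rank

section Topology
open DecoratedGraph ClemensPolytope
variable {I : Type u} [Fintype I] {n : ℕ} {S : ClemensPolytope I}

theorem DecoratedGraph.Iso.isRealization {G H : DecoratedGraph I n} (φ : Iso G H)
    {p : Fin H.numV → I → ℝ} (hp : H.IsRealization S p) : G.IsRealization S (p ∘ φ.vert) := by
  refine ⟨fun v => hp.vertex_mem _, fun d => ?_, fun d => ?_⟩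
  · have := hp.edge_mem (φ.dart d)
    rwa [φ.tgt_dart, φ.src_dart] at this
  · have := hp.parallel (φ.dart d)
    rwa [φ.tgt_dart, φ.src_dart, φ.weight_dart] at this

theorem CombType.posSupp_eq {α : CombType I n} {p : Fin α.numV → I → ℝ}
    (hp : p ∈ α.realizations S) (v : Fin α.numV) : posSupp (p v) = α.face v :=
  (mem_openFace_iff.1 (hp.2 v)).2

theorem CombType.mem_realizations_of_posSupp {α : CombType I n} {p : Fin α.numV → I → ℝ}
    (hp : α.IsRealization S p) (h : ∀ v, posSupp (p v) = α.face v) : p ∈ α.realizations S :=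
  ⟨hp, fun v => mem_openFace_iff.2 ⟨(mem_carrier_iff.1 (hp.vertex_mem v)).1, h v⟩⟩

/-- Transport of realizations along an isomorphism of types. -/
theorem CombType.comp_mem_realizations {α β : CombType I n}
    {φ : Iso α.toDecoratedGraph β.toDecoratedGraph} (hφ : IsIso α β φ)
    {p : Fin β.numV → I → ℝ} (hp : p ∈ β.realizations S) : p ∘ φ.vert ∈ α.realizations S :=
  mem_realizations_of_posSupp (φ.isRealization hp.1) fun v => by
    rw [Function.comp, posSupp_eq hp, hφ]

theorem TropCurve.pos_mem_realizations (C : TropCurve S n) : C.pos ∈ C.type.realizations S :=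
  CombType.mem_realizations_of_posSupp (α := C.type) C.isRealization fun _ => rfl

/-- Isomorphic curves have isomorphic types. -/
theorem TropCurve.type_isIso {B C : TropCurve S n}
    {φ : Iso B.toDecoratedGraph C.toDecoratedGraph} (h : ∀ v, C.pos (φ.vert v) = B.pos v) :
    CombType.IsIso B.type C.type φ := fun v => congrArg posSupp (h v)

theorem Simplification.exists_extension {B C : TropCurve S n} (h : Simplification B C)
    {r : Fin C.numV → I → ℝ} (hr : C.IsRealization S r)
    (hs : ∀ v, posSupp (r v) = posSupp (C.pos v)) :
    ∃ q : Fin B.numV → I → ℝ, B.IsRealization S q ∧ (∀ v, posSupp (q v) = posSupp (B.pos v)) ∧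
      q ∘ h.vert = r := by
  obtain ⟨C', h', -, hl⟩ := B.exists_simplification
  obtain ⟨φ, hφ⟩ := h'.exists_iso h
  obtain ⟨q, h1, h2, h3⟩ := hl (r ∘ φ.vert) (φ.isRealization hr) fun k => by
    rw [Function.comp, hs, h'.pos_iso h hφ]
  refine ⟨q, h1, h2, funext fun v => ?_⟩
  obtain ⟨w, rfl⟩ := φ.vert.surjective v
  rw [Function.comp, hφ]
  exact congrFun h3 w

variable [DecidableEq I] {ω : SimpleDensity S} {g : ℕ} {A : ℝ}

theorem SimpleCurve.not_isRemovable (C : SimpleCurve ω g n A) (v : Fin C.1.numV) :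
    ¬ C.1.IsRemovable v := fun h => h.2.2.2 (C.2.1 v h.1 h.2.1 h.2.2.1)

theorem SimpleCurve.type_isAdmissible (C : SimpleCurve ω g n A) :
    C.1.type.IsAdmissible ω g A :=
  ⟨⟨C.1, Setoid.refl _⟩, C.2.1, C.2.2.1, C.2.2.2⟩

theorem SimpleCurve.isLimitOf (C : SimpleCurve ω g n A) :
    IsLimitOf C.1.toDecoratedGraph C.1.pos (Moduli.mk C) :=
  ⟨C.1, C, ⟨(Iso.refl _).toCollapse.toContraction fun _ => rfl⟩,
    ⟨Simplification.refl C.not_isRemovable⟩, rfl⟩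

theorem CombType.isLimit_toStratum {α : CombType I n} (hα : α.IsAdmissible ω g A)
    (p : α.realizations S) : IsLimit α p.1 (α.toStratum hα p).1 :=
  SimpleCurve.isLimitOf (⟨α.curve p, hα.simple, hα.genus, by
    rw [α.type_curve p]; exact hα.degree⟩ : SimpleCurve ω g n A)

theorem Moduli.mk_eq_toStratum {α : CombType I n} (hα : α.IsAdmissible ω g A)
    (C : SimpleCurve ω g n A) {φ : Iso C.1.toDecoratedGraph α.toDecoratedGraph}
    {p : α.realizations S} (h : ∀ v, p.1 (φ.vert v) = C.1.pos v) :
    Moduli.mk C = (α.toStratum hα p).1 :=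
  Moduli.mk_eq_iff.2 ⟨φ, h⟩

theorem CombType.toStratum_surjective {α : CombType I n} (hα : α.IsAdmissible ω g A) :
    Function.Surjective (α.toStratum hα) := by
  rintro ⟨_, C, rfl, hC⟩
  obtain ⟨φ, hφ⟩ := Quotient.exact hC.symm
  refine ⟨⟨C.1.pos ∘ φ.vert, comp_mem_realizations hφ C.1.pos_mem_realizations⟩,
    Subtype.ext (Moduli.mk_eq_toStratum hα C (φ := φ.symm) fun v => ?_).symm⟩
  exact congrArg C.1.pos (φ.vert.apply_symm_apply v)

theorem CombType.toStratum_eq_iff {α : CombType I n} (hα : α.IsAdmissible ω g A)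
    {p q : α.realizations S} : α.toStratum hα p = α.toStratum hα q ↔
      ∃ φ, IsIso α α φ ∧ ∀ v, q.1 (φ.vert v) = p.1 v := by
  rw [Subtype.ext_iff]
  refine Moduli.mk_eq_iff.trans ⟨fun ⟨φ, h⟩ => ⟨φ, fun v => ?_, h⟩, fun ⟨φ, _, h⟩ => ⟨φ, h⟩⟩
  exact (posSupp_eq q.2 (φ.vert v)).symm.trans
    ((congrArg posSupp (h v)).trans (posSupp_eq p.2 v))

theorem mk_mem_stratum_iff {C : SimpleCurve ω g n A} {τ : Quotient (CombType.setoid I n)} :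
    Moduli.mk C ∈ stratum ω g n A τ ↔ Quotient.mk _ C.1.type = τ := by
  refine ⟨?_, fun h => ⟨C, rfl, h⟩⟩
  rintro ⟨D, hD, rfl⟩
  obtain ⟨φ, hφ⟩ := Moduli.mk_eq_iff.1 hD.symm
  exact Quotient.sound ⟨φ, TropCurve.type_isIso hφ⟩

/-- A degeneration of an admissible type `α` has smaller rank, unless it has type `α` itself. -/
theorem CombType.rank_le_of_isLimit {α : CombType I n} (hα : α.IsAdmissible ω g A)
    {p : Fin α.numV → I → ℝ} (hp : p ∈ α.weakRealizations S) {C : SimpleCurve ω g n A}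
    (h : IsLimit α p (Moduli.mk C)) :
    C.1.type.rank ≤ α.rank ∧ (C.1.type.rank = α.rank → p ∈ α.realizations S) := by
  classical
  obtain ⟨B, C', ⟨k⟩, ⟨h⟩, hC⟩ := h
  obtain ⟨φ, hφ⟩ := Moduli.mk_eq_iff.1 hC.symm
  replace h := h.congrRight φ hφ
  choose s hs using k.vert_surjective
  have hsi : Function.Injective s := fun x y hxy => by rw [← hs x, hxy, hs]
  have hti : Function.Injective (s ∘ h.vert) := hsi.comp h.vert_injective
  have hpos : ∀ x, p (s (h.vert x)) = C.1.pos x := fun x => by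
    rw [← k.pos_vert, hs, h.pos_vert]
  have hface' : ∀ x : Fin C.1.numV, C.1.type.face x = posSupp (p (s (h.vert x))) := fun x =>
    congrArg posSupp (hpos x).symm
  have hsub : ∀ x : Fin C.1.numV, C.1.type.face x ⊆ α.face (s (h.vert x)) := fun x => by
    rw [hface']
    exact (mem_closedFace_iff.1 (hp.1 _)).2
  have h1 : ∑ x : Fin C.1.numV, ((C.1.type.face x).card + 1) ≤
      ∑ x : Fin C.1.numV, ((α.face (s (h.vert x))).card + 1) :=
    Finset.sum_le_sum fun x _ => Nat.add_le_add_right (Finset.card_le_card (hsub x)) 1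
  have h2 : ∑ x : Fin C.1.numV, ((α.face (s (h.vert x))).card + 1) =
      ∑ v ∈ Finset.univ.image (s ∘ h.vert), ((α.face v).card + 1) :=
    (Finset.sum_image (f := fun v => (α.face v).card + 1) hti.injOn).symm
  have h3 : ∑ v ∈ Finset.univ.image (s ∘ h.vert), ((α.face v).card + 1) ≤ α.rank :=
    Finset.sum_le_sum_of_subset (Finset.subset_univ _)
  refine ⟨h1.trans (h2.le.trans h3), fun heq => ?_⟩
  have heq' : ∑ x : Fin C.1.numV, ((C.1.type.face x).card + 1) = α.rank := heq
  have hsurj : Function.Surjective (s ∘ h.vert) := by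
    by_contra hns
    rw [Function.Surjective] at hns
    push Not at hns
    obtain ⟨v, hv⟩ := hns
    have : ∑ v ∈ Finset.univ.image (s ∘ h.vert), ((α.face v).card + 1) < α.rank :=
      Finset.sum_lt_sum_of_subset (Finset.subset_univ _) (Finset.mem_univ v)
        (by simpa using hv) (Nat.succ_pos _) fun _ _ _ => Nat.zero_le _
    omega
  have hface : ∀ x : Fin C.1.numV, C.1.type.face x = α.face (s (h.vert x)) := by
    intro x
    refine Finset.eq_of_subset_of_card_le (hsub x) ?_
    by_contra hlt
    have : ∑ x : Fin C.1.numV, ((C.1.type.face x).card + 1) <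
        ∑ x : Fin C.1.numV, ((α.face (s (h.vert x))).card + 1) :=
      Finset.sum_lt_sum (fun x _ => Nat.add_le_add_right (Finset.card_le_card (hsub x)) 1)
        ⟨x, Finset.mem_univ x, by omega⟩
    omega
  have hki : Function.Injective k.vert := by
    intro u v huv
    obtain ⟨x, rfl⟩ := hsurj.of_comp u
    obtain ⟨y, rfl⟩ := hsurj.of_comp v
    rw [hs, hs] at huv
    rw [huv]
  rw [hα.good.mem_realizations_iff]
  refine ⟨fun v => ?_, fun d => ?_⟩
  · obtain ⟨x, rfl⟩ := hsurj v
    refine mem_openFace_iff.2 ⟨(mem_closedFace_iff.1 (hp.1 _)).1, ?_⟩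
    exact (hface' x).symm.trans (hface x)
  · obtain ⟨l, hl, e⟩ := hp.2 d
    refine ⟨l, lt_of_le_of_ne hl ?_, e⟩
    rintro rfl
    rw [zero_smul, sub_eq_zero] at e
    exact α.tgt_ne_src d (hki ((k.vert_eq_iff _ _).2 (.single ⟨d, rfl, rfl, e.symm⟩))).symm

/-- If a degeneration of curves of type `α` to a curve of type `γ` exists, then every curve of type
`γ` is such a degeneration. -/
theorem CombType.exists_isLimit_of_isIso {α γ : CombType I n} (hγ : γ.IsAdmissible ω g A)
    {p : Fin α.numV → I → ℝ} (hp : p ∈ α.weakRealizations S) {C : SimpleCurve ω g n A}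
    (h : IsLimit α p (Moduli.mk C)) {φ : Iso C.1.toDecoratedGraph γ.toDecoratedGraph}
    (hφ : IsIso C.1.type γ φ) (r : γ.realizations S) :
    ∃ q ∈ α.weakRealizations S, IsLimit α q (γ.toStratum hγ r).1 := by
  obtain ⟨B, C', ⟨k⟩, ⟨h⟩, hC⟩ := h
  obtain ⟨ψ, hψ⟩ := Moduli.mk_eq_iff.1 hC.symm
  replace h := h.congrRight ψ hψ
  have hr := comp_mem_realizations hφ r.2
  obtain ⟨q, h1, h2, h3⟩ := h.exists_extension hr.1 (posSupp_eq hr)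
  let B₂ : TropCurve S n := ⟨B.toDecoratedGraph, q, h1⟩
  let C₂ : SimpleCurve ω g n A := ⟨C.1.type.curve ⟨_, hr⟩, C.2.1, C.2.2.1, by
    rw [type_curve]; exact C.2.2.2⟩
  let f : Collapse α.toDecoratedGraph B₂.toDecoratedGraph := k.toCollapse
  refine ⟨q ∘ k.vert, ⟨fun v => ?_, fun d => ?_⟩, B₂, C₂, ⟨f.toContraction fun _ => rfl⟩,
    ⟨⟨h.vert, h.vert_injective, h.range_vert, h.dart, h.dart_injective, h.range_dart, h.src_dart,
      h.rev_dart, h.weight_dart, fun v => (congrFun h3 v).symm, h.genus_vert, h.mark_vert⟩⟩,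
    Moduli.mk_eq_toStratum hγ C₂ (φ := φ) fun v => rfl⟩
  · refine mem_closedFace_iff.2 ⟨(mem_carrier_iff.1 (h1.vertex_mem _)).1, ?_⟩
    rw [Function.comp, h2, k.pos_vert]
    exact (mem_closedFace_iff.1 (hp.1 v)).2
  · by_cases hd : k.vert (α.src d) = k.vert (α.tgt d)
    · exact ⟨0, le_rfl, by simp [hd]⟩
    · obtain ⟨e, rfl⟩ := k.toCollapse.exists_dart hd
      obtain ⟨l, hl, he⟩ := h1.parallel e
      refine ⟨l, hl.le, ?_⟩
      rw [k.toCollapse.tgt_dart, k.toCollapse.src_dart, k.toCollapse.weight_dart] at he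
      exact he

/-! ### The topology of the moduli space -/

/-- The attaching map `ι_α` of the closed polyhedron of `α`. -/
noncomputable def CombType.limit {α : CombType I n} (hα : α.IsAdmissible ω g A)
    (p : closure (α.realizations S)) : Moduli ω g n A :=
  (hα.exists_limit (hα.good.closure_realizations.subset p.2)).choose

theorem CombType.isLimit_limit {α : CombType I n} (hα : α.IsAdmissible ω g A)
    (p : closure (α.realizations S)) : IsLimit α p.1 (limit hα p) :=
  (hα.exists_limit (hα.good.closure_realizations.subset p.2)).choose_spec

theorem CombType.limit_eq_iff {α : CombType I n} (hα : α.IsAdmissible ω g A)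
    {p : closure (α.realizations S)} {c : Moduli ω g n A} :
    limit hα p = c ↔ IsLimit α p.1 c :=
  ⟨fun h => h ▸ isLimit_limit hα p, fun h => IsLimitOf.unique (isLimit_limit hα p) h⟩

theorem CombType.limit_subset_closure {α : CombType I n} (hα : α.IsAdmissible ω g A)
    (p : α.realizations S) :
    limit hα ⟨p.1, subset_closure p.2⟩ = (α.toStratum hα p).1 :=
  (limit_eq_iff hα).2 (isLimit_toStratum hα p)

theorem Moduli.isOpen_iff {U : Set (Moduli ω g n A)} :
    IsOpen U ↔ ∀ (α : CombType I n) (hα : α.IsAdmissible ω g A),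
      IsOpen (CombType.limit hα ⁻¹' U) := by
  rw [isOpen_iSup_iff, Subtype.forall]
  refine forall_congr' fun α => forall_congr' fun hα => ?_
  rw [isOpen_coinduced, isOpen_induced_iff]
  constructor
  · rintro ⟨V, hV, h⟩
    convert hV using 1
    ext p
    let q : LimitGraph α ω g A := ⟨(p, CombType.limit hα p), CombType.isLimit_limit hα p⟩
    exact (Set.ext_iff.1 h q).symm
  · intro h
    refine ⟨_, h, ?_⟩
    ext q
    have : CombType.limit hα q.1.1 = q.1.2 := (CombType.limit_eq_iff hα).2 q.2
    simp only [mem_preimage, this]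

theorem Moduli.isClosed_iff {Z : Set (Moduli ω g n A)} :
    IsClosed Z ↔ ∀ (α : CombType I n) (hα : α.IsAdmissible ω g A),
      IsClosed (CombType.limit hα ⁻¹' Z) := by
  simp only [← isOpen_compl_iff, Moduli.isOpen_iff, preimage_compl]

theorem CombType.continuous_limit {α : CombType I n} (hα : α.IsAdmissible ω g A) :
    Continuous (limit hα) :=
  ⟨fun _ hU => Moduli.isOpen_iff.1 hU α hα⟩

theorem CombType.compactSpace_closure {α : CombType I n} (hα : α.IsAdmissible ω g A) :
    CompactSpace (closure (α.realizations S)) := by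
  rw [hα.good.closure_realizations]
  exact isCompact_iff_compactSpace.1 isCompact_weakRealizations

/-- The pairs of points that are identified in the moduli space form a closed set: it is the union
of closed sets defined by finite data. -/
theorem CombType.isClosed_limit_eq {α β : CombType I n} (hα : α.IsAdmissible ω g A)
    (hβ : β.IsAdmissible ω g A) :
    IsClosed {x : closure (α.realizations S) × closure (β.realizations S) |
      limit hα x.1 = limit hβ x.2} := by
  let D := Set (Fin α.numD) × Set (Fin β.numD) × Set (Fin α.numV × Fin β.numV)
  let X : D → Set (closure (α.realizations S) × closure (β.realizations S)) := fun t =>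
    {x | (∀ d ∈ t.1, x.1.1 (α.src d) = x.1.1 (α.tgt d)) ∧
      (∀ d ∈ t.2.1, x.2.1 (β.src d) = x.2.1 (β.tgt d)) ∧ ∀ y ∈ t.2.2, x.1.1 y.1 = x.2.1 y.2}
  have hX : ∀ t, IsClosed (X t) := by
    intro t
    have c1 : ∀ v, Continuous fun x : closure (α.realizations S) × closure (β.realizations S) =>
        x.1.1 v := fun v => (continuous_apply v).comp (continuous_subtype_val.comp continuous_fst)
    have c2 : ∀ v, Continuous fun x : closure (α.realizations S) × closure (β.realizations S) =>
        x.2.1 v := fun v => (continuous_apply v).comp (continuous_subtype_val.comp continuous_snd)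
    simp only [X, ofPred_and, ofPred_forall]
    exact .inter (isClosed_biInter fun d _ => isClosed_eq (c1 _) (c1 _))
      (.inter (isClosed_biInter fun d _ => isClosed_eq (c2 _) (c2 _))
      (isClosed_biInter fun y _ => isClosed_eq (c1 _) (c2 _)))
  have key : {x : closure (α.realizations S) × closure (β.realizations S) |
      limit hα x.1 = limit hβ x.2} =
      ⋃ t ∈ {t : D | X t ⊆ {x | limit hα x.1 = limit hβ x.2}}, X t := by
    refine Subset.antisymm (fun x hx => ?_) (iUnion₂_subset fun t ht => ht)
    obtain ⟨T, hT, hT'⟩ := IsLimitOf.exists_relation (isLimit_limit hα x.1)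
      ((limit_eq_iff hβ).1 (Eq.symm hx))
    refine mem_iUnion₂.2 ⟨⟨{d | x.1.1 (α.src d) = x.1.1 (α.tgt d)},
      {d | x.2.1 (β.src d) = x.2.1 (β.tgt d)}, T⟩, fun y hy => ?_, fun d hd => hd,
      fun d hd => hd, hT⟩
    exact hT' y.1.1 y.2.1 hy.1 hy.2.1 hy.2.2 _ _ (isLimit_limit hα y.1) (isLimit_limit hβ y.2)
  rw [key]
  exact (Set.toFinite _).isClosed_biUnion fun t _ => hX t

theorem CombType.isClosedMap_limit {α : CombType I n} (hα : α.IsAdmissible ω g A) :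
    IsClosedMap (limit hα) := by
  intro Z hZ
  rw [Moduli.isClosed_iff]
  intro β hβ
  have := compactSpace_closure hα
  have h : limit hβ ⁻¹' (limit hα '' Z) = Prod.snd ''
      ({x : closure (α.realizations S) × closure (β.realizations S) |
        limit hα x.1 = limit hβ x.2} ∩ Prod.fst ⁻¹' Z) := by
    ext q
    constructor
    · rintro ⟨p, hp, h⟩
      exact ⟨(p, q), ⟨h, hp⟩, rfl⟩
    · rintro ⟨⟨p, q⟩, ⟨h, hp⟩, rfl⟩
      exact ⟨p, hp, h⟩
  rw [h]
  exact isClosedMap_snd_of_compactSpace _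
    ((isClosed_limit_eq hα hβ).inter (hZ.preimage continuous_fst))

variable (n ω g A) in
/-- The disjoint union of the closed polyhedra of all admissible types. -/
abbrev ClosedPolyhedra : Type u :=
  Σ α : {α : CombType I n // α.IsAdmissible ω g A}, closure (α.1.realizations S)

/-- The map from the disjoint union of the closed polyhedra to the moduli space. -/
noncomputable def attach (x : ClosedPolyhedra n ω g A) : Moduli ω g n A := CombType.limit x.1.2 x.2

theorem continuous_attach : Continuous (attach : ClosedPolyhedra n ω g A → _) :=
  continuous_sigma fun α => CombType.continuous_limit α.2

variable (n ω g A) in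
theorem finite_admissible : Finite {α : CombType I n // α.IsAdmissible ω g A} :=
  CombType.finite_isAdmissible ω g n A

theorem compactSpace_closedPolyhedra : CompactSpace (ClosedPolyhedra n ω g A) := by
  have := finite_admissible n ω g A
  have := fun α : {α : CombType I n // α.IsAdmissible ω g A} => CombType.compactSpace_closure α.2
  infer_instance

theorem isClosedMap_attach : IsClosedMap (attach : ClosedPolyhedra n ω g A → _) := by
  have := finite_admissible n ω g A
  intro Z hZ
  have : attach '' Z = ⋃ α : {α : CombType I n // α.IsAdmissible ω g A},
      CombType.limit α.2 '' {p | (⟨α, p⟩ : ClosedPolyhedra n ω g A) ∈ Z} := by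
    ext c
    simp only [mem_iUnion, mem_image, mem_ofPred_eq]
    constructor
    · rintro ⟨⟨α, p⟩, h, rfl⟩
      exact ⟨α, p, h, rfl⟩
    · rintro ⟨α, p, h, rfl⟩
      exact ⟨⟨α, p⟩, h, rfl⟩
  rw [this]
  exact isClosed_iUnion_of_finite fun α =>
    CombType.isClosedMap_limit α.2 _ (hZ.preimage continuous_sigmaMk)

theorem attach_surjective : Function.Surjective (attach : ClosedPolyhedra n ω g A → _) := by
  intro c
  obtain ⟨C, rfl⟩ := Quotient.exists_rep c
  exact ⟨⟨⟨C.1.type, C.type_isAdmissible⟩, C.1.pos, subset_closure C.1.pos_mem_realizations⟩,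
    (CombType.limit_eq_iff C.type_isAdmissible).2 C.isLimitOf⟩

theorem compactSpace_moduli : CompactSpace (Moduli ω g n A) :=
  have := compactSpace_closedPolyhedra (ω := ω) (g := g) (n := n) (A := A)
  attach_surjective.compactSpace continuous_attach

/-- The image of a compact Hausdorff space under a closed continuous map is Hausdorff. -/
theorem t2Space_of_isClosedMap {X Y : Type*} [TopologicalSpace X] [TopologicalSpace Y]
    [CompactSpace X] [T2Space X] {f : X → Y} (hf : Continuous f) (hc : IsClosedMap f)
    (hs : Function.Surjective f) : T2Space Y := by
  have hpt : ∀ y, IsClosed {y} := fun y => by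
    obtain ⟨x, rfl⟩ := hs y
    rw [← image_singleton]
    exact hc _ isClosed_singleton
  refine ⟨fun y z hyz => ?_⟩
  obtain ⟨U, V, hU, hV, hyU, hzV, hUV⟩ := normal_separation
    ((hpt y).preimage hf) ((hpt z).preimage hf) (Disjoint.preimage f (by simpa using hyz))
  refine ⟨(f '' Uᶜ)ᶜ, (f '' Vᶜ)ᶜ, (hc _ hU.isClosed_compl).isOpen_compl,
    (hc _ hV.isClosed_compl).isOpen_compl, ?_, ?_, ?_⟩
  · rintro ⟨x, hx, rfl⟩
    exact hx (hyU rfl)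
  · rintro ⟨x, hx, rfl⟩
    exact hx (hzV rfl)
  · rw [disjoint_left]
    intro w hw hw'
    obtain ⟨x, rfl⟩ := hs w
    have h1 : x ∈ U := by_contra fun h => hw ⟨x, h, rfl⟩
    have h2 : x ∈ V := by_contra fun h => hw' ⟨x, h, rfl⟩
    exact disjoint_left.1 hUV h1 h2

theorem t2Space_moduli : T2Space (Moduli ω g n A) :=
  have := compactSpace_closedPolyhedra (ω := ω) (g := g) (n := n) (A := A)
  t2Space_of_isClosedMap continuous_attach isClosedMap_attach attach_surjective

/-! ### Strata -/

theorem CombType.stratum_eq_range {α : CombType I n} (hα : α.IsAdmissible ω g A) :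
    stratum ω g n A (Quotient.mk _ α) = range fun p => (α.toStratum hα p).1 := by
  ext c
  constructor
  · intro hc
    obtain ⟨p, hp⟩ := toStratum_surjective hα ⟨c, hc⟩
    exact ⟨p, congrArg Subtype.val hp⟩
  · rintro ⟨p, rfl⟩
    exact (α.toStratum hα p).2

theorem CombType.closure_stratum {α : CombType I n} (hα : α.IsAdmissible ω g A) :
    closure (stratum ω g n A (Quotient.mk _ α)) = range (limit hα) := by
  apply Subset.antisymm
  · refine closure_minimal ?_ (isClosedMap_limit hα).isClosed_range
    rw [stratum_eq_range hα]
    rintro _ ⟨p, rfl⟩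
    exact ⟨_, limit_subset_closure hα p⟩
  · rintro _ ⟨p, rfl⟩
    have h1 : p ∈ closure (Subtype.val ⁻¹' α.realizations S) := by
      rw [closure_subtype, Subtype.image_preimage_coe, inter_eq_right.2 subset_closure]
      exact p.2
    refine closure_mono ?_ (image_closure_subset_closure_image (continuous_limit hα)
      (mem_image_of_mem _ h1))
    rintro _ ⟨q, hq, rfl⟩
    rw [stratum_eq_range hα]
    exact ⟨⟨q.1, hq⟩, (limit_subset_closure hα ⟨q.1, hq⟩).symm⟩

/-- A point of the closed polyhedron of `α` maps to the closure of the stratum of `α`; it maps to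
a stratum of smaller rank unless it belongs to the open polyhedron. -/
theorem CombType.rank_le_of_limit_mem {α γ : CombType I n} (hα : α.IsAdmissible ω g A)
    {p : closure (α.realizations S)} (h : limit hα p ∈ stratum ω g n A (Quotient.mk _ γ)) :
    γ.rank ≤ α.rank ∧ (γ.rank = α.rank → p.1 ∈ α.realizations S) := by
  obtain ⟨C, hC, hγ⟩ := h
  obtain ⟨φ, hφ⟩ := Quotient.exact hγ
  rw [← rank_eq_of_isIso hφ]
  exact rank_le_of_isLimit hα (hα.good.closure_realizations.subset p.2)
    ((limit_eq_iff hα).1 hC.symm)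

theorem CombType.isLocallyClosed_stratum {α : CombType I n} (hα : α.IsAdmissible ω g A) :
    IsLocallyClosed (stratum ω g n A (Quotient.mk _ α)) := by
  have := finite_admissible n ω g A
  let Z : Set (Moduli ω g n A) := ⋃ γ : {γ : CombType I n // γ.IsAdmissible ω g A},
    ⋃ _ : γ.1.rank < α.rank, closure (stratum ω g n A (Quotient.mk _ γ.1))
  have hZ : IsClosed Z := isClosed_iUnion_of_finite fun γ =>
    isClosed_iUnion_of_finite fun _ => isClosed_closure
  refine ⟨Zᶜ, closure (stratum ω g n A (Quotient.mk _ α)), hZ.isOpen_compl, isClosed_closure, ?_⟩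
  apply Subset.antisymm
  · refine subset_inter (fun c hc hcZ => ?_) subset_closure
    simp only [Z, mem_iUnion] at hcZ
    obtain ⟨γ, hlt, hcγ⟩ := hcZ
    rw [closure_stratum γ.2] at hcγ
    obtain ⟨q, rfl⟩ := hcγ
    exact absurd (rank_le_of_limit_mem γ.2 hc).1 (not_le.2 hlt)
  · rintro c ⟨hcZ, hc⟩
    rw [closure_stratum hα] at hc
    obtain ⟨p, hp⟩ := hc
    obtain ⟨C, rfl⟩ := Quotient.exists_rep c
    have hC : Moduli.mk C ∈ stratum ω g n A (Quotient.mk _ C.1.type) := mk_mem_stratum_iff.2 rfl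
    have h1 := rank_le_of_limit_mem hα (p := p) (γ := C.1.type) (by rw [hp]; exact hC)
    have h2 : C.1.type.rank = α.rank := by
      refine h1.1.antisymm (not_lt.1 fun hlt => hcZ ?_)
      exact mem_iUnion.2 ⟨⟨_, C.type_isAdmissible⟩, mem_iUnion.2 ⟨hlt, subset_closure hC⟩⟩
    rw [← hp, limit_subset_closure hα ⟨p.1, h1.2 h2⟩]
    exact (α.toStratum hα _).2

theorem CombType.stratum_subset_closure {α γ : CombType I n} (hα : α.IsAdmissible ω g A)
    (hγ : γ.IsAdmissible ω g A) (h : (stratum ω g n A (Quotient.mk _ γ) ∩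
      closure (stratum ω g n A (Quotient.mk _ α))).Nonempty) :
    stratum ω g n A (Quotient.mk _ γ) ⊆ closure (stratum ω g n A (Quotient.mk _ α)) := by
  rw [closure_stratum hα] at h ⊢
  obtain ⟨_, ⟨C, hC, hCγ⟩, p, rfl⟩ := h
  obtain ⟨φ, hφ⟩ := Quotient.exact hCγ
  rw [stratum_eq_range hγ]
  rintro _ ⟨r, rfl⟩
  obtain ⟨q, hq, hl⟩ := exists_isLimit_of_isIso hγ (hα.good.closure_realizations.subset p.2)
    ((limit_eq_iff hα).1 hC.symm) hφ r
  rw [← hα.good.closure_realizations] at hq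
  exact ⟨⟨q, hq⟩, (limit_eq_iff hα).2 hl⟩

variable (n ω g A) in
theorem isFiniteStratification_stratum :
    IsFiniteStratification (stratum ω g n A '' admissibleTypes ω g n A) where
  finite := by
    have h := (CombType.finite_isAdmissible ω g n A).image (Quotient.mk (CombType.setoid I n))
    exact h.image _
  isPartition := by
    constructor
    · rintro ⟨_, ⟨α, hα, rfl⟩, h⟩
      obtain ⟨p, hp⟩ := hα.good.realizations_nonempty
      exact h.subset (α.toStratum hα ⟨p, hp⟩).2
    · intro c
      obtain ⟨C, rfl⟩ := Quotient.exists_rep c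
      refine ⟨_, ⟨⟨_, ⟨_, C.type_isAdmissible, rfl⟩, rfl⟩, mk_mem_stratum_iff.2 rfl⟩, ?_⟩
      rintro _ ⟨⟨τ, -, rfl⟩, hc⟩
      rw [← mk_mem_stratum_iff.1 hc]
  isLocallyClosed := by
    rintro _ ⟨_, ⟨α, hα, rfl⟩, rfl⟩
    exact CombType.isLocallyClosed_stratum hα
  frontier := by
    rintro _ ⟨_, ⟨γ, hγ, rfl⟩, rfl⟩ _ ⟨_, ⟨α, hα, rfl⟩, rfl⟩ h
    exact CombType.stratum_subset_closure hα hγ h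

variable (n ω g A) in
theorem injOn_stratum : InjOn (stratum ω g n A) (admissibleTypes ω g n A) := by
  rintro _ ⟨α, hα, rfl⟩ τ _ h
  obtain ⟨p, hp⟩ := hα.good.realizations_nonempty
  obtain ⟨C, hC, hCα⟩ := (α.toStratum hα ⟨p, hp⟩).2
  have h1 : Moduli.mk C ∈ stratum ω g n A (Quotient.mk _ α) := mk_mem_stratum_iff.2 hCα
  rw [h] at h1
  rw [← hCα]
  exact mk_mem_stratum_iff.1 h1

theorem CombType.continuous_toStratum {α : CombType I n} (hα : α.IsAdmissible ω g A) :
    Continuous (α.toStratum hα) := by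
  refine continuous_induced_rng.2 ?_
  have : Subtype.val ∘ α.toStratum hα =
      limit hα ∘ inclusion (subset_closure (s := α.realizations S)) :=
    funext fun p => (limit_subset_closure hα p).symm
  rw [this]
  exact (continuous_limit hα).comp (continuous_inclusion _)

/-- The open polyhedron is the full preimage of the stratum in the closed polyhedron. -/
theorem CombType.isClosedMap_toStratum {α : CombType I n} (hα : α.IsAdmissible ω g A) :
    IsClosedMap (α.toStratum hα) := by
  intro Z hZ
  obtain ⟨W, hW, rfl⟩ := (IsEmbedding.inclusion
    (subset_closure (s := α.realizations S))).isClosed_iff.1 hZ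
  refine isClosed_induced_iff.2 ⟨_, isClosedMap_limit hα _ hW, ?_⟩
  ext c
  constructor
  · rintro ⟨p, hp, hpc⟩
    have h1 : p.1 ∈ α.realizations S :=
      (rank_le_of_limit_mem hα (p := p) (γ := α) (by rw [hpc]; exact c.2)).2 rfl
    refine ⟨⟨p.1, h1⟩, hp, Subtype.ext ?_⟩
    rw [← limit_subset_closure]
    exact hpc
  · rintro ⟨p, hp, rfl⟩
    exact ⟨_, hp, limit_subset_closure hα p⟩

theorem CombType.isOpenMap_toStratum {α : CombType I n} (hα : α.IsAdmissible ω g A) :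
    IsOpenMap (α.toStratum hα) := by
  intro U hU
  -- The saturation of `U` is the union of the translates of `U` by automorphisms of `α`.
  have hsat : IsOpen (α.toStratum hα ⁻¹' (α.toStratum hα '' U)) := by
    have : α.toStratum hα ⁻¹' (α.toStratum hα '' U) =
        ⋃ (φ : Iso α.toDecoratedGraph α.toDecoratedGraph) (hφ : IsIso α α φ),
          (fun p : α.realizations S => (⟨p.1 ∘ φ.vert, comp_mem_realizations hφ p.2⟩ :
            α.realizations S)) ⁻¹' U := by
      ext p
      simp only [mem_preimage, mem_image, mem_iUnion]
      constructor
      · rintro ⟨q, hq, h⟩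
        obtain ⟨φ, hφ, h'⟩ := (toStratum_eq_iff hα).1 h
        refine ⟨φ, hφ, ?_⟩
        convert hq using 1
        exact Subtype.ext (funext h')
      · rintro ⟨φ, hφ, h⟩
        exact ⟨_, h, (toStratum_eq_iff hα).2 ⟨φ, hφ, fun v => rfl⟩⟩
    rw [this]
    refine isOpen_iUnion fun φ => isOpen_iUnion fun hφ => hU.preimage ?_
    refine Continuous.subtype_mk (continuous_pi fun v => ?_) _
    exact (continuous_apply (φ.vert v)).comp continuous_subtype_val
  have h := isClosedMap_toStratum hα _ hsat.isClosed_compl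
  rw [← isClosed_compl_iff]
  rwa [← preimage_compl, image_preimage_eq _ (toStratum_surjective hα)] at h

end Topology
end TropicalModuli

open TropicalModuli in
theorem theorem6p1 {I : Type*} [Fintype I] [DecidableEq I] (S : ClemensPolytope I)
    (ω : SimpleDensity S) (g n : ℕ) (A : ℝ) (hA : 0 < A) :
    -- the attaching maps `ι_α`, which define the topology, are well defined
    (∀ α : CombType I n, α.IsAdmissible ω g A → ∀ p ∈ closure (α.realizations S),
      ∃! c : Moduli ω g n A, IsLimit α p c) ∧
    -- the moduli space is a compact Hausdorff space
    CompactSpace (Moduli ω g n A) ∧ T2Space (Moduli ω g n A) ∧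
    -- it is stratified by combinatorial types, bijectively
    IsFiniteStratification (stratum ω g n A '' admissibleTypes ω g n A) ∧
    Set.InjOn (stratum ω g n A) (admissibleTypes ω g n A) ∧
    -- the strata are open convex polyhedra, up to automorphisms of the combinatorial type
    ∀ (α : CombType I n) (hα : α.IsAdmissible ω g A),
      (α.realizations S).Nonempty ∧
      IsOpenConvexPolyhedron (α.realizations S) ∧
      IsOpenQuotientMap (α.toStratum hα) ∧
      (∀ p q : α.realizations S, α.toStratum hα p = α.toStratum hα q ↔
        ∃ φ, CombType.IsIso α α φ ∧ ∀ v, q.1 (φ.vert v) = p.1 v) ∧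
      ((∀ φ, CombType.IsIso α α φ → ∀ v, φ.vert v = v) → IsHomeomorph (α.toStratum hα)) := by
  refine ⟨fun α hα p hp => ⟨_, CombType.isLimit_limit hα ⟨p, hp⟩, fun c hc =>
    IsLimitOf.unique hc (CombType.isLimit_limit hα ⟨p, hp⟩)⟩, compactSpace_moduli, t2Space_moduli,
    isFiniteStratification_stratum n ω g A, injOn_stratum n ω g A, fun α hα =>
    ⟨hα.good.realizations_nonempty, hα.good.isOpenConvexPolyhedron,
      ⟨CombType.toStratum_surjective hα, CombType.continuous_toStratum hα,
        CombType.isOpenMap_toStratum hα⟩, fun p q => CombType.toStratum_eq_iff hα, fun h => ?_⟩⟩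
  refine ⟨CombType.continuous_toStratum hα, CombType.isOpenMap_toStratum hα, fun p q hpq => ?_,
    CombType.toStratum_surjective hα⟩
  obtain ⟨φ, hφ, hpos⟩ := (CombType.toStratum_eq_iff hα).1 hpq
  refine Subtype.ext (funext fun v => ?_)
  rw [← hpos, h φ hφ]
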